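/- \textbf{Theorem (multivariate discrete second-order Poincar\'e inequality).} Let $p=(p_k)_{k\in\mathbb N}$ with $0<p_k<1$, put $q_k:=1-p_k$, and let $(\Omega,\mathcal F,P)$ be the space $\Omega=\{-1,+1\}^{\mathbb N}$ with the product $\sigma$-algebra and $P=\bigotimes_{k}(p_k\delta_{+1}+q_k\delta_{-1})$. For $F:\Omega\to\mathbb R$ and $k\in\mathbb N$ let $$D_kF:=\sqrt{p_kq_k}\,(F_k^+-F_k^-),$$ where $F_k^{\pm}(\omega)$ is $F$ evaluated at $\omega$ with its $k$-th coordinate replaced by $\pm1$; put $D^m_{k_1,\dots,k_m}F:=D_{k_m}(D^{m-1}_{k_1,\dots,k_{m-1}}F)$ and $D^0F:=F$. Write $F\in\mathrm{dom}(D^m)$ if $F\in L^2(\Omega)$ and $\mathbb E\big[\sum_{k_1,\dots,k_m}(D^m_{k_1,\dots,k_m}F)^2\big]<\infty$, and $\mathrm{dom}(D):=\mathrm{dom}(D^1)$. Let $d\in\mathbb N$ and let $F_1,\dots,F_d:\Omega\to\mathbb R$ satisfy, for all $i$, $F_i\in\mathrm{dom}(D)\cap\mathrm{dom}(D^2)$,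 $\mathbb E[F_i]=0$ and $\mathbb E\big[\|(pq)^{-1/4}DF_i\|_{\ell^4(\mathbb N)}^4\big]=\mathbb E\big[\sum_k (p_kq_k)^{-1}(D_kF_i)^4\big]<\infty$. Put $\mathbf F:=(F_1,\dots,F_d)$, and let $\mathbf N$ be a centred Gaussian random vector in $\mathbb R^d$ with symmetric positive semidefinite covariance matrix $\Sigma=(\Sigma_{ij})_{i,j=1}^d$. For $i,j=1,\dots,d$ define, with values in $[0,\infty]$, \begin{align*} B_1(i,j)&:=\Big(\tfrac{15}{4}\sum_{k,\ell,m}(\mathbb E[(D_kF_i)^2(D_\ell F_i)^2])^{1/2}(\mathbb E[(D_mD_kF_j)^2(D_mD_\ell F_j)^2])^{1/2}\Big)^{1/2},\\ B_2(i,j)&:=\Big(\tfrac34\sum_{k,\ell,m}\tfrac1{p_mq_m}(\mathbb E[(D_mD_kF_i)^2(D_mD_\ell F_i)^2])^{1/2}(\mathbb E[(D_mD_kF_j)^2(D_mD_\ell F_j)^2])^{1/2}\Big)^{1/2},\\ B_3(i,j)&:=\tfrac12 d^{3/2}\sum_k\tfrac{|p_k-q_k|}{\sqrt{p_kq_k}}(\mathbb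 E[(D_kF_i)^2])^{1/2}(\mathbb E[(D_kF_j)^4])^{1/2},\\ B_4(i,j)&:=\tfrac5{12}d^2\sum_k\tfrac1{p_kq_k}(\mathbb E[(D_kF_i)^4])^{1/4}(\mathbb E[(D_kF_j)^4])^{3/4}, \end{align*} all sums being over $\mathbb N$. Then $$d_4(\mathbf F,\mathbf N)\le\frac12\sum_{i,j=1}^d\Big[|\Sigma_{ij}-\mathrm{cov}(F_i,F_j)|+B_1(i,j)+B_2(i,j)+B_3(i,j)+B_4(i,j)\Big].$$ Here $d_4(\mathbf X,\mathbf Y):=\sup_g|\mathbb E[g(\mathbf X)]-\mathbb E[g(\mathbf Y)]|$, where the supremum runs over all $g:\mathbb R^d\to\mathbb R$ all of whose iterated partial derivatives of order at most four exist everywhere and which satisfy $M_1(g),M_2(g),M_3(g),M_4(g)\le1$, with $M_n(g):=\max_{1\le i_1,\dots,i_n\le d}\big\|\tfrac{\partial^n g}{\partial x_{i_1}\cdots\partial x_{i_n}}\big\|_\infty$. -/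

import Mathlib

open MeasureTheory ProbabilityTheory
open scoped ENNReal

noncomputable section

namespace Rademacher

/-- The canonical space `{-1, +1}^ℕ` with its product σ-algebra
(the group `ℤˣ` of units of `ℤ` is the set `{-1, +1}`). -/
abbrev Space : Type := ℕ → ℤˣ

/-- The σ-algebra on `{-1, +1}` is the power set. -/
instance instDiscreteSign : DiscreteMeasurableSpace ℤˣ :=
  ⟨fun s => ⟨Units.val '' s, trivial, Set.preimage_image_eq s Units.val_injective⟩⟩

/-- The law `⨂ₖ (pₖ δ₊₁ + qₖ δ₋₁)`, `qₖ = 1 - pₖ`, of a Rademacher sequence with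
success probabilities `p`. -/
def law (p : ℕ → ℝ) : Measure Space :=
  Measure.infinitePi fun k =>
    ENNReal.ofReal (p k) • Measure.dirac (1 : ℤˣ) +
      ENNReal.ofReal (1 - p k) • Measure.dirac (-1 : ℤˣ)

theorem isProbabilityMeasure_factor {r : ℝ} (hr : r ∈ Set.Ioo (0 : ℝ) 1) :
    IsProbabilityMeasure (ENNReal.ofReal r • Measure.dirac (1 : ℤˣ) +
      ENNReal.ofReal (1 - r) • Measure.dirac (-1 : ℤˣ)) := by
  constructor
  simp [← ENNReal.ofReal_add hr.1.le (sub_nonneg.2 hr.2.le)]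

theorem isProbabilityMeasure_law {p : ℕ → ℝ} (hp : ∀ k, p k ∈ Set.Ioo (0 : ℝ) 1) :
    IsProbabilityMeasure (law p) := by
  have := fun k => isProbabilityMeasure_factor (hp k)
  unfold law
  infer_instance

/-- The discrete Malliavin derivative `Dₖ F = √(pₖ qₖ) (Fₖ⁺ - Fₖ⁻)`, where `Fₖ^±` is `F`
evaluated after replacing the `k`-th coordinate by `±1`. -/
def D (p : ℕ → ℝ) (k : ℕ) (F : Space → ℝ) : Space → ℝ := fun ω =>
  √(p k * (1 - p k)) * (F (Function.update ω k 1) - F (Function.update ω k (-1)))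

/-- The iterated derivative `D^m_{k₁,…,kₘ} F = D_{kₘ} (D^{m-1}_{k₁,…,k_{m-1}} F)`, `D⁰ F = F`. -/
def iterD (p : ℕ → ℝ) : (m : ℕ) → (Fin m → ℕ) → (Space → ℝ) → Space → ℝ
  | 0, _, F => F
  | m + 1, k, F => D p (k (Fin.last m)) (iterD p m (fun i => k i.castSucc) F)

/-- The expectation, in `[0, ∞]`, of a nonnegative random variable. -/
def expect (p : ℕ → ℝ) (Z : Space → ℝ) : ℝ≥0∞ :=
  ∫⁻ ω, ENNReal.ofReal (Z ω) ∂(law p)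

/-- `F ∈ dom(D^m)`: `F` is square integrable and `𝔼 ‖D^m F‖²_{ℓ²(ℕ)^{⊗m}} < ∞`. -/
def MemDom (p : ℕ → ℝ) (m : ℕ) (F : Space → ℝ) : Prop :=
  MemLp F 2 (law p) ∧
    ∫⁻ ω, ∑' k : Fin m → ℕ, ENNReal.ofReal (iterD p m k F ω ^ 2) ∂(law p) < ∞

/-- `𝔼 ‖(pq)^{-1/4} D F‖⁴_{ℓ⁴(ℕ)} < ∞`. -/
def FiniteFourth (p : ℕ → ℝ) (F : Space → ℝ) : Prop :=
  ∫⁻ ω, ∑' k : ℕ,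
    ENNReal.ofReal (((p k * (1 - p k)) ^ (-(1 / 4) : ℝ) * D p k F ω) ^ 4) ∂(law p) < ∞

/-- `B₁` for a pair of functionals `F = F_i`, `G = F_j`. -/
def B₁ (p : ℕ → ℝ) (F G : Space → ℝ) : ℝ≥0∞ :=
  ((15 / 4) * ∑' (k : ℕ) (l : ℕ) (m : ℕ),
    expect p (fun ω => D p k F ω ^ 2 * D p l F ω ^ 2) ^ (1 / 2 : ℝ) *
    expect p (fun ω => D p m (D p k G) ω ^ 2 * D p m (D p l G) ω ^ 2) ^ (1 / 2 : ℝ))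
      ^ (1 / 2 : ℝ)

/-- `B₂` for a pair of functionals `F = F_i`, `G = F_j`. -/
def B₂ (p : ℕ → ℝ) (F G : Space → ℝ) : ℝ≥0∞ :=
  ((3 / 4) * ∑' (k : ℕ) (l : ℕ) (m : ℕ),
    ENNReal.ofReal (1 / (p m * (1 - p m))) *
    expect p (fun ω => D p m (D p k F) ω ^ 2 * D p m (D p l F) ω ^ 2) ^ (1 / 2 : ℝ) *
    expect p (fun ω => D p m (D p k G) ω ^ 2 * D p m (D p l G) ω ^ 2) ^ (1 / 2 : ℝ))
      ^ (1 / 2 : ℝ)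

/-- `B₃` for a pair of functionals `F = F_i`, `G = F_j` of a `d`-dimensional vector. -/
def B₃ (p : ℕ → ℝ) (d : ℕ) (F G : Space → ℝ) : ℝ≥0∞ :=
  (1 / 2) * (d : ℝ≥0∞) ^ (3 / 2 : ℝ) * ∑' k : ℕ,
    ENNReal.ofReal (|p k - (1 - p k)| / √(p k * (1 - p k))) *
    expect p (fun ω => D p k F ω ^ 2) ^ (1 / 2 : ℝ) *
    expect p (fun ω => D p k G ω ^ 4) ^ (1 / 2 : ℝ)

/-- `B₄` for a pair of functionals `F = F_i`, `G = F_j` of a `d`-dimensional vector. -/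
def B₄ (p : ℕ → ℝ) (d : ℕ) (F G : Space → ℝ) : ℝ≥0∞ :=
  (5 / 12) * (d : ℝ≥0∞) ^ 2 * ∑' k : ℕ,
    ENNReal.ofReal (1 / (p k * (1 - p k))) *
    expect p (fun ω => D p k F ω ^ 4) ^ (1 / 4 : ℝ) *
    expect p (fun ω => D p k G ω ^ 4) ^ (3 / 4 : ℝ)

end Rademacher

namespace D4

variable {d : ℕ}

/-- The partial derivative `∂g/∂x_i` (with value `0` where it does not exist). -/
def pderiv (i : Fin d) (g : EuclideanSpace ℝ (Fin d) → ℝ) : EuclideanSpace ℝ (Fin d) → ℝ :=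
  fun x => lineDeriv ℝ g x (EuclideanSpace.single i 1)

/-- The iterated partial derivative `∂^n g / ∂x_{i₁} ⋯ ∂x_{iₙ}`. -/
def iterPderiv : (n : ℕ) → (Fin n → Fin d) → (EuclideanSpace ℝ (Fin d) → ℝ) →
    EuclideanSpace ℝ (Fin d) → ℝ
  | 0, _, g => g
  | n + 1, i, g => pderiv (i 0) (iterPderiv n (fun j => i j.succ) g)

/-- `g` is `n` times partially differentiable: all iterated partial derivatives of order at most
`n` exist at every point. -/
def PartiallyDifferentiable (n : ℕ) (g : EuclideanSpace ℝ (Fin d) → ℝ) : Prop :=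
  ∀ m < n, ∀ (i : Fin m → Fin d) (j : Fin d) (x : EuclideanSpace ℝ (Fin d)),
    LineDifferentiableAt ℝ (iterPderiv m i g) x (EuclideanSpace.single j 1)

/-- `Mₙ(g)`: the largest supremum norm of an iterated partial derivative of order `n`. -/
def M (n : ℕ) (g : EuclideanSpace ℝ (Fin d) → ℝ) : ℝ≥0∞ :=
  ⨆ (i : Fin n → Fin d) (x : EuclideanSpace ℝ (Fin d)), ENNReal.ofReal |iterPderiv n i g x|

/-- The test functions of the `d₄`-distance. -/
def IsTest (g : EuclideanSpace ℝ (Fin d) → ℝ) : Prop :=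
  PartiallyDifferentiable 4 g ∧ M 1 g ≤ 1 ∧ M 2 g ≤ 1 ∧ M 3 g ≤ 1 ∧ M 4 g ≤ 1

/-- The `d₄`-distance between (the laws of) two integrable random vectors `X` and `Y`. Test
functions are Lipschitz, so that both expectations exist. -/
def dist {Ω Ω' : Type*} [MeasurableSpace Ω] [MeasurableSpace Ω']
    (X : Ω → EuclideanSpace ℝ (Fin d)) (μ : Measure Ω)
    (Y : Ω' → EuclideanSpace ℝ (Fin d)) (ν : Measure Ω') : ℝ≥0∞ :=
  ⨆ (g : EuclideanSpace ℝ (Fin d) → ℝ) (_ : IsTest g),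
    ENNReal.ofReal |∫ ω, g (X ω) ∂μ - ∫ ω, g (Y ω) ∂ν|

end D4

end

/-! The proof joins a discrete Malliavin covariance formula to a Gaussian interpolation. It is
carried out for finitely many coordinates and then passed to the limit.

Fix a finite set s of coordinates and let f_i = `avg p s (F i)` be the conditional expectation of
F_i. When a coordinate k joins a set A, the number E[G · E[F|A]] grows by E[D_k G · E[D_k F|A]]
(`integral_mul_avg_insert`). Averaging this telescoping sum over all orders in which s can be built
up gives the covariance formula `integral_mul_avg_sub`, in which `mix` averages conditional
expectations over random subsets of s. The weights are Beta integrals, so that `mix` of D_k F is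
Mehler's formula for −D_k L⁻¹ f. Taking both functions equal gives the Poincaré inequality
`poincare`.

Now take G = ∂_i h(f) for a smooth h. The discrete chain rule `abs_D_comp_sub_le` replaces D_k(∂_i
h(f)) by the sum over j of ∂_ij h(f), averaged over coordinate k, times D_k f_j; the remainders
produce B₃ and B₄. What is left is E[∂_ij h(f) Γ_ij] with Γ = `carre`, whose mean is E[f_i f_j]. The
deviation E|Γ − EΓ| is at most the standard deviation of Γ, which the Poincaré inequality and the
product rule `D_mul` bound by the quantities in B₁ and B₂ (`integral_abs_carre_sub_le`). The outcome
is an approximate Stein equation with an error R (`abs_stein_le`).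

To compare E g(f) with E g(N), differentiate E g(sin θ · f + cos θ · N) with N independent of f.
After Gaussian integration by parts the derivative is cos θ times a Stein expression for the
function x ↦ g(sin θ · x + c), hence at most R sin θ cos θ in modulus; integration over [0, π/2]
gives R/2 (`IsTest.abs_integral_sub_integral_le`).

Conditional expectations and `mix` contract L² and L⁴, so R involves only derivatives of the F_i
themselves, in partial sums of the series of the theorem. Finally s increases to ℕ, and f_i tends to
F_i in L². -/

noncomputable section

/-! ### The product law under freezing and resampling of coordinates. -/

namespace Rademacher

variable {p : ℕ → ℝ} [hp : Fact (∀ k, p k ∈ Set.Ioo (0 : ℝ) 1)]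

instance : IsProbabilityMeasure (law p) := isProbabilityMeasure_law hp.out

theorem measurable_update_sign (k : ℕ) (e : ℤˣ) :
    Measurable fun ω : Space => Function.update ω k e := by
  refine measurable_pi_lambda _ fun i => ?_
  by_cases h : i = k
  · subst h; simp
  · simpa [Function.update_of_ne h] using measurable_pi_apply i

/-- Resampling one coordinate independently does not change a product law. It suffices to check
finite rectangles, where only the factor at k is affected. -/
theorem law_eq_add_map_update (k : ℕ) :
    law p = ENNReal.ofReal (p k) • (law p).map (fun ω => Function.update ω k 1) +
      ENNReal.ofReal (1 - p k) • (law p).map (fun ω => Function.update ω k (-1)) := by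
  have hprob := fun k => isProbabilityMeasure_factor (hp.out k)
  symm
  unfold law
  refine Measure.eq_infinitePi _ fun s t ht => ?_
  have key : ∀ e : ℤˣ, (law p).map (fun ω => Function.update ω k e) (Set.pi s t) =
      if k ∈ s then (t k).indicator 1 e * ∏ i ∈ s.erase k,
        (ENNReal.ofReal (p i) • Measure.dirac (1 : ℤˣ) +
          ENNReal.ofReal (1 - p i) • Measure.dirac (-1 : ℤˣ)) (t i)
      else ∏ i ∈ s, (ENNReal.ofReal (p i) • Measure.dirac (1 : ℤˣ) +
          ENNReal.ofReal (1 - p i) • Measure.dirac (-1 : ℤˣ)) (t i) := by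
    intro e
    have hms : MeasurableSet (Set.pi (s : Set ℕ) t) :=
      MeasurableSet.pi s.countable_toSet fun i _ => ht i
    rw [Measure.map_apply (measurable_update_sign k e) hms]
    by_cases hk : k ∈ s
    · rw [if_pos hk]
      by_cases he : e ∈ t k
      · have : (fun ω : Space => Function.update ω k e) ⁻¹' (Set.pi s t) =
            Set.pi (s.erase k : Finset ℕ) t := by
          ext ω
          simp only [Set.mem_preimage, Set.mem_pi, Finset.mem_coe, Finset.mem_erase]
          constructor
          · intro h i hi
            simpa [Function.update_of_ne hi.1] using h i hi.2
          · intro h i hi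
            by_cases hik : i = k
            · subst hik; simpa using he
            · simpa [Function.update_of_ne hik] using h i ⟨hik, hi⟩
        rw [this]
        unfold law
        rw [Measure.infinitePi_pi _ (fun i _ => ht i)]
        simp [he]
      · have : (fun ω : Space => Function.update ω k e) ⁻¹' (Set.pi s t) = ∅ := by
          ext ω
          simp only [Set.mem_preimage, Set.mem_pi, Finset.mem_coe, Set.mem_empty_iff_false,
            iff_false]
          intro h
          exact he (by simpa using h k hk)
        simp [this, he]
    · rw [if_neg hk]
      have : (fun ω : Space => Function.update ω k e) ⁻¹' (Set.pi s t) = Set.pi s t := by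
        ext ω
        simp only [Set.mem_preimage, Set.mem_pi, Finset.mem_coe]
        refine forall₂_congr fun i hi => ?_
        have hik : i ≠ k := fun h => hk (h ▸ hi)
        simp [Function.update_of_ne hik]
      rw [this]
      unfold law
      rw [Measure.infinitePi_pi _ (fun i _ => ht i)]
  change (ENNReal.ofReal (p k) • (law p).map (fun ω => Function.update ω k 1) +
      ENNReal.ofReal (1 - p k) • (law p).map (fun ω => Function.update ω k (-1))) _ = _
  rw [Measure.add_apply, Measure.smul_apply, Measure.smul_apply, key, key]
  by_cases hk : k ∈ s
  · rw [if_pos hk, if_pos hk, ← Finset.mul_prod_erase _ _ hk]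
    simp [ht k, add_mul, mul_assoc]
  · rw [if_neg hk, if_neg hk, smul_eq_mul, smul_eq_mul, ← add_mul,
      ← ENNReal.ofReal_add (hp.out k).1.le (sub_nonneg.2 (hp.out k).2.le)]
    simp

/-- Both signs have positive probability, so each summand of the resampling identity is dominated by
the law. Freezing a coordinate therefore respects null sets and integrability, which matters because
the functionals are only almost everywhere measurable. -/
theorem exists_map_update_le (k : ℕ) (e : ℤˣ) :
    ∃ c : ℝ≥0∞, c ≠ ∞ ∧ (law p).map (fun ω => Function.update ω k e) ≤ c • law p := by
  have aux : ∀ (r : ℝ) (μ ν : Measure Space), 0 < r → ENNReal.ofReal r • μ ≤ ν →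
      ∃ c : ℝ≥0∞, c ≠ ∞ ∧ μ ≤ c • ν := by
    intro r μ ν hr h
    refine ⟨(ENNReal.ofReal r)⁻¹, by simpa using hr, ?_⟩
    intro s
    have := h s
    simp only [Measure.smul_apply, smul_eq_mul] at this ⊢
    rw [← ENNReal.mul_le_iff_le_inv (by simpa using hr) ENNReal.ofReal_ne_top]
    exact this
  have h := law_eq_add_map_update (p := p) k
  rcases Int.units_eq_one_or e with rfl | rfl
  · refine aux (p k) _ _ (hp.out k).1 ?_
    conv_rhs => rw [h]
    exact Measure.le_add_right le_rfl
  · refine aux (1 - p k) _ _ (sub_pos.2 (hp.out k).2) ?_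
    conv_rhs => rw [h]
    exact Measure.le_add_left le_rfl

theorem measurable_piecewise_left (A : Finset ℕ) (ω : Space) :
    Measurable fun ω' : Space => A.piecewise ω ω' := by
  refine measurable_pi_lambda _ fun i => ?_
  by_cases h : i ∈ A
  · simp [h]
  · simpa [h] using measurable_pi_apply i

theorem exists_map_piecewise_le (A : Finset ℕ) (ω : Space) :
    ∃ c : ℝ≥0∞, c ≠ ∞ ∧ (law p).map (fun ω' => A.piecewise ω ω') ≤ c • law p := by
  induction A using Finset.induction_on with
  | empty => exact ⟨1, by simp, by simp⟩
  | insert k A hk ih =>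
    obtain ⟨c, hc, h⟩ := ih
    obtain ⟨c', hc', h'⟩ := exists_map_update_le (p := p) k (ω k)
    refine ⟨c * c', ENNReal.mul_ne_top hc hc', ?_⟩
    have : (fun ω' : Space => (insert k A).piecewise ω ω') =
        (fun ω' => Function.update ω' k (ω k)) ∘ fun ω' => A.piecewise ω ω' := by
      ext1 ω'; exact Finset.piecewise_insert _ _ _ _
    rw [this, ← Measure.map_map (measurable_update_sign _ _) (measurable_piecewise_left _ _)]
    refine (Measure.map_mono h (measurable_update_sign _ _)).trans ?_
    rw [Measure.map_smul, mul_smul]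
    intro s
    simp only [Measure.smul_apply, smul_eq_mul]
    exact mul_le_mul_right (h' s) c

theorem _root_.MeasureTheory.MemLp.comp_update {u : Space → ℝ} {r : ℝ≥0∞}
    (hu : MemLp u r (law p)) (k : ℕ) (e : ℤˣ) :
    MemLp (fun ω => u (Function.update ω k e)) r (law p) := by
  obtain ⟨c, hc, h⟩ := exists_map_update_le (p := p) k e
  have := (hu.smul_measure hc).mono_measure h
  exact this.comp_of_map (measurable_update_sign k e).aemeasurable

theorem _root_.MeasureTheory.MemLp.comp_piecewise {u : Space → ℝ} {r : ℝ≥0∞}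
    (hu : MemLp u r (law p)) (A : Finset ℕ) (ω : Space) :
    MemLp (fun ω' => u (A.piecewise ω ω')) r (law p) := by
  obtain ⟨c, hc, h⟩ := exists_map_piecewise_le (p := p) A ω
  have := (hu.smul_measure hc).mono_measure h
  exact this.comp_of_map (measurable_piecewise_left A ω).aemeasurable

theorem _root_.MeasureTheory.Integrable.comp_update {u : Space → ℝ}
    (hu : Integrable u (law p)) (k : ℕ) (e : ℤˣ) :
    Integrable (fun ω => u (Function.update ω k e)) (law p) :=
  memLp_one_iff_integrable.1 ((memLp_one_iff_integrable.2 hu).comp_update k e)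

theorem _root_.MeasureTheory.Integrable.comp_piecewise {u : Space → ℝ}
    (hu : Integrable u (law p)) (A : Finset ℕ) (ω : Space) :
    Integrable (fun ω' => u (A.piecewise ω ω')) (law p) :=
  memLp_one_iff_integrable.1 ((memLp_one_iff_integrable.2 hu).comp_piecewise A ω)

theorem integral_eq_update {u : Space → ℝ} (hu : Integrable u (law p)) (k : ℕ) :
    ∫ ω, u ω ∂law p = p k * ∫ ω, u (Function.update ω k 1) ∂law p +
      (1 - p k) * ∫ ω, u (Function.update ω k (-1)) ∂law p := by
  have hle : ∀ e, Integrable u ((law p).map fun ω => Function.update ω k e) := fun e => by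
    obtain ⟨c, hc, h⟩ := exists_map_update_le (p := p) k e
    exact (hu.smul_measure hc).mono_measure h
  have hmap : ∀ e, ∫ ω, u ω ∂((law p).map fun ω => Function.update ω k e) =
      ∫ ω, u (Function.update ω k e) ∂law p := fun e =>
    integral_map (measurable_update_sign k e).aemeasurable (hle e).aestronglyMeasurable
  conv_lhs => rw [law_eq_add_map_update k]
  rw [integral_add_measure ((hle _).smul_measure ENNReal.ofReal_ne_top)
    ((hle _).smul_measure ENNReal.ofReal_ne_top), integral_smul_measure, integral_smul_measure,
    hmap, hmap, ENNReal.toReal_ofReal (hp.out k).1.le,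
    ENNReal.toReal_ofReal (sub_nonneg.2 (hp.out k).2.le)]
  simp

end Rademacher

end

/-! ### Cylinder functions and conditional expectations. -/

noncomputable section

namespace Rademacher

variable {p : ℕ → ℝ} [hp : Fact (∀ k, p k ∈ Set.Ioo (0 : ℝ) 1)]

/-- Functions of finitely many coordinates. -/
def Cylinder (u : Space → ℝ) : Prop := ∃ A : Finset ℕ, DependsOn u (A : Set ℕ)

namespace Cylinder

variable {u v : Space → ℝ}

theorem exists_comp (hu : Cylinder u) :
    ∃ (A : Finset ℕ) (g : (A → ℤˣ) → ℝ), u = fun ω => g fun i => ω i := by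
  obtain ⟨A, hA⟩ := hu
  obtain ⟨g, hg⟩ := dependsOn_iff_exists_comp.1 hA
  exact ⟨A, g, hg⟩

theorem measurable (hu : Cylinder u) : Measurable u := by
  obtain ⟨A, g, rfl⟩ := hu.exists_comp
  exact (measurable_of_finite g).comp (measurable_pi_lambda _ fun i => measurable_pi_apply _)

theorem exists_bound (hu : Cylinder u) : ∃ c, ∀ ω, |u ω| ≤ c := by
  obtain ⟨A, g, rfl⟩ := hu.exists_comp
  obtain ⟨c, hc⟩ := (Set.finite_range fun x => |g x|).bddAbove
  exact ⟨c, fun ω => hc ⟨_, rfl⟩⟩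

theorem memLp (hu : Cylinder u) (r : ℝ≥0∞) : MemLp u r (law p) := by
  obtain ⟨c, hc⟩ := hu.exists_bound
  exact MemLp.of_bound hu.measurable.aestronglyMeasurable c (ae_of_all _ hc)

theorem integrable (hu : Cylinder u) : Integrable u (law p) :=
  memLp_one_iff_integrable.1 (hu.memLp 1)

theorem comp_family {ι : Type*} [Finite ι] {f : ι → Space → ℝ} (hf : ∀ i, Cylinder (f i))
    (φ : (ι → ℝ) → ℝ) : Cylinder fun ω => φ fun i => f i ω := by
  have := Fintype.ofFinite ι
  choose A hA using hf
  refine ⟨Finset.univ.biUnion A, fun x y h => congrArg φ (funext fun i => hA i fun j hj => h j ?_)⟩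
  simp only [Finset.coe_biUnion, Set.mem_iUnion]
  exact ⟨i, by simp, hj⟩

theorem const (c : ℝ) : Cylinder fun _ => c := ⟨∅, fun _ _ _ => rfl⟩

theorem comp (hu : Cylinder u) (φ : ℝ → ℝ) : Cylinder fun ω => φ (u ω) := by
  obtain ⟨A, hA⟩ := hu
  exact ⟨A, fun x y h => congrArg φ (hA h)⟩

theorem comp₂ (hu : Cylinder u) (hv : Cylinder v) (φ : ℝ → ℝ → ℝ) :
    Cylinder fun ω => φ (u ω) (v ω) := by
  obtain ⟨A, hA⟩ := hu
  obtain ⟨B, hB⟩ := hv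
  refine ⟨A ∪ B, fun x y h => ?_⟩
  change φ (u x) (v x) = φ (u y) (v y)
  rw [hA fun i hi => h i (by simp [Finset.mem_coe.1 hi]),
    hB fun i hi => h i (by simp [Finset.mem_coe.1 hi])]

theorem add (hu : Cylinder u) (hv : Cylinder v) : Cylinder fun ω => u ω + v ω :=
  hu.comp₂ hv (· + ·)

theorem sub (hu : Cylinder u) (hv : Cylinder v) : Cylinder fun ω => u ω - v ω :=
  hu.comp₂ hv (· - ·)

theorem mul (hu : Cylinder u) (hv : Cylinder v) : Cylinder fun ω => u ω * v ω :=
  hu.comp₂ hv (· * ·)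

theorem const_mul (hu : Cylinder u) (c : ℝ) : Cylinder fun ω => c * u ω := hu.comp (c * ·)

theorem pow (hu : Cylinder u) (n : ℕ) : Cylinder fun ω => u ω ^ n := hu.comp (· ^ n)

theorem abs (hu : Cylinder u) : Cylinder fun ω => |u ω| := hu.comp (|·|)

theorem sum {ι : Type*} (s : Finset ι) {f : ι → Space → ℝ} (hf : ∀ i ∈ s, Cylinder (f i)) :
    Cylinder fun ω => ∑ i ∈ s, f i ω := by
  classical
  induction s using Finset.induction_on with
  | empty => simpa using const 0
  | insert a s ha ih =>
    simp only [Finset.sum_insert ha]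
    exact (hf a (by simp)).add (ih fun i hi => hf i (by simp [hi]))

theorem update (hu : Cylinder u) (k : ℕ) (e : ℤˣ) :
    Cylinder fun ω => u (Function.update ω k e) := by
  obtain ⟨A, hA⟩ := hu
  refine ⟨A, fun x y h => hA fun i hi => ?_⟩
  by_cases hik : i = k
  · subst hik; simp
  · simp [Function.update_of_ne hik, h i hi]

theorem D (hu : Cylinder u) (k : ℕ) : Cylinder (D p k u) :=
  ((hu.update k 1).sub (hu.update k (-1))).const_mul _

end Cylinder

theorem _root_.MeasureTheory.MemLp.rademacherD {u : Space → ℝ} {r : ℝ≥0∞}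
    (hu : MemLp u r (law p)) (k : ℕ) : MemLp (D p k u) r (law p) :=
  ((hu.comp_update k 1).sub (hu.comp_update k (-1))).const_mul _

theorem _root_.MeasureTheory.Integrable.rademacherD {u : Space → ℝ}
    (hu : Integrable u (law p)) (k : ℕ) : Integrable (D p k u) (law p) :=
  ((hu.comp_update k 1).sub (hu.comp_update k (-1))).const_mul _

@[simp]
theorem D_update (k : ℕ) (u : Space → ℝ) (ω : Space) (e : ℤˣ) :
    D p k u (Function.update ω k e) = D p k u ω := by
  simp [D]

theorem sqrt_mul_sqrt_pq (k : ℕ) : √(p k * (1 - p k)) * √(p k * (1 - p k)) = p k * (1 - p k) :=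
  Real.mul_self_sqrt (mul_nonneg (hp.out k).1.le (sub_nonneg.2 (hp.out k).2.le))

variable (p) in
/-- The conditional expectation given the coordinates in `A`. -/
def avg (A : Finset ℕ) (u : Space → ℝ) : Space → ℝ :=
  fun ω => ∫ ω', u (A.piecewise ω ω') ∂law p

theorem dependsOn_avg (A : Finset ℕ) (u : Space → ℝ) : DependsOn (avg p A u) (A : Set ℕ) := by
  intro x y h
  refine integral_congr_ae (ae_of_all _ fun ω' => congrArg u (funext fun i => ?_))
  by_cases hi : i ∈ A
  · simpa [hi] using h i hi
  · simp [hi]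

/-- This version of the conditional expectation is defined at every ω and depends on finitely many
signs, so it takes finitely many values. Measurability and integrability are automatic from here on,
whatever u is. -/
theorem cylinder_avg (A : Finset ℕ) (u : Space → ℝ) : Cylinder (avg p A u) :=
  ⟨A, dependsOn_avg A u⟩

theorem avg_empty (u : Space → ℝ) (ω : Space) : avg p ∅ u ω = ∫ ω', u ω' ∂law p := by
  simp [avg]

theorem avg_of_dependsOn {A : Finset ℕ} {u : Space → ℝ} (hu : DependsOn u (A : Set ℕ)) :
    avg p A u = u := by
  ext ω
  have : ∀ ω', u (A.piecewise ω ω') = u ω := fun ω' =>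
    hu fun i hi => by simp [Finset.mem_coe.1 hi]
  simp [avg, this]

theorem avg_sub (A : Finset ℕ) {u v : Space → ℝ} (hu : Integrable u (law p))
    (hv : Integrable v (law p)) (ω : Space) :
    avg p A (fun ω => u ω - v ω) ω = avg p A u ω - avg p A v ω :=
  integral_sub (hu.comp_piecewise A ω) (hv.comp_piecewise A ω)

theorem avg_insert_update {A : Finset ℕ} {k : ℕ} (hk : k ∉ A) (u : Space → ℝ) (ω : Space)
    (e : ℤˣ) : avg p (insert k A) u (Function.update ω k e) =
      ∫ ω', u (A.piecewise ω (Function.update ω' k e)) ∂law p := by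
  refine integral_congr_ae (ae_of_all _ fun ω' => congrArg u (funext fun i => ?_))
  by_cases hik : i = k
  · subst hik; simp [hk]
  · by_cases hi : i ∈ A <;> simp [hi, hik, Finset.piecewise]

theorem avg_eq_insert {A : Finset ℕ} {k : ℕ} (hk : k ∉ A) {u : Space → ℝ}
    (hu : Integrable u (law p)) (ω : Space) :
    avg p A u ω = p k * avg p (insert k A) u (Function.update ω k 1) +
      (1 - p k) * avg p (insert k A) u (Function.update ω k (-1)) := by
  rw [avg_insert_update hk, avg_insert_update hk]
  exact integral_eq_update (hu.comp_piecewise A ω) k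

theorem integral_avg (A : Finset ℕ) {u : Space → ℝ} (hu : Integrable u (law p)) :
    ∫ ω, avg p A u ω ∂law p = ∫ ω, u ω ∂law p := by
  induction A using Finset.induction_on with
  | empty => simp [avg_empty]
  | insert k A hk ih =>
    have hc := cylinder_avg (p := p) (insert k A) u
    rw [integral_eq_update hc.integrable k, ← ih]
    simp_rw [avg_eq_insert hk hu]
    rw [integral_add ((hc.update k 1).const_mul _).integrable
      ((hc.update k (-1)).const_mul _).integrable, integral_const_mul, integral_const_mul]

theorem sq_integral_le {Ω : Type*} [MeasurableSpace Ω] {μ : Measure Ω} [IsProbabilityMeasure μ]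
    {u : Ω → ℝ} (hu : MemLp u 2 μ) : (∫ ω, u ω ∂μ) ^ 2 ≤ ∫ ω, u ω ^ 2 ∂μ := by
  have h := variance_eq_sub hu
  have h' := variance_nonneg u μ
  simp only [Pi.pow_apply] at h
  linarith

theorem sq_avg_le (A : Finset ℕ) {u : Space → ℝ} (hu : MemLp u 2 (law p)) (ω : Space) :
    avg p A u ω ^ 2 ≤ avg p A (fun ω => u ω ^ 2) ω :=
  sq_integral_le (hu.comp_piecewise A ω)

theorem integral_sq_avg_le (A : Finset ℕ) {u : Space → ℝ} (hu : MemLp u 2 (law p)) :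
    ∫ ω, avg p A u ω ^ 2 ∂law p ≤ ∫ ω, u ω ^ 2 ∂law p := by
  rw [← integral_avg A hu.integrable_sq]
  exact integral_mono ((cylinder_avg A u).pow 2).integrable (cylinder_avg A _).integrable
    fun ω => sq_avg_le A hu ω

theorem _root_.MeasureTheory.MemLp.mul_of_four {Ω : Type*} [MeasurableSpace Ω] {μ : Measure Ω}
    {u v : Ω → ℝ} (hu : MemLp u 4 μ) (hv : MemLp v 4 μ) : MemLp (fun ω => u ω * v ω) 2 μ := by
  have : ENNReal.HolderTriple 4 4 2 := ⟨by
    rw [← ENNReal.toReal_eq_toReal_iff' (by simp) (by simp)]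
    rw [ENNReal.toReal_add (by simp) (by simp)]
    norm_num⟩
  exact (MemLp.mul hu hv : MemLp (v * u) 2 μ).ae_eq (ae_of_all _ fun ω => mul_comm _ _)

theorem _root_.MeasureTheory.MemLp.sq_of_four {Ω : Type*} [MeasurableSpace Ω] {μ : Measure Ω}
    {u : Ω → ℝ} (hu : MemLp u 4 μ) : MemLp (fun ω => u ω ^ 2) 2 μ := by
  simpa only [pow_two] using hu.mul_of_four hu

theorem _root_.MeasureTheory.MemLp.two_of_four {Ω : Type*} [MeasurableSpace Ω] {μ : Measure Ω}
    [IsFiniteMeasure μ] {u : Ω → ℝ} (hu : MemLp u 4 μ) : MemLp u 2 μ :=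
  hu.mono_exponent (by norm_num)

/-- Jensen's inequality for the square, used twice. -/
theorem integral_fourth_avg_le (A : Finset ℕ) {u : Space → ℝ} (hu : MemLp u 4 (law p)) :
    ∫ ω, avg p A u ω ^ 4 ∂law p ≤ ∫ ω, u ω ^ 4 ∂law p := by
  have h : ∀ ω, avg p A u ω ^ 4 ≤ avg p A (fun ω => u ω ^ 2) ω ^ 2 := fun ω => by
    have := pow_le_pow_left₀ (sq_nonneg _) (sq_avg_le A hu.two_of_four ω) 2
    rwa [← pow_mul] at this
  refine (integral_mono ((cylinder_avg A u).pow 4).integrable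
    ((cylinder_avg A _).pow 2).integrable h).trans ?_
  refine (integral_sq_avg_le A hu.sq_of_four).trans (le_of_eq ?_)
  simp_rw [← pow_mul]

theorem D_avg_of_mem {A : Finset ℕ} {k : ℕ} (hk : k ∈ A) {u : Space → ℝ}
    (hu : Integrable u (law p)) : D p k (avg p A u) = avg p A (D p k u) := by
  ext ω
  have h : ∀ e ω', A.piecewise (Function.update ω k e) ω' =
      Function.update (A.piecewise ω ω') k e := fun e ω' =>
    (Finset.update_piecewise_of_mem A ω ω' hk e).symm
  simp only [D, avg, h]
  rw [integral_const_mul, integral_sub ((hu.comp_update k 1).comp_piecewise A ω)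
    ((hu.comp_update k (-1)).comp_piecewise A ω)]

theorem D_of_dependsOn {A : Set ℕ} {k : ℕ} (hk : k ∉ A) {u : Space → ℝ}
    (hu : DependsOn u A) (ω : Space) : D p k u ω = 0 := by
  have : u (Function.update ω k 1) = u (Function.update ω k (-1)) := hu fun i hi => by
    have : i ≠ k := fun h => hk (h ▸ hi)
    simp [this]
  simp [D, this]

theorem D_avg_of_notMem {A : Finset ℕ} {k : ℕ} (hk : k ∉ A) (u : Space → ℝ) (ω : Space) :
    D p k (avg p A u) ω = 0 :=
  D_of_dependsOn (by simpa using hk) (dependsOn_avg A u) ω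

/-- `D p k u` does not depend on coordinate k, so freezing that coordinate and integrating it out
amount to the same. -/
theorem avg_insert_D {A : Finset ℕ} {k : ℕ} (hk : k ∉ A) (u : Space → ℝ) :
    avg p (insert k A) (D p k u) = avg p A (D p k u) := by
  ext ω
  have h : ∀ e, avg p (insert k A) (D p k u) (Function.update ω k e) = avg p A (D p k u) ω := by
    intro e
    rw [avg_insert_update hk]
    refine integral_congr_ae (ae_of_all _ fun ω' => ?_)
    change D p k u _ = D p k u _
    rw [← D_update k u (A.piecewise ω ω') e, Finset.update_piecewise_of_notMem A _ _ hk]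
  simpa using h (ω k)

theorem avg_D_update (A : Finset ℕ) (k : ℕ) {u : Space → ℝ} (hu : Integrable u (law p))
    (ω : Space) (e : ℤˣ) : avg p A (D p k u) (Function.update ω k e) = avg p A (D p k u) ω := by
  by_cases hk : k ∈ A
  · rw [← D_avg_of_mem hk hu, D_update]
  · exact dependsOn_avg A _ fun i hi => Function.update_of_ne (fun h : i = k => hk (h ▸ hi)) _ _

end Rademacher

end

/-! ### The covariance formula and the Poincaré inequality. -/

noncomputable section

namespace Rademacher

variable {p : ℕ → ℝ} [hp : Fact (∀ k, p k ∈ Set.Ioo (0 : ℝ) 1)]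

/-- The probability of a given `j`-element subset of an `n`-element set, when first the cardinality
is chosen uniformly and then the subset. -/
def weight (n j : ℕ) : ℝ := j.factorial * (n - j).factorial / (n + 1).factorial

theorem weight_nonneg (n j : ℕ) : 0 ≤ weight n j := by unfold weight; positivity

/-- The weight is the Beta integral of t^j (1 − t)^(n − j) over [0, 1], and here (1 − t) + t = 1.
The value is the probability that, in a uniformly random ordering of n elements, the predecessors of
a given element form a given set of size j. -/
theorem weight_add_weight_succ {n j : ℕ} (h : j < n) :
    weight n j + weight n (j + 1) = j.factorial * (n - 1 - j).factorial / n.factorial := by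
  obtain ⟨m, rfl⟩ := Nat.exists_eq_add_of_lt h
  have h1 : j + m + 1 - j = m + 1 := by omega
  have h2 : j + m + 1 - (j + 1) = m := by omega
  have h3 : j + m + 1 - 1 - j = m := by omega
  simp only [weight, h1, h2, h3]
  rw [Nat.factorial_succ (j + m + 1), Nat.factorial_succ m, Nat.factorial_succ j]
  have := Nat.factorial_pos (j + m + 1)
  push_cast
  field_simp
  ring

theorem sum_weight (s : Finset ℕ) : ∑ A ∈ s.powerset, weight s.card A.card = 1 := by
  rw [Finset.sum_powerset_apply_card (fun j => weight s.card j)]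
  have : ∀ j ∈ Finset.range (s.card + 1), s.card.choose j • weight s.card j =
      1 / (s.card + 1 : ℝ) := by
    intro j hj
    have h := Nat.choose_mul_factorial_mul_factorial (Nat.lt_succ_iff.1 (Finset.mem_range.1 hj))
    have h' : ((s.card.choose j : ℝ) * j.factorial * (s.card - j).factorial) =
      s.card.factorial := by exact_mod_cast h
    have h0 : (s.card.factorial : ℝ) ≠ 0 := by positivity
    rw [nsmul_eq_mul, weight, ← mul_div_assoc, ← mul_assoc, h', Nat.factorial_succ]
    push_cast
    field_simp
  rw [Finset.sum_congr rfl this]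
  simp
  field_simp

/-- Complementation in s preserves the weights, so the random subset contains m with probability
1/2. This is the origin of the factors 1/2 in `sqrt_sum_integral_D_carre_le`. -/
theorem sum_weight_mem {s : Finset ℕ} {m : ℕ} (hm : m ∈ s) :
    ∑ A ∈ s.powerset with m ∈ A, weight s.card A.card = 1 / 2 := by
  have h1 : ∑ A ∈ s.powerset with m ∈ A, weight s.card A.card =
      ∑ A ∈ s.powerset with m ∉ A, weight s.card A.card := by
    refine Finset.sum_nbij' (fun A => s \ A) (fun A => s \ A) ?_ ?_ ?_ ?_ ?_
    · intro A hA
      simp only [Finset.mem_filter, Finset.mem_powerset] at hA ⊢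
      exact ⟨Finset.sdiff_subset, by simp [hA.2]⟩
    · intro A hA
      simp only [Finset.mem_filter, Finset.mem_powerset] at hA ⊢
      exact ⟨Finset.sdiff_subset, by simp [hA.2, hm]⟩
    · intro A hA
      simp only [Finset.mem_filter, Finset.mem_powerset] at hA
      exact Finset.sdiff_sdiff_eq_self hA.1
    · intro A hA
      simp only [Finset.mem_filter, Finset.mem_powerset] at hA
      exact Finset.sdiff_sdiff_eq_self hA.1
    · intro A hA
      simp only [Finset.mem_filter, Finset.mem_powerset] at hA
      have := Finset.card_le_card hA.1
      rw [Finset.card_sdiff_of_subset hA.1, weight, weight, Nat.sub_sub_self this, mul_comm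
        (A.card.factorial : ℝ)]
  have h2 := Finset.sum_filter_add_sum_filter_not s.powerset (fun A => m ∈ A)
    fun A => weight s.card A.card
  rw [sum_weight] at h2
  linarith

/-- Telescoping along a uniformly random ordering of s: the coefficient of the increment from A to
`insert k A` is the probability that A is the set of predecessors of k. -/
theorem sum_sub_insert_eq (s : Finset ℕ) (c : Finset ℕ → ℝ) :
    ∑ k ∈ s, ∑ A ∈ (s.erase k).powerset, (weight s.card A.card + weight s.card (A.card + 1)) *
      (c (insert k A) - c A) = c s - c ∅ := by
  set γ : Finset ℕ → ℝ := fun A => A.card.factorial * (s.card - A.card).factorial /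
    s.card.factorial with hγ
  set δ : ℕ → ℝ := fun j => j.factorial * (s.card - 1 - j).factorial / s.card.factorial with hδ
  have hfac : (s.card.factorial : ℝ) / s.card.factorial = 1 := div_self (by positivity)
  have hw : ∀ k ∈ s, ∀ A ∈ (s.erase k).powerset,
      (weight s.card A.card + weight s.card (A.card + 1)) * (c (insert k A) - c A) =
        δ A.card * c (insert k A) - δ A.card * c A := by
    intro k hk A hA
    have := Finset.card_le_card (Finset.mem_powerset.1 hA)
    have h0 := Finset.card_pos.2 ⟨k, hk⟩
    rw [Finset.card_erase_of_mem hk] at this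
    rw [weight_add_weight_succ (by omega), hδ, mul_sub]
  rw [Finset.sum_congr rfl fun k hk => Finset.sum_congr rfl (hw k hk)]
  simp only [Finset.sum_sub_distrib]
  -- A nonempty B arises as `insert k A` from `B.card` pairs, and `B.card` times δ at `B.card - 1`
  -- is `γ B`. The empty set does not arise.
  have h1 : ∑ k ∈ s, ∑ A ∈ (s.erase k).powerset, δ A.card * c (insert k A) =
      ∑ B ∈ s.powerset, (γ B - if B = ∅ then 1 else 0) * c B := by
    calc _ = ∑ B ∈ s.powerset, ∑ k ∈ B, δ (B.card - 1) * c B := by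
          rw [Finset.sum_sigma', Finset.sum_sigma']
          refine Finset.sum_nbij' (fun x => ⟨insert x.1 x.2, x.1⟩) (fun x => ⟨x.2, x.1.erase x.2⟩)
            ?_ ?_ ?_ ?_ ?_
          · rintro ⟨k, A⟩ h
            simp only [Finset.mem_sigma, Finset.mem_powerset] at h ⊢
            exact ⟨Finset.insert_subset h.1 (h.2.trans (Finset.erase_subset _ _)), by simp⟩
          · rintro ⟨B, k⟩ h
            simp only [Finset.mem_sigma, Finset.mem_powerset] at h ⊢
            exact ⟨h.1 h.2, Finset.erase_subset_erase _ h.1⟩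
          · rintro ⟨k, A⟩ h
            simp only [Finset.mem_sigma, Finset.mem_powerset] at h
            have : k ∉ A := fun hk => by simpa using h.2 hk
            simp [Finset.erase_insert this]
          · rintro ⟨B, k⟩ h
            simp only [Finset.mem_sigma, Finset.mem_powerset] at h
            simp [Finset.insert_erase h.2]
          · rintro ⟨k, A⟩ h
            simp only [Finset.mem_sigma, Finset.mem_powerset] at h
            have : k ∉ A := fun hk => by simpa using h.2 hk
            simp [Finset.card_insert_of_notMem this]
      _ = _ := by
          refine Finset.sum_congr rfl fun B hB => ?_
          rw [Finset.sum_const, nsmul_eq_mul, ← mul_assoc]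
          congr 1
          have hBs := Finset.card_le_card (Finset.mem_powerset.1 hB)
          by_cases hB0 : B = ∅
          · simp [hB0, hγ, hfac]
          · obtain ⟨j, hj⟩ := Nat.exists_eq_succ_of_ne_zero (fun h => hB0 (Finset.card_eq_zero.1 h))
            have : s.card - 1 - j = s.card - (j + 1) := by omega
            simp only [hB0, hγ, hδ, hj, Nat.succ_eq_add_one, Nat.add_sub_cancel, this,
              Nat.factorial_succ j, if_false, sub_zero]
            push_cast
            ring
  -- A proper subset B can be enlarged by `s.card - B.card` elements, which again gives `γ B`. The
  -- two sums cancel except at s and at the empty set.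
  have h2 : ∑ k ∈ s, ∑ A ∈ (s.erase k).powerset, δ A.card * c A =
      ∑ B ∈ s.powerset, (γ B - if B = s then 1 else 0) * c B := by
    calc _ = ∑ B ∈ s.powerset, ∑ k ∈ s \ B, δ B.card * c B := by
          refine Finset.sum_comm' fun k A => ?_
          simp only [Finset.mem_powerset, Finset.mem_sdiff]
          constructor
          · rintro ⟨hk, hA⟩
            exact ⟨⟨hk, fun h => by simpa using hA h⟩, hA.trans (Finset.erase_subset _ _)⟩
          · rintro ⟨⟨hk, hkA⟩, hA⟩
            exact ⟨hk, fun x hx => Finset.mem_erase.2 ⟨fun h => hkA (h ▸ hx), hA hx⟩⟩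
      _ = _ := by
          refine Finset.sum_congr rfl fun B hB => ?_
          have hBs := Finset.card_le_card (Finset.mem_powerset.1 hB)
          rw [Finset.sum_const, nsmul_eq_mul, ← mul_assoc,
            Finset.card_sdiff_of_subset (Finset.mem_powerset.1 hB)]
          congr 1
          by_cases hB0 : B = s
          · simp [hB0, hγ, hfac]
          · have hlt : B.card < s.card := Finset.card_lt_card
              ((Finset.mem_powerset.1 hB).ssubset_of_ne hB0)
            obtain ⟨j, hj⟩ := Nat.exists_eq_succ_of_ne_zero (Nat.sub_ne_zero_of_lt hlt)
            have : s.card - 1 - B.card = j := by omega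
            simp only [hB0, hγ, hδ, hj, Nat.succ_eq_add_one, this,
              Nat.factorial_succ j, if_false, sub_zero]
            push_cast
            ring
  rw [h1, h2, ← Finset.sum_sub_distrib]
  simp_rw [sub_mul, ite_mul, one_mul, zero_mul]
  simp only [sub_sub_sub_cancel_left, Finset.sum_sub_distrib]
  simp

/-- Integrate out coordinate k. As `avg p A F` is the weighted mean of the two values of `avg p
(insert k A) F`, these deviate from it by q_k and −p_k times their difference. Both terms then carry
p_k q_k, the product of the normalisations of the two derivatives. -/
theorem integral_mul_avg_insert {A : Finset ℕ} {k : ℕ} (hk : k ∉ A) {F G : Space → ℝ}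
    (hF : Integrable F (law p)) (hG : Cylinder G) :
    ∫ ω, G ω * avg p (insert k A) F ω ∂law p - ∫ ω, G ω * avg p A F ω ∂law p =
      ∫ ω, D p k G ω * avg p A (D p k F) ω ∂law p := by
  have hi : Cylinder fun ω => G ω * (avg p (insert k A) F ω - avg p A F ω) :=
    hG.mul ((cylinder_avg _ F).sub (cylinder_avg _ F))
  have hA := cylinder_avg (p := p) A F
  have hI := cylinder_avg (p := p) (insert k A) F
  rw [← integral_sub (hG.mul hI).integrable (hG.mul hA).integrable]
  simp_rw [← mul_sub]
  rw [integral_eq_update hi.integrable k, ← integral_const_mul, ← integral_const_mul,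
    ← integral_add ((hi.update k 1).const_mul _).integrable
      ((hi.update k (-1)).const_mul _).integrable]
  refine integral_congr_ae (ae_of_all _ fun ω => ?_)
  have hup : ∀ e, avg p A F (Function.update ω k e) = avg p A F ω := fun e =>
    dependsOn_avg A F fun i hi => Function.update_of_ne (fun h : i = k => hk (h ▸ hi)) _ _
  have hs := sqrt_mul_sqrt_pq (p := p) k
  simp only [hup]
  rw [← avg_insert_D hk F, ← D_avg_of_mem (Finset.mem_insert_self k A) hF, avg_eq_insert hk hF]
  simp only [D]
  linear_combination (-(G (Function.update ω k 1) - G (Function.update ω k (-1))) *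
    (avg p (insert k A) F (Function.update ω k 1) -
      avg p (insert k A) F (Function.update ω k (-1)))) * hs

variable (p) in
/-- The average of the conditional expectations given random subsets of `s`. -/
def mix (s : Finset ℕ) (u : Space → ℝ) : Space → ℝ := fun ω =>
  ∑ A ∈ s.powerset, weight s.card A.card * avg p A u ω

theorem cylinder_mix (s : Finset ℕ) (u : Space → ℝ) : Cylinder (mix p s u) :=
  Cylinder.sum _ fun A _ => (cylinder_avg A u).const_mul _

theorem dependsOn_mix (s : Finset ℕ) (u : Space → ℝ) : DependsOn (mix p s u) (s : Set ℕ) := by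
  intro x y h
  refine Finset.sum_congr rfl fun A hA => ?_
  rw [dependsOn_avg A u fun i hi => h i (Finset.mem_powerset.1 hA hi)]

/-- Subsets with and without k are paired, their averages being equal by `avg_insert_D`. This
produces the coefficients of `sum_sub_insert_eq`. -/
theorem mix_D {s : Finset ℕ} {k : ℕ} (hk : k ∈ s) (u : Space → ℝ) (ω : Space) :
    mix p s (D p k u) ω = ∑ A ∈ (s.erase k).powerset,
      (weight s.card A.card + weight s.card (A.card + 1)) * avg p A (D p k u) ω := by
  unfold mix
  conv_lhs => rw [← Finset.insert_erase hk]
  rw [Finset.sum_powerset_insert (Finset.notMem_erase k s), ← Finset.sum_add_distrib,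
    Finset.insert_erase hk]
  refine Finset.sum_congr rfl fun A hA => ?_
  have hkA : k ∉ A := fun h => by simpa using Finset.mem_powerset.1 hA h
  rw [avg_insert_D hkA, Finset.card_insert_of_notMem hkA]
  ring

/-- The covariance formula. -/
theorem integral_mul_avg_sub (s : Finset ℕ) {F G : Space → ℝ} (hF : Integrable F (law p))
    (hG : Cylinder G) :
    ∫ ω, G ω * avg p s F ω ∂law p - (∫ ω, G ω ∂law p) * ∫ ω, F ω ∂law p =
      ∑ k ∈ s, ∫ ω, D p k G ω * mix p s (D p k F) ω ∂law p := by
  have h := sum_sub_insert_eq s fun A => ∫ ω, G ω * avg p A F ω ∂law p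
  simp only [avg_empty, integral_mul_const] at h
  rw [← h]
  refine Finset.sum_congr rfl fun k hk => ?_
  simp_rw [mix_D hk, Finset.mul_sum]
  rw [integral_finsetSum _ fun A _ =>
    ((hG.D k).mul ((cylinder_avg A _).const_mul _)).integrable]
  refine Finset.sum_congr rfl fun A hA => ?_
  have hkA : k ∉ A := fun h => by simpa using Finset.mem_powerset.1 hA h
  rw [integral_mul_avg_insert hkA hF hG, ← integral_const_mul]
  refine integral_congr_ae (ae_of_all _ fun ω => ?_)
  simp only
  ring

theorem sq_sum_mul_le {ι : Type*} (s : Finset ι) (w x : ι → ℝ) (hw : ∀ i ∈ s, 0 ≤ w i) :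
    (∑ i ∈ s, w i * x i) ^ 2 ≤ (∑ i ∈ s, w i) * ∑ i ∈ s, w i * x i ^ 2 := by
  refine Finset.sum_sq_le_sum_mul_sum_of_sq_le_mul s hw
    (fun i hi => mul_nonneg (hw i hi) (sq_nonneg _)) fun i _ => le_of_eq ?_
  ring

theorem integral_sq_mix_le (s : Finset ℕ) {u : Space → ℝ} (hu : MemLp u 2 (law p)) :
    ∫ ω, mix p s u ω ^ 2 ∂law p ≤ ∫ ω, u ω ^ 2 ∂law p := by
  have hc : ∀ A : Finset ℕ, Cylinder fun ω => weight s.card A.card * avg p A u ω ^ 2 := fun A =>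
    ((cylinder_avg A u).pow 2).const_mul _
  calc _ ≤ ∫ ω, ∑ A ∈ s.powerset, weight s.card A.card * avg p A u ω ^ 2 ∂law p := by
        refine integral_mono ((cylinder_mix s u).pow 2).integrable
          (Cylinder.sum _ fun A _ => hc A).integrable fun ω => ?_
        refine (sq_sum_mul_le _ _ _ fun A _ => weight_nonneg _ _).trans (le_of_eq ?_)
        rw [sum_weight, one_mul]
    _ = ∑ A ∈ s.powerset, weight s.card A.card * ∫ ω, avg p A u ω ^ 2 ∂law p := by
        rw [integral_finsetSum _ fun A _ => (hc A).integrable]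
        simp_rw [integral_const_mul]
    _ ≤ ∑ A ∈ s.powerset, weight s.card A.card * ∫ ω, u ω ^ 2 ∂law p := by
        exact Finset.sum_le_sum fun A _ =>
          mul_le_mul_of_nonneg_left (integral_sq_avg_le A hu) (weight_nonneg _ _)
    _ = _ := by rw [← Finset.sum_mul, sum_weight, one_mul]

theorem integral_mul_le_sqrt {Ω : Type*} [MeasurableSpace Ω] {μ : Measure Ω} {u v : Ω → ℝ}
    (hu : MemLp u 2 μ) (hv : MemLp v 2 μ) :
    ∫ ω, u ω * v ω ∂μ ≤ √(∫ ω, u ω ^ 2 ∂μ) * √(∫ ω, v ω ^ 2 ∂μ) := by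
  have h := integral_mul_norm_le_Lp_mul_Lq (μ := μ) (f := u) (g := v) Real.HolderConjugate.two_two
    (by simpa using hu) (by simpa using hv)
  simp only [Real.norm_eq_abs, Real.rpow_ofNat, sq_abs, ← Real.sqrt_eq_rpow] at h
  refine le_trans ?_ h
  refine integral_mono (hu.integrable_mul hv) (hu.norm.integrable_mul hv.norm) fun ω => ?_
  rw [← abs_mul]
  exact le_abs_self _

/-- The Poincaré inequality. -/
theorem poincare {s : Finset ℕ} {u : Space → ℝ} (hu : DependsOn u (s : Set ℕ)) :
    ∫ ω, u ω ^ 2 ∂law p - (∫ ω, u ω ∂law p) ^ 2 ≤ ∑ k ∈ s, ∫ ω, D p k u ω ^ 2 ∂law p := by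
  have hc : Cylinder u := ⟨s, hu⟩
  have h := integral_mul_avg_sub s (p := p) hc.integrable hc
  rw [avg_of_dependsOn hu] at h
  simp only [pow_two] at h ⊢
  rw [h]
  refine Finset.sum_le_sum fun k _ => ?_
  have hD := (hc.D (p := p) k).memLp (p := p) 2
  -- Cauchy–Schwarz, after which the L² contraction of `mix` leaves the squared norm of the
  -- derivative.
  refine (integral_mul_le_sqrt hD ((cylinder_mix s _).memLp 2)).trans ?_
  have := Real.sqrt_le_sqrt (integral_sq_mix_le s hD)
  refine (mul_le_mul_of_nonneg_left this (Real.sqrt_nonneg _)).trans (le_of_eq ?_)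
  rw [Real.mul_self_sqrt (integral_nonneg fun _ => sq_nonneg _)]
  simp only [pow_two]

end Rademacher

end

/-! ### Fluctuations of the carré-du-champ functional. -/

noncomputable section

namespace Rademacher

variable {p : ℕ → ℝ} [hp : Fact (∀ k, p k ∈ Set.Ioo (0 : ℝ) 1)]

theorem sq_sum_eq {ι : Type*} (s : Finset ι) (a b : ι → ℝ) :
    (∑ k ∈ s, a k * b k) ^ 2 = ∑ k ∈ s, ∑ l ∈ s, a k * a l * (b k * b l) := by
  rw [pow_two, Finset.sum_mul_sum]
  exact Finset.sum_congr rfl fun k _ => Finset.sum_congr rfl fun l _ => by ring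

theorem sq_sum_mul_integral_le {ι Ω : Type*} [MeasurableSpace Ω] {μ : Measure Ω}
    [IsProbabilityMeasure μ] (s : Finset ι) (a : ι → ℝ) {u : ι → Ω → ℝ}
    (hu : ∀ k ∈ s, MemLp (u k) 2 μ) :
    (∑ k ∈ s, a k * ∫ ω, u k ω ∂μ) ^ 2 ≤
      ∑ k ∈ s, ∑ l ∈ s, a k * a l * ∫ ω, u k ω * u l ω ∂μ := by
  have h2 : ∀ k ∈ s, ∀ l ∈ s, Integrable (fun ω => a k * a l * (u k ω * u l ω)) μ :=
    fun k hk l hl => ((hu k hk).integrable_mul (hu l hl)).const_mul _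
  have h : MemLp (fun ω => ∑ k ∈ s, a k * u k ω) 2 μ :=
    memLp_finsetSum _ fun k hk => (hu k hk).const_mul (a k)
  have key := sq_integral_le h
  rw [integral_finsetSum _ fun k hk => ((hu k hk).integrable one_le_two).const_mul (a k)] at key
  simp_rw [sq_sum_eq] at key
  rw [integral_finsetSum _ fun k hk => integrable_finsetSum _ fun l hl => h2 k hk l hl] at key
  simp_rw [integral_const_mul] at key
  refine key.trans (le_of_eq (Finset.sum_congr rfl fun k hk => ?_))
  rw [integral_finsetSum _ fun l hl => h2 k hk l hl]
  simp_rw [integral_const_mul]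

/-- Jensen's inequality for the sum of v_k(ω') u_k(ω) over the product space, one variable at a
time. The integrals of the u's and of the v's stay separate, and this decoupling is what lets
products of norms appear in `sumT` and `sumU`. -/
theorem sq_sum_integral_mul_integral_le {ι Ω Ω' : Type*} [MeasurableSpace Ω] {μ : Measure Ω}
    [IsProbabilityMeasure μ] [MeasurableSpace Ω'] {ν : Measure Ω'} [IsProbabilityMeasure ν]
    (s : Finset ι) {u : ι → Ω → ℝ} {v : ι → Ω' → ℝ}
    (hu : ∀ k ∈ s, MemLp (u k) 2 μ) (hv : ∀ k ∈ s, MemLp (v k) 2 ν) :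
    (∑ k ∈ s, (∫ ω, v k ω ∂ν) * ∫ ω, u k ω ∂μ) ^ 2 ≤
      ∑ k ∈ s, ∑ l ∈ s, (∫ ω, v k ω * v l ω ∂ν) * ∫ ω, u k ω * u l ω ∂μ := by
  set a : ι → ℝ := fun k => ∫ ω, v k ω ∂ν
  have huu : ∀ k ∈ s, ∀ l ∈ s, Integrable (fun ω => u k ω * u l ω) μ :=
    fun k hk l hl => (hu k hk).integrable_mul (hu l hl)
  have e : ∀ c : ι → ι → ℝ, ∑ k ∈ s, ∑ l ∈ s, c k l * ∫ ω, u k ω * u l ω ∂μ =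
      ∫ ω, ∑ k ∈ s, ∑ l ∈ s, c k l * (u k ω * u l ω) ∂μ := by
    intro c
    rw [integral_finsetSum _ fun k hk => integrable_finsetSum _ fun l hl =>
      (huu k hk l hl).const_mul _]
    refine Finset.sum_congr rfl fun k hk => ?_
    rw [integral_finsetSum _ fun l hl => (huu k hk l hl).const_mul _]
    simp_rw [integral_const_mul]
  refine (sq_sum_mul_integral_le s a hu).trans ?_
  rw [e, e]
  refine integral_mono (integrable_finsetSum _ fun k hk => integrable_finsetSum _ fun l hl =>
    (huu k hk l hl).const_mul _) (integrable_finsetSum _ fun k hk => integrable_finsetSum _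
    fun l hl => (huu k hk l hl).const_mul _) fun ω => ?_
  have h := sq_sum_mul_integral_le s (fun k => u k ω) hv
  have h' : (∑ k ∈ s, u k ω * a k) ^ 2 = ∑ k ∈ s, ∑ l ∈ s, a k * a l * (u k ω * u l ω) := by
    rw [sq_sum_eq]
    exact Finset.sum_congr rfl fun k _ => Finset.sum_congr rfl fun l _ => by ring
  simp only
  rw [← h']
  refine h.trans (le_of_eq ?_)
  exact Finset.sum_congr rfl fun k _ => Finset.sum_congr rfl fun l _ => by ring

variable (p) in
/-- The `L²`-norm of a product. -/
def normMul (u v : Space → ℝ) : ℝ := √(∫ ω, (u ω * v ω) ^ 2 ∂law p)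

/-- At a fixed ω both averages are integrals over independent copies of the unfrozen coordinates, so
the decoupled inequality applies pointwise. Cauchy–Schwarz and the L² contraction then remove the
averages. -/
theorem integral_sq_sum_avg_mul_avg_le {ι : Type*} (s : Finset ι) (A B : Finset ℕ)
    {u v : ι → Space → ℝ} (hu : ∀ k ∈ s, MemLp (u k) 4 (law p))
    (hv : ∀ k ∈ s, MemLp (v k) 4 (law p)) :
    ∫ ω, (∑ k ∈ s, avg p B (v k) ω * avg p A (u k) ω) ^ 2 ∂law p ≤
      ∑ k ∈ s, ∑ l ∈ s, normMul p (v k) (v l) * normMul p (u k) (u l) := by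
  have hc : ∀ k l, Cylinder fun ω =>
      avg p B (fun ω => v k ω * v l ω) ω * avg p A (fun ω => u k ω * u l ω) ω := fun k l =>
    (cylinder_avg B _).mul (cylinder_avg A _)
  calc _ ≤ ∫ ω, ∑ k ∈ s, ∑ l ∈ s, avg p B (fun ω => v k ω * v l ω) ω *
          avg p A (fun ω => u k ω * u l ω) ω ∂law p := by
        refine integral_mono (((Cylinder.sum s fun k _ =>
          (cylinder_avg B (v k)).mul (cylinder_avg A (u k))).pow 2).integrable)
          (Cylinder.sum _ fun k _ => Cylinder.sum _ fun l _ => hc k l).integrable fun ω => ?_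
        exact sq_sum_integral_mul_integral_le s
          (fun k hk => (hu k hk).two_of_four.comp_piecewise A ω)
          (fun k hk => (hv k hk).two_of_four.comp_piecewise B ω)
    _ = ∑ k ∈ s, ∑ l ∈ s, ∫ ω, avg p B (fun ω => v k ω * v l ω) ω *
          avg p A (fun ω => u k ω * u l ω) ω ∂law p := by
        rw [integral_finsetSum _ fun k _ => (Cylinder.sum s fun l _ => hc k l).integrable]
        exact Finset.sum_congr rfl fun k _ => integral_finsetSum _ fun l _ => (hc k l).integrable
    _ ≤ _ := by
        refine Finset.sum_le_sum fun k hk => Finset.sum_le_sum fun l hl => ?_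
        refine (integral_mul_le_sqrt ((cylinder_avg B _).memLp 2)
          ((cylinder_avg A _).memLp 2)).trans ?_
        exact mul_le_mul
          (Real.sqrt_le_sqrt (integral_sq_avg_le B ((hv k hk).mul_of_four (hv l hl))))
          (Real.sqrt_le_sqrt (integral_sq_avg_le A ((hu k hk).mul_of_four (hu l hl))))
          (Real.sqrt_nonneg _) (Real.sqrt_nonneg _)

/-- The total weight enters once through Cauchy–Schwarz and once through the bound common to all i.
Its square is kept because the weights may sum to 1/2 only. -/
theorem integral_sq_sum_avg_mul_mix_le {ι κ : Type*} (s : Finset ι) (S : Finset κ) (w : κ → ℝ)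
    (hw : ∀ i ∈ S, 0 ≤ w i) (A : κ → Finset ℕ) (B : Finset ℕ)
    {u v : ι → Space → ℝ} (hu : ∀ k ∈ s, MemLp (u k) 4 (law p))
    (hv : ∀ k ∈ s, MemLp (v k) 4 (law p)) :
    ∫ ω, (∑ k ∈ s, avg p B (v k) ω * ∑ i ∈ S, w i * avg p (A i) (u k) ω) ^ 2 ∂law p ≤
      (∑ i ∈ S, w i) ^ 2 *
        ∑ k ∈ s, ∑ l ∈ s, normMul p (v k) (v l) * normMul p (u k) (u l) := by
  have hc : ∀ i, Cylinder fun ω =>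
      (∑ k ∈ s, avg p B (v k) ω * avg p (A i) (u k) ω) ^ 2 := fun i =>
    (Cylinder.sum _ fun k _ => (cylinder_avg _ _).mul (cylinder_avg _ _)).pow 2
  calc _ ≤ ∫ ω, (∑ i ∈ S, w i) * ∑ i ∈ S, w i *
          (∑ k ∈ s, avg p B (v k) ω * avg p (A i) (u k) ω) ^ 2 ∂law p := by
        refine integral_mono ((Cylinder.sum s fun k _ => (cylinder_avg B (v k)).mul
            (Cylinder.sum S fun i _ => (cylinder_avg (A i) (u k)).const_mul _)).pow 2).integrable
          ((Cylinder.sum _ fun i _ => (hc i).const_mul _).const_mul _).integrable fun ω => ?_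
        refine le_trans (le_of_eq ?_) (sq_sum_mul_le S w _ hw)
        congr 1
        simp_rw [Finset.mul_sum]
        rw [Finset.sum_comm]
        exact Finset.sum_congr rfl fun k _ => Finset.sum_congr rfl fun l _ => by ring
    _ = (∑ i ∈ S, w i) * ∑ i ∈ S, w i *
          ∫ ω, (∑ k ∈ s, avg p B (v k) ω * avg p (A i) (u k) ω) ^ 2 ∂law p := by
        rw [integral_const_mul, integral_finsetSum _ fun i _ => ((hc i).const_mul _).integrable]
        simp_rw [integral_const_mul]
    _ ≤ (∑ i ∈ S, w i) * ∑ i ∈ S, w i *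
          ∑ k ∈ s, ∑ l ∈ s, normMul p (v k) (v l) * normMul p (u k) (u l) :=
        mul_le_mul_of_nonneg_left (Finset.sum_le_sum fun i hi =>
          mul_le_mul_of_nonneg_left (integral_sq_sum_avg_mul_avg_le s _ _ hu hv) (hw i hi))
          (Finset.sum_nonneg hw)
    _ = _ := by rw [← Finset.sum_mul]; ring

/-- The difference operator is no derivation. The correction carries the sign of ω at m because the
undifferentiated factors are evaluated at the current value of that coordinate. -/
theorem D_mul (m : ℕ) (u v : Space → ℝ) (ω : Space) :
    D p m (fun ω => u ω * v ω) ω = D p m u ω * v ω + u ω * D p m v ω -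
      ((ω m : ℤ) : ℝ) / √(p m * (1 - p m)) * (D p m u ω * D p m v ω) := by
  have hpq : √(p m * (1 - p m)) ≠ 0 :=
    (Real.sqrt_pos.2 (mul_pos (hp.out m).1 (sub_pos.2 (hp.out m).2))).ne'
  obtain ⟨e, he⟩ : ∃ e, e = ω m := ⟨_, rfl⟩
  have hω : ω = Function.update ω m e := by simp [he]
  rw [hω]
  simp only [D_update, Function.update_self]
  rcases Int.units_eq_one_or e with rfl | rfl
  · simp only [D, Units.val_one, Int.cast_one]
    field_simp
    ring
  · simp only [D, Units.val_neg, Units.val_one, Int.cast_neg, Int.cast_one]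
    field_simp
    ring

theorem D_sum {ι : Type*} (m : ℕ) (s : Finset ι) (f : ι → Space → ℝ) (ω : Space) :
    D p m (fun ω => ∑ i ∈ s, f i ω) ω = ∑ i ∈ s, D p m (f i) ω := by
  simp only [D, ← Finset.sum_sub_distrib, Finset.mul_sum]

/-- An average over coordinate m has no derivative in direction m. For m in s only half of the total
weight survives, by `sum_weight_mem`. -/
theorem D_mix {s : Finset ℕ} (m : ℕ) {u : Space → ℝ} (hu : Integrable u (law p)) (ω : Space) :
    D p m (mix p s u) ω =
      ∑ A ∈ s.powerset with m ∈ A, weight s.card A.card * avg p A (D p m u) ω := by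
  unfold mix
  rw [D_sum, Finset.sum_filter]
  refine Finset.sum_congr rfl fun A _ => ?_
  have : D p m (fun ω => weight s.card A.card * avg p A u ω) ω =
      weight s.card A.card * D p m (avg p A u) ω := by simp only [D]; ring
  rw [this]
  split_ifs with h
  · rw [D_avg_of_mem h hu]
  · rw [D_avg_of_notMem h, mul_zero]

theorem sqrt_sum_integral_add_sq_le (s : Finset ℕ) {α β : ℕ → Space → ℝ}
    (hα : ∀ m ∈ s, Cylinder (α m)) (hβ : ∀ m ∈ s, Cylinder (β m)) :
    √(∑ m ∈ s, ∫ ω, (α m ω + β m ω) ^ 2 ∂law p) ≤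
      √(∑ m ∈ s, ∫ ω, α m ω ^ 2 ∂law p) + √(∑ m ∈ s, ∫ ω, β m ω ^ 2 ∂law p) := by
  have hn : ∀ f : ℕ → Space → ℝ, 0 ≤ ∑ m ∈ s, ∫ ω, f m ω ^ 2 ∂law p := fun f =>
    Finset.sum_nonneg fun m _ => integral_nonneg fun _ => sq_nonneg _
  refine Real.sqrt_le_iff.2 ⟨by positivity, ?_⟩
  rw [add_sq, Real.sq_sqrt (hn _), Real.sq_sqrt (hn _)]
  have h1 : ∑ m ∈ s, ∫ ω, (α m ω + β m ω) ^ 2 ∂law p = ∑ m ∈ s, ∫ ω, α m ω ^ 2 ∂law p +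
      2 * ∑ m ∈ s, ∫ ω, α m ω * β m ω ∂law p + ∑ m ∈ s, ∫ ω, β m ω ^ 2 ∂law p := by
    rw [Finset.mul_sum, ← Finset.sum_add_distrib, ← Finset.sum_add_distrib]
    refine Finset.sum_congr rfl fun m hm => ?_
    have h1 := ((hα m hm).pow 2).integrable (p := p)
    have h2 := (((hα m hm).mul (hβ m hm)).const_mul 2).integrable (p := p)
    have h12 : Integrable (fun ω => α m ω ^ 2 + 2 * (α m ω * β m ω)) (law p) := h1.add h2
    rw [← integral_const_mul, ← integral_add h1 h2,
      ← integral_add h12 ((hβ m hm).pow 2).integrable]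
    refine integral_congr_ae (ae_of_all _ fun ω => ?_)
    ring
  have h2 : ∑ m ∈ s, ∫ ω, α m ω * β m ω ∂law p ≤
      √(∑ m ∈ s, ∫ ω, α m ω ^ 2 ∂law p) * √(∑ m ∈ s, ∫ ω, β m ω ^ 2 ∂law p) :=
    (Finset.sum_le_sum fun m hm =>
      integral_mul_le_sqrt ((hα m hm).memLp 2) ((hβ m hm).memLp 2)).trans
      (Real.sum_sqrt_mul_sqrt_le _ (fun m => integral_nonneg fun _ => sq_nonneg _)
        (fun m => integral_nonneg fun _ => sq_nonneg _))
  rw [h1]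
  linarith

variable (p) in
/-- The partial sums of the series in `B₁`. -/
def sumT (s : Finset ℕ) (F G : Space → ℝ) : ℝ :=
  ∑ m ∈ s, ∑ k ∈ s, ∑ l ∈ s, normMul p (D p k F) (D p l F) *
    normMul p (D p m (D p k G)) (D p m (D p l G))

variable (p) in
/-- The partial sums of the series in `B₂`. -/
def sumU (s : Finset ℕ) (F G : Space → ℝ) : ℝ :=
  ∑ m ∈ s, 1 / (p m * (1 - p m)) * ∑ k ∈ s, ∑ l ∈ s,
    normMul p (D p m (D p k F)) (D p m (D p l F)) *
    normMul p (D p m (D p k G)) (D p m (D p l G))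

variable (p) in
/-- The discrete carré-du-champ type functional associated with the covariance formula. -/
def carre (s : Finset ℕ) (F G : Space → ℝ) : Space → ℝ := fun ω =>
  ∑ k ∈ s, D p k (avg p s G) ω * mix p s (D p k F) ω

theorem dependsOn_carre (s : Finset ℕ) {F G : Space → ℝ} (hG : Integrable G (law p)) :
    DependsOn (carre p s F G) (s : Set ℕ) := by
  intro x y h
  refine Finset.sum_congr rfl fun k hk => ?_
  rw [dependsOn_mix s _ h, D_avg_of_mem hk hG, dependsOn_avg s _ h]

/-- The product rule splits the derivative into three parts, estimated by Minkowski's inequality: α,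
with the derivative on `D p k G` and total weight 1; β, with the derivative on the mixture and
weight 1/2; and the correction γ, with weight 1/2 and a factor whose square is 1/(p_m q_m). -/
theorem sqrt_sum_integral_D_carre_le (s : Finset ℕ) {F G : Space → ℝ}
    (hF2 : MemLp F 2 (law p)) (hG2 : MemLp G 2 (law p))
    (hF : ∀ k, MemLp (D p k F) 4 (law p)) (hG : ∀ k, MemLp (D p k G) 4 (law p)) :
    √(∑ m ∈ s, ∫ ω, D p m (carre p s F G) ω ^ 2 ∂law p) ≤
      √(sumT p s F G) + 1 / 2 * √(sumT p s G F) + 1 / 2 * √(sumU p s F G) := by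
  have iF : ∀ k, Integrable (D p k F) (law p) := (hF2.integrable one_le_two).rademacherD
  have iG : ∀ k, Integrable (D p k G) (law p) := (hG2.integrable one_le_two).rademacherD
  set α : ℕ → Space → ℝ := fun m ω => ∑ k ∈ s, avg p s (D p m (D p k G)) ω *
    ∑ A ∈ s.powerset, weight s.card A.card * avg p A (D p k F) ω
  set β : ℕ → Space → ℝ := fun m ω => ∑ k ∈ s, avg p s (D p k G) ω *
    ∑ A ∈ s.powerset with m ∈ A, weight s.card A.card * avg p A (D p m (D p k F)) ω
  set γ : ℕ → Space → ℝ := fun m ω => ∑ k ∈ s, avg p s (D p m (D p k G)) ω *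
    ∑ A ∈ s.powerset with m ∈ A, weight s.card A.card * avg p A (D p m (D p k F)) ω
  set X : ℕ → Space → ℝ := fun m ω => -(((ω m : ℤ) : ℝ) / √(p m * (1 - p m)))
  have hX : ∀ m, Cylinder (X m) := fun m =>
    ⟨{m}, fun x y h => by simp only [X]; rw [h m (by simp)]⟩
  have hmix : ∀ (S : Finset (Finset ℕ)) (u v : ℕ → Space → ℝ), Cylinder fun ω =>
      ∑ k ∈ s, avg p s (v k) ω * ∑ A ∈ S, weight s.card A.card * avg p A (u k) ω :=
    fun S u v => Cylinder.sum _ fun k _ => (cylinder_avg _ _).mul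
      (Cylinder.sum _ fun A _ => (cylinder_avg A _).const_mul _)
  have hα : ∀ m, Cylinder (α m) := fun m => hmix _ _ _
  have hβ : ∀ m, Cylinder (β m) := fun m => hmix _ _ _
  have hγ : ∀ m, Cylinder (γ m) := fun m => hmix _ _ _
  have hD : ∀ m ∈ s, ∀ ω, D p m (carre p s F G) ω = α m ω + β m ω + X m ω * γ m ω := by
    intro m hm ω
    unfold carre
    rw [D_sum]
    simp only [α, β, γ, Finset.mul_sum (s := s), ← Finset.sum_add_distrib]
    refine Finset.sum_congr rfl fun k hk => ?_
    rw [D_mul, D_mix m (iF k), D_avg_of_mem hk (hG2.integrable one_le_two),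
      D_avg_of_mem hm (iG k)]
    simp only [mix, X]
    ring
  have h1 : ∑ m ∈ s, ∫ ω, α m ω ^ 2 ∂law p ≤ sumT p s F G := by
    refine Finset.sum_le_sum fun m hm => ?_
    refine (integral_sq_sum_avg_mul_mix_le s _ _ (fun _ _ => weight_nonneg _ _) _ _
      (fun k _ => hF k) (fun k _ => (hG k).rademacherD m)).trans (le_of_eq ?_)
    rw [sum_weight, one_pow, one_mul]
    simp_rw [mul_comm]
  have h2 : ∑ m ∈ s, ∫ ω, β m ω ^ 2 ∂law p ≤ (1 / 2) ^ 2 * sumT p s G F := by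
    unfold sumT
    rw [Finset.mul_sum]
    refine Finset.sum_le_sum fun m hm => ?_
    refine (integral_sq_sum_avg_mul_mix_le s _ _ (fun _ _ => weight_nonneg _ _) _ _
      (fun k _ => (hF k).rademacherD m) (fun k _ => hG k)).trans (le_of_eq ?_)
    rw [sum_weight_mem hm]
  have h3 : ∑ m ∈ s, ∫ ω, (X m ω * γ m ω) ^ 2 ∂law p ≤ (1 / 2) ^ 2 * sumU p s F G := by
    unfold sumU
    rw [Finset.mul_sum]
    refine Finset.sum_le_sum fun m hm => ?_
    have hpq : 0 < p m * (1 - p m) := mul_pos (hp.out m).1 (sub_pos.2 (hp.out m).2)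
    have hX2 : ∀ ω, (X m ω * γ m ω) ^ 2 = 1 / (p m * (1 - p m)) * γ m ω ^ 2 := by
      intro ω
      have hs : (((ω m : ℤ) : ℝ)) ^ 2 = 1 := by
        rcases Int.units_eq_one_or (ω m) with h | h <;> simp [h]
      rw [mul_pow]
      simp only [X]
      rw [neg_sq, div_pow, Real.sq_sqrt hpq.le, hs]
    simp_rw [hX2]
    rw [integral_const_mul, mul_left_comm]
    refine mul_le_mul_of_nonneg_left ?_ (one_div_nonneg.2 hpq.le)
    refine (integral_sq_sum_avg_mul_mix_le s _ _ (fun _ _ => weight_nonneg _ _) _ _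
      (fun k _ => (hF k).rademacherD m) (fun k _ => (hG k).rademacherD m)).trans (le_of_eq ?_)
    rw [sum_weight_mem hm]
    simp_rw [mul_comm (normMul p (D p m (D p _ G)) _)]
  have e : ∑ m ∈ s, ∫ ω, D p m (carre p s F G) ω ^ 2 ∂law p =
      ∑ m ∈ s, ∫ ω, (α m ω + β m ω + X m ω * γ m ω) ^ 2 ∂law p :=
    Finset.sum_congr rfl fun m hm => by simp_rw [hD m hm]
  have hsq : ∀ x : ℝ, √((1 / 2) ^ 2 * x) = 1 / 2 * √x := fun x => by
    rw [Real.sqrt_mul (by positivity), Real.sqrt_sq (by norm_num)]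
  rw [e]
  refine (sqrt_sum_integral_add_sq_le s (fun m _ => (hα m).add (hβ m))
    (fun m _ => (hX m).mul (hγ m))).trans ?_
  refine (add_le_add_left (sqrt_sum_integral_add_sq_le s (fun m _ => hα m)
    (fun m _ => hβ m)) _).trans ?_
  rw [← hsq, ← hsq]
  exact add_le_add (add_le_add (Real.sqrt_le_sqrt h1) (Real.sqrt_le_sqrt h2)) (Real.sqrt_le_sqrt h3)

/-- The mean absolute deviation is at most the standard deviation, to which the Poincaré inequality
applies. -/
theorem integral_abs_carre_sub_le (s : Finset ℕ) {F G : Space → ℝ}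
    (hF2 : MemLp F 2 (law p)) (hG2 : MemLp G 2 (law p))
    (hF : ∀ k, MemLp (D p k F) 4 (law p)) (hG : ∀ k, MemLp (D p k G) 4 (law p)) :
    ∫ ω, |carre p s F G ω - ∫ ω', carre p s F G ω' ∂law p| ∂law p ≤
      √(sumT p s F G) + 1 / 2 * √(sumT p s G F) + 1 / 2 * √(sumU p s F G) := by
  refine le_trans ?_ (sqrt_sum_integral_D_carre_le s hF2 hG2 hF hG)
  have hd := dependsOn_carre s (F := F) (hG2.integrable one_le_two)
  have hc : Cylinder (carre p s F G) := ⟨s, hd⟩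
  have hP := poincare (p := p) hd
  set c := ∫ ω', carre p s F G ω' ∂law p
  refine Real.le_sqrt_of_sq_le ?_
  refine (sq_integral_le ((hc.sub (.const c)).abs.memLp 2)).trans (le_trans (le_of_eq ?_) hP)
  simp_rw [sq_abs, sub_sq]
  rw [integral_add ((hc.pow 2).sub ((hc.const_mul 2).mul (.const c))).integrable (integrable_const _),
    integral_sub (hc.pow 2).integrable ((hc.const_mul 2).mul (.const c)).integrable,
    integral_mul_const, integral_const_mul]
  simp only [integral_const, probReal_univ, one_smul]
  ring

end Rademacher

end

/-! ### Taylor expansion with weights at the end points. -/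

noncomputable section

namespace D4

theorem norm_le_of_hasDerivAt_of_le {f f' B B' : ℝ → ℝ} (hf : ∀ s, HasDerivAt f (f' s) s)
    (hB : ∀ s, HasDerivAt B (B' s) s) (h0 : |f 0| ≤ B 0)
    (h : ∀ s ∈ Set.Ico (0 : ℝ) 1, |f' s| ≤ B' s) :
    ∀ s ∈ Set.Icc (0 : ℝ) 1, |f s| ≤ B s := fun _ hs =>
  image_norm_le_of_norm_deriv_right_le_deriv_boundary
    (fun s _ => (hf s).continuousAt.continuousWithinAt)
    (fun s _ => (hf s).hasDerivWithinAt) h0 hB h hs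

/-- A quadrature formula with nodes at the end points and arbitrary weights. -/
theorem abs_sub_sub_le {φ φ₁ φ₂ : ℝ → ℝ} (h1 : ∀ s, HasDerivAt φ (φ₁ s) s)
    (h2 : ∀ s, HasDerivAt φ₁ (φ₂ s) s) {M L : ℝ} (hM : ∀ s, |φ₂ s| ≤ M)
    (hL : ∀ s, 0 ≤ s → |φ₂ s - φ₂ 0| ≤ L * s) (r : ℝ) :
    |φ 1 - φ 0 - (r * φ₁ 1 + (1 - r) * φ₁ 0)| ≤ 1 / 2 * |r - (1 - r)| * M + 5 / 12 * L := by
  have hb : ∀ s ∈ Set.Icc (0 : ℝ) 1, |φ₁ s - φ₁ 0| ≤ M * s :=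
    norm_le_of_hasDerivAt_of_le (fun s => (h2 s).sub_const _)
      (fun s => by simpa using (hasDerivAt_id s).const_mul M) (by simp) fun s _ => hM s
  have hR1 : ∀ s ∈ Set.Icc (0 : ℝ) 1, |φ₁ s - φ₁ 0 - s * φ₂ 0| ≤ L * (s ^ 2 / 2) := by
    refine norm_le_of_hasDerivAt_of_le (f' := fun s => φ₂ s - φ₂ 0) (B' := fun s => L * s)
      (fun s => ?_) (fun s => ?_) (by simp) fun s hs => hL s hs.1
    · simpa using ((h2 s).sub_const (φ₁ 0)).fun_sub ((hasDerivAt_id s).mul_const (φ₂ 0))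
    · have := (((hasDerivAt_id s).pow 2).div_const 2).const_mul L
      simpa using this
  have hR0 : ∀ s ∈ Set.Icc (0 : ℝ) 1,
      |φ s - φ 0 - s * φ₁ 0 - s ^ 2 / 2 * φ₂ 0| ≤ L * (s ^ 3 / 6) := by
    refine norm_le_of_hasDerivAt_of_le (f' := fun s => φ₁ s - φ₁ 0 - s * φ₂ 0)
      (B' := fun s => L * (s ^ 2 / 2))
      (fun s => ?_) (fun s => ?_) (by simp) fun s hs => hR1 s ⟨hs.1, hs.2.le⟩
    · have := (((h1 s).sub_const (φ 0)).fun_sub ((hasDerivAt_id s).mul_const (φ₁ 0))).fun_sub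
        ((((hasDerivAt_id s).pow 2).div_const 2).mul_const (φ₂ 0))
      simpa using this
    · have := (((hasDerivAt_id s).pow 3).div_const 6).const_mul L
      refine this.congr_deriv ?_
      change L * (((3 : ℕ) : ℝ) * s ^ 2 * 1 / 6) = _
      push_cast
      ring
  have hb := hb 1 (by simp)
  have hR1 := hR1 1 (by simp)
  have hR0 := hR0 1 (by simp)
  -- The Taylor remainders of φ and φ₁ at 0 contribute 1/6 and 1/2 · 1/2, in total 5/12. The
  -- deviation of r from 1/2 is charged to the increment of φ₁.
  have e : φ 1 - φ 0 - (r * φ₁ 1 + (1 - r) * φ₁ 0) =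
      (φ 1 - φ 0 - 1 * φ₁ 0 - 1 ^ 2 / 2 * φ₂ 0) - 1 / 2 * (φ₁ 1 - φ₁ 0 - 1 * φ₂ 0) -
        1 / 2 * (r - (1 - r)) * (φ₁ 1 - φ₁ 0) := by ring
  rw [e]
  refine (abs_sub _ _).trans ?_
  have h3 := abs_sub (φ 1 - φ 0 - 1 * φ₁ 0 - 1 ^ 2 / 2 * φ₂ 0)
    (1 / 2 * (φ₁ 1 - φ₁ 0 - 1 * φ₂ 0))
  rw [abs_mul (1 / 2 : ℝ), abs_of_pos (by norm_num : (0 : ℝ) < 1 / 2)] at h3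
  have h4 : |1 / 2 * (r - (1 - r)) * (φ₁ 1 - φ₁ 0)| ≤ 1 / 2 * |r - (1 - r)| * (M * 1) := by
    rw [abs_mul, abs_mul, abs_of_pos (by norm_num : (0 : ℝ) < 1 / 2)]
    gcongr
  linarith

variable {d : ℕ}

/-- Families of first, second and third partial derivatives of a function, with the bounds used in
the expansions below. -/
structure TestDerivs (g₁ : Fin d → EuclideanSpace ℝ (Fin d) → ℝ)
    (g₂ : Fin d → Fin d → EuclideanSpace ℝ (Fin d) → ℝ)
    (g₃ : Fin d → Fin d → Fin d → EuclideanSpace ℝ (Fin d) → ℝ) : Prop where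
  deriv₁ : ∀ i x v, HasDerivAt (fun s : ℝ => g₁ i (x + s • v)) (∑ j, g₂ i j x * v j) 0
  deriv₂ : ∀ i j x v, HasDerivAt (fun s : ℝ => g₂ i j (x + s • v)) (∑ l, g₃ i j l x * v l) 0
  bound₂ : ∀ i j x, |g₂ i j x| ≤ 1
  bound₃ : ∀ i j l x, |g₃ i j l x| ≤ 1
  lip₃ : ∀ i j l x y, |g₃ i j l x - g₃ i j l y| ≤ ∑ m, |x m - y m|

theorem hasDerivAt_line {f : EuclideanSpace ℝ (Fin d) → ℝ} {f' : EuclideanSpace ℝ (Fin d) → ℝ}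
    {v : EuclideanSpace ℝ (Fin d)}
    (h : ∀ x, HasDerivAt (fun s : ℝ => f (x + s • v)) (f' x) 0) (x : EuclideanSpace ℝ (Fin d))
    (s : ℝ) : HasDerivAt (fun s : ℝ => f (x + s • v)) (f' (x + s • v)) s := by
  have := h (x + s • v)
  rw [← sub_self s] at this
  have h2 := HasDerivAt.comp_sub_const s s this
  refine h2.congr_of_eventuallyEq (Filter.Eventually.of_forall fun t => ?_)
  simp [add_assoc, ← add_smul]

variable {g₁ : Fin d → EuclideanSpace ℝ (Fin d) → ℝ}
    {g₂ : Fin d → Fin d → EuclideanSpace ℝ (Fin d) → ℝ}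
    {g₃ : Fin d → Fin d → Fin d → EuclideanSpace ℝ (Fin d) → ℝ}

theorem TestDerivs.abs_increment_sub_le (h : TestDerivs g₁ g₂ g₃) (i : Fin d)
    (x v : EuclideanSpace ℝ (Fin d)) (r : ℝ) :
    |g₁ i (x + v) - g₁ i x - ∑ j, (r * g₂ i j (x + v) + (1 - r) * g₂ i j x) * v j| ≤
      1 / 2 * |r - (1 - r)| * (∑ j, |v j|) ^ 2 + 5 / 12 * (∑ j, |v j|) ^ 3 := by
  have key := abs_sub_sub_le (φ := fun s => g₁ i (x + s • v))
    (φ₁ := fun s => ∑ j, g₂ i j (x + s • v) * v j)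
    (φ₂ := fun s => ∑ j, (∑ l, g₃ i j l (x + s • v) * v l) * v j)
    (M := (∑ j, |v j|) ^ 2) (L := (∑ j, |v j|) ^ 3)
    (fun s => hasDerivAt_line (f' := fun y => ∑ j, g₂ i j y * v j) (fun y => h.deriv₁ i y v) x s)
    (fun s => by
      refine HasDerivAt.fun_sum fun j _ => HasDerivAt.mul_const ?_ _
      exact hasDerivAt_line (f' := fun y => ∑ l, g₃ i j l y * v l) (fun y => h.deriv₂ i j y v) x s)
    (fun s => ?_) (fun s hs => ?_) r
  · simp only [one_smul, zero_smul, add_zero] at key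
    refine le_trans (le_of_eq ?_) key
    congr 2
    rw [Finset.mul_sum, Finset.mul_sum, ← Finset.sum_add_distrib]
    exact Finset.sum_congr rfl fun j _ => by ring
  · rw [pow_two, Finset.mul_sum]
    refine (Finset.abs_sum_le_sum_abs _ _).trans (Finset.sum_le_sum fun j _ => ?_)
    rw [abs_mul]
    refine mul_le_mul_of_nonneg_right ?_ (abs_nonneg _)
    refine (Finset.abs_sum_le_sum_abs _ _).trans (Finset.sum_le_sum fun l _ => ?_)
    rw [abs_mul]
    exact mul_le_of_le_one_left (abs_nonneg _) (h.bound₃ _ _ _ _)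
  · have e : (∑ j, (∑ l, g₃ i j l (x + s • v) * v l) * v j) -
        ∑ j, (∑ l, g₃ i j l (x + (0 : ℝ) • v) * v l) * v j =
        ∑ j, (∑ l, (g₃ i j l (x + s • v) - g₃ i j l x) * v l) * v j := by
      simp only [zero_smul, add_zero, sub_mul, Finset.sum_sub_distrib]
    rw [e]
    have hl : ∀ j l, |g₃ i j l (x + s • v) - g₃ i j l x| ≤ s * ∑ m, |v m| := fun j l => by
      refine (h.lip₃ i j l _ _).trans (le_of_eq ?_)
      rw [Finset.mul_sum]
      refine Finset.sum_congr rfl fun m _ => ?_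
      simp [abs_mul, abs_of_nonneg hs]
    have e2 : (∑ j, |v j|) ^ 3 * s = ∑ j, (∑ l, s * (∑ m, |v m|) * |v l|) * |v j| := by
      simp only [← Finset.mul_sum]
      ring
    rw [e2]
    refine (Finset.abs_sum_le_sum_abs _ _).trans (Finset.sum_le_sum fun j _ => ?_)
    rw [abs_mul]
    refine mul_le_mul_of_nonneg_right ?_ (abs_nonneg _)
    refine (Finset.abs_sum_le_sum_abs _ _).trans (Finset.sum_le_sum fun l _ => ?_)
    rw [abs_mul]
    exact mul_le_mul_of_nonneg_right (hl j l) (abs_nonneg _)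

end D4

/-! ### The discrete chain rule and the approximate Stein equation. -/

namespace Rademacher

variable {p : ℕ → ℝ} [hp : Fact (∀ k, p k ∈ Set.Ioo (0 : ℝ) 1)] {d : ℕ}
    {g₁ : Fin d → EuclideanSpace ℝ (Fin d) → ℝ}
    {g₂ : Fin d → Fin d → EuclideanSpace ℝ (Fin d) → ℝ}
    {g₃ : Fin d → Fin d → Fin d → EuclideanSpace ℝ (Fin d) → ℝ}

/-- The random vector with given components. -/
def vec (f : Fin d → Space → ℝ) (ω : Space) : EuclideanSpace ℝ (Fin d) :=
  WithLp.toLp 2 fun i => f i ω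

theorem Cylinder.comp_vec {f : Fin d → Space → ℝ} (hf : ∀ i, Cylinder (f i))
    (φ : EuclideanSpace ℝ (Fin d) → ℝ) : Cylinder fun ω => φ (vec f ω) :=
  Cylinder.comp_family hf fun y => φ (WithLp.toLp 2 y)

/-- Quadrature with r = p_k between the two values of the vector. Its increment is the derivative
divided by √(p_k q_k), so the terms of degree two and three, multiplied by √(p_k q_k), acquire
1/√(p_k q_k) and 1/(p_k q_k). -/
theorem abs_D_comp_sub_le (h : D4.TestDerivs g₁ g₂ g₃) (f : Fin d → Space → ℝ) (i : Fin d)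
    (k : ℕ) (ω : Space) :
    |D p k (fun ω => g₁ i (vec f ω)) ω - ∑ j, (p k * g₂ i j (vec f (Function.update ω k 1)) +
      (1 - p k) * g₂ i j (vec f (Function.update ω k (-1)))) * D p k (f j) ω| ≤
      1 / 2 * (|p k - (1 - p k)| / √(p k * (1 - p k))) * (∑ j, |D p k (f j) ω|) ^ 2 +
        5 / 12 * (1 / (p k * (1 - p k))) * (∑ j, |D p k (f j) ω|) ^ 3 := by
  have hpq : 0 < p k * (1 - p k) := mul_pos (hp.out k).1 (sub_pos.2 (hp.out k).2)
  set x := vec f (Function.update ω k (-1))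
  set y := vec f (Function.update ω k 1)
  set σ := √(p k * (1 - p k)) with hσ
  have hσ0 : 0 < σ := Real.sqrt_pos.2 hpq
  have hσ2 : p k * (1 - p k) = σ ^ 2 := (Real.sq_sqrt hpq.le).symm
  have key := h.abs_increment_sub_le i x (y - x) (p k)
  have hD : ∀ j, D p k (f j) ω = σ * (y - x) j := fun j => rfl
  have hs : ∑ j, |D p k (f j) ω| = σ * ∑ j, |(y - x) j| := by
    simp_rw [hD, abs_mul, abs_of_pos hσ0, Finset.mul_sum]
  rw [add_sub_cancel] at key
  have e : D p k (fun ω => g₁ i (vec f ω)) ω - ∑ j, (p k * g₂ i j y + (1 - p k) * g₂ i j x) *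
      D p k (f j) ω = σ * (g₁ i y - g₁ i x - ∑ j, (p k * g₂ i j y + (1 - p k) * g₂ i j x) *
        (y - x) j) := by
    rw [mul_sub, Finset.mul_sum]
    congr 1
    exact Finset.sum_congr rfl fun j _ => by rw [hD]; ring
  rw [e, hs, abs_mul, abs_of_pos hσ0]
  refine (mul_le_mul_of_nonneg_left key hσ0.le).trans (le_of_eq ?_)
  rw [hσ2]
  field_simp

theorem mix_D_update (s : Finset ℕ) (k : ℕ) {u : Space → ℝ} (hu : Integrable u (law p))
    (ω : Space) (e : ℤˣ) : mix p s (D p k u) (Function.update ω k e) = mix p s (D p k u) ω := by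
  simp only [mix, avg_D_update _ k hu]

theorem integral_mul_eq_of_update {u v : Space → ℝ} (hu : Cylinder u) (hv : Cylinder v) {k : ℕ}
    (h : ∀ ω e, v (Function.update ω k e) = v ω) :
    ∫ ω, u ω * v ω ∂law p = ∫ ω, (p k * u (Function.update ω k 1) +
      (1 - p k) * u (Function.update ω k (-1))) * v ω ∂law p := by
  rw [integral_eq_update (hu.mul hv).integrable k]
  simp_rw [h, add_mul]
  rw [integral_add (((hu.update k 1).const_mul _).mul hv).integrable
    (((hu.update k (-1)).const_mul _).mul hv).integrable]
  simp_rw [mul_assoc]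
  rw [integral_const_mul, integral_const_mul]

/-- The quadrature weights p_k, q_k were chosen so that the averaged second derivative is the
integral of g₂ over coordinate k. The factors multiplying it are free of that coordinate, so under
the expectation it may be replaced by g₂ itself at no cost. -/
theorem abs_integral_D_comp_mul_sub_le (h : D4.TestDerivs g₁ g₂ g₃) {f : Fin d → Space → ℝ}
    (hf : ∀ i, Cylinder (f i)) {a : Space → ℝ} (ha : Cylinder a) {k : ℕ}
    (hak : ∀ ω e, a (Function.update ω k e) = a ω) (i : Fin d) :
    |∫ ω, D p k (fun ω => g₁ i (vec f ω)) ω * a ω ∂law p -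
      ∑ j, ∫ ω, g₂ i j (vec f ω) * (D p k (f j) ω * a ω) ∂law p| ≤
      1 / 2 * (|p k - (1 - p k)| / √(p k * (1 - p k))) *
        ∫ ω, (∑ j, |D p k (f j) ω|) ^ 2 * |a ω| ∂law p +
      5 / 12 * (1 / (p k * (1 - p k))) * ∫ ω, (∑ j, |D p k (f j) ω|) ^ 3 * |a ω| ∂law p := by
  have hg : ∀ j, Cylinder fun ω => g₂ i j (vec f ω) := fun j => Cylinder.comp_vec hf _
  have hDf : ∀ j, Cylinder (D p k (f j)) := fun j => (hf j).D k
  have hb : Cylinder fun ω => ∑ j, |D p k (f j) ω| := Cylinder.sum _ fun j _ => (hDf j).abs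
  set c : Fin d → Space → ℝ := fun j ω => p k * g₂ i j (vec f (Function.update ω k 1)) +
      (1 - p k) * g₂ i j (vec f (Function.update ω k (-1))) with hc
  have hcc : ∀ j, Cylinder (c j) := fun j =>
    (((hg j).update k 1).const_mul _).add (((hg j).update k (-1)).const_mul _)
  have e : ∀ j, ∫ ω, g₂ i j (vec f ω) * (D p k (f j) ω * a ω) ∂law p =
      ∫ ω, c j ω * (D p k (f j) ω * a ω) ∂law p := fun j =>
    integral_mul_eq_of_update (hg j) ((hDf j).mul ha) fun ω e => by rw [D_update, hak]
  simp_rw [e]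
  rw [← integral_finsetSum _ fun j _ => ((hcc j).mul ((hDf j).mul ha)).integrable,
    ← integral_sub (((Cylinder.comp_vec hf _).D k).mul ha).integrable
      (Cylinder.sum _ fun j _ => (hcc j).mul ((hDf j).mul ha)).integrable,
    ← integral_const_mul, ← integral_const_mul,
    ← integral_add (((hb.pow 2).mul ha.abs).const_mul _).integrable
      (((hb.pow 3).mul ha.abs).const_mul _).integrable]
  refine abs_integral_le_integral_abs.trans (integral_mono ?_ ?_ fun ω => ?_)
  · exact ((((Cylinder.comp_vec hf (g₁ i)).D (p := p) k).mul ha).sub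
      (Cylinder.sum _ fun j _ => (hcc j).mul ((hDf j).mul ha))).abs.integrable
  · exact ((((hb.pow 2).mul ha.abs).const_mul _).add
      (((hb.pow 3).mul ha.abs).const_mul _)).integrable
  · have := mul_le_mul_of_nonneg_right (abs_D_comp_sub_le (p := p) h f i k ω) (abs_nonneg (a ω))
    rw [← abs_mul, sub_mul, Finset.sum_mul] at this
    simp only [hc]
    refine le_trans (le_of_eq ?_) (this.trans (le_of_eq ?_))
    · congr 2
      exact Finset.sum_congr rfl fun j _ => by ring
    · ring

theorem integral_fourth_mix_le (s : Finset ℕ) {u : Space → ℝ} (hu : MemLp u 4 (law p)) :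
    ∫ ω, mix p s u ω ^ 4 ∂law p ≤ ∫ ω, u ω ^ 4 ∂law p := by
  have hc : ∀ A : Finset ℕ, Cylinder fun ω => weight s.card A.card * avg p A u ω ^ 4 := fun A =>
    ((cylinder_avg A u).pow 4).const_mul _
  calc _ ≤ ∫ ω, ∑ A ∈ s.powerset, weight s.card A.card * avg p A u ω ^ 4 ∂law p := by
        refine integral_mono ((cylinder_mix s u).pow 4).integrable
          (Cylinder.sum _ fun A _ => hc A).integrable fun ω => ?_
        have h1 := sq_sum_mul_le s.powerset (fun A => weight s.card A.card)
          (fun A => avg p A u ω) fun A _ => weight_nonneg _ _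
        have h2 := sq_sum_mul_le s.powerset (fun A => weight s.card A.card)
          (fun A => avg p A u ω ^ 2) fun A _ => weight_nonneg _ _
        rw [sum_weight, one_mul] at h1 h2
        have h3 := (pow_le_pow_left₀ (sq_nonneg _) h1 2).trans h2
        simp_rw [← pow_mul] at h3
        exact h3
    _ = ∑ A ∈ s.powerset, weight s.card A.card * ∫ ω, avg p A u ω ^ 4 ∂law p := by
        rw [integral_finsetSum _ fun A _ => (hc A).integrable]
        simp_rw [integral_const_mul]
    _ ≤ ∑ A ∈ s.powerset, weight s.card A.card * ∫ ω, u ω ^ 4 ∂law p :=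
        Finset.sum_le_sum fun A _ =>
          mul_le_mul_of_nonneg_left (integral_fourth_avg_le A hu) (weight_nonneg _ _)
    _ = _ := by rw [← Finset.sum_mul, sum_weight, one_mul]

variable (p) in
/-- The partial sums of the series in `B₃`. -/
def sumV (s : Finset ℕ) (F G : Space → ℝ) : ℝ :=
  ∑ k ∈ s, |p k - (1 - p k)| / √(p k * (1 - p k)) *
    (√(∫ ω, D p k F ω ^ 2 ∂law p) * √(∫ ω, D p k G ω ^ 4 ∂law p))

variable (p) in
/-- The partial sums of the series in `B₄`. -/
def sumW (s : Finset ℕ) (F G : Space → ℝ) : ℝ :=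
  ∑ k ∈ s, 1 / (p k * (1 - p k)) *
    (√√(∫ ω, D p k F ω ^ 4 ∂law p) *
      (√√(∫ ω, D p k G ω ^ 4 ∂law p) * √(∫ ω, D p k G ω ^ 4 ∂law p)))

theorem integral_sq_mul_abs_le {u v : Space → ℝ} (hu : Cylinder u) (hv : Cylinder v) :
    ∫ ω, v ω ^ 2 * |u ω| ∂law p ≤ √(∫ ω, u ω ^ 2 ∂law p) * √(∫ ω, v ω ^ 4 ∂law p) := by
  have := integral_mul_le_sqrt (μ := law p) ((hv.pow 2).memLp 2) (hu.abs.memLp 2)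
  simp only [sq_abs, ← pow_mul] at this
  rwa [mul_comm (√_)] at this

/-- Hölder's inequality with exponents 4/3 and 4, obtained from Cauchy–Schwarz for |u||v| · v² and
then for u² · v². -/
theorem integral_cube_mul_abs_le {u v : Space → ℝ} (hu : Cylinder u) (hv : Cylinder v) :
    ∫ ω, |v ω| ^ 3 * |u ω| ∂law p ≤ √√(∫ ω, u ω ^ 4 ∂law p) *
      (√√(∫ ω, v ω ^ 4 ∂law p) * √(∫ ω, v ω ^ 4 ∂law p)) := by
  have h1 := integral_mul_le_sqrt (μ := law p) ((hu.abs.mul hv.abs).memLp 2) ((hv.pow 2).memLp 2)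
  have h2 := integral_mul_le_sqrt (μ := law p) ((hu.pow 2).memLp 2) ((hv.pow 2).memLp 2)
  simp only [mul_pow, sq_abs, ← pow_mul] at h1 h2
  have h3 := Real.sqrt_le_sqrt h2
  rw [Real.sqrt_mul (Real.sqrt_nonneg _)] at h3
  refine le_trans (le_of_eq ?_) (h1.trans ((mul_le_mul_of_nonneg_right h3
    (Real.sqrt_nonneg _)).trans (le_of_eq (mul_assoc _ _ _))))
  refine integral_congr_ae (ae_of_all _ fun ω => ?_)
  have := sq_abs (v ω)
  simp only
  rw [← this]
  ring

theorem sum_abs_pow_le (x : Fin d → ℝ) (n : ℕ) :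
    (∑ j, |x j|) ^ (n + 1) ≤ (d : ℝ) ^ n * ∑ j, |x j| ^ (n + 1) := by
  have := pow_sum_div_card_le_sum_pow (s := Finset.univ) (f := fun j => |x j|)
    (fun j _ => abs_nonneg _) n
  rcases Nat.eq_zero_or_pos d with rfl | hd
  · simp
  · rwa [div_le_iff₀' (by simp; positivity), Finset.card_univ, Fintype.card_fin] at this

theorem integral_sum_abs_pow_mul_le {f : Fin d → Space → ℝ} (hf : ∀ i, Cylinder (f i))
    {a : Space → ℝ} (ha : Cylinder a) (n : ℕ) :
    ∫ ω, (∑ j, |f j ω|) ^ (n + 1) * |a ω| ∂law p ≤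
      (d : ℝ) ^ n * ∑ j, ∫ ω, |f j ω| ^ (n + 1) * |a ω| ∂law p := by
  have hc : ∀ j, Cylinder fun ω => |f j ω| ^ (n + 1) * |a ω| := fun j =>
    ((hf j).abs.pow _).mul ha.abs
  rw [← integral_finsetSum _ fun j _ => (hc j).integrable, ← integral_const_mul]
  refine integral_mono (((Cylinder.sum _ fun j _ => (hf j).abs).pow _).mul ha.abs).integrable
    ((Cylinder.sum _ fun j _ => hc j).const_mul _).integrable fun ω => ?_
  simp only
  rw [← Finset.sum_mul, ← mul_assoc]
  exact mul_le_mul_of_nonneg_right (sum_abs_pow_le _ n) (abs_nonneg _)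

section Stein

variable {F : Fin d → Space → ℝ}

/-- The covariance formula with G a first derivative of the test function at f, followed by the
chain rule. The function `mix p s (D p k (F i))` is free of coordinate k, as that step requires, and
the powers of d come from the power mean inequality. -/
theorem abs_integral_mul_sub_integral_carre_le (h : D4.TestDerivs g₁ g₂ g₃)
    (hF2 : ∀ i, MemLp (F i) 2 (law p)) (hF0 : ∀ i, ∫ ω, F i ω ∂law p = 0)
    (hF4 : ∀ i k, MemLp (D p k (F i)) 4 (law p)) (s : Finset ℕ) (i : Fin d) :
    |∫ ω, avg p s (F i) ω * g₁ i (vec (fun i => avg p s (F i)) ω) ∂law p -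
      ∑ j, ∫ ω, g₂ i j (vec (fun i => avg p s (F i)) ω) * carre p s (F i) (F j) ω ∂law p| ≤
    ∑ j, (1 / 2 * d * sumV p s (F i) (F j) + 5 / 12 * d ^ 2 * sumW p s (F i) (F j)) := by
  set f : Fin d → Space → ℝ := fun i => avg p s (F i)
  have hf : ∀ i, Cylinder (f i) := fun i => cylinder_avg s (F i)
  have hFi : ∀ i, Integrable (F i) (law p) := fun i => (hF2 i).integrable one_le_two
  set a : ℕ → Space → ℝ := fun k => mix p s (D p k (F i))
  have ha : ∀ k, Cylinder (a k) := fun k => cylinder_mix s _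
  have hDf : ∀ k j, Cylinder (D p k (f j)) := fun k j => (hf j).D k
  have hpq : ∀ k, 0 < p k * (1 - p k) := fun k => mul_pos (hp.out k).1 (sub_pos.2 (hp.out k).2)
  have e1 : ∫ ω, f i ω * g₁ i (vec f ω) ∂law p =
      ∑ k ∈ s, ∫ ω, D p k (fun ω => g₁ i (vec f ω)) ω * a k ω ∂law p := by
    rw [← integral_mul_avg_sub s (hFi i) (Cylinder.comp_vec hf (g₁ i)), hF0, mul_zero, sub_zero]
    simp_rw [mul_comm]
    rfl
  have e2 : ∑ j, ∫ ω, g₂ i j (vec f ω) * carre p s (F i) (F j) ω ∂law p =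
      ∑ k ∈ s, ∑ j, ∫ ω, g₂ i j (vec f ω) * (D p k (f j) ω * a k ω) ∂law p := by
    rw [Finset.sum_comm]
    refine Finset.sum_congr rfl fun j _ => ?_
    rw [← integral_finsetSum _ fun k _ => ((Cylinder.comp_vec hf (g₂ i j)).mul
      ((hDf k j).mul (ha k))).integrable]
    simp_rw [carre, Finset.mul_sum]
    rfl
  have h2 : ∀ k ∈ s, ∀ j, ∫ ω, |D p k (f j) ω| ^ 2 * |a k ω| ∂law p ≤
      √(∫ ω, D p k (F i) ω ^ 2 ∂law p) * √(∫ ω, D p k (F j) ω ^ 4 ∂law p) := by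
    intro k hk j
    simp_rw [sq_abs]
    refine (integral_sq_mul_abs_le (ha k) (hDf k j)).trans ?_
    refine mul_le_mul (Real.sqrt_le_sqrt (integral_sq_mix_le s (hF4 i k).two_of_four))
      (Real.sqrt_le_sqrt ?_) (Real.sqrt_nonneg _) (Real.sqrt_nonneg _)
    rw [D_avg_of_mem hk (hFi j)]
    exact integral_fourth_avg_le s (hF4 j k)
  have h3 : ∀ k ∈ s, ∀ j, ∫ ω, |D p k (f j) ω| ^ 3 * |a k ω| ∂law p ≤
      √√(∫ ω, D p k (F i) ω ^ 4 ∂law p) *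
      (√√(∫ ω, D p k (F j) ω ^ 4 ∂law p) * √(∫ ω, D p k (F j) ω ^ 4 ∂law p)) := by
    intro k hk j
    refine (integral_cube_mul_abs_le (ha k) (hDf k j)).trans ?_
    have h4 : ∫ ω, D p k (f j) ω ^ 4 ∂law p ≤ ∫ ω, D p k (F j) ω ^ 4 ∂law p := by
      rw [D_avg_of_mem hk (hFi j)]
      exact integral_fourth_avg_le s (hF4 j k)
    have h5 := integral_fourth_mix_le s (hF4 i k)
    gcongr
  rw [e1, e2, ← Finset.sum_sub_distrib]
  refine (Finset.abs_sum_le_sum_abs _ _).trans ?_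
  calc _ ≤ ∑ k ∈ s, ∑ j, (1 / 2 * d * (|p k - (1 - p k)| / √(p k * (1 - p k)) *
          (√(∫ ω, D p k (F i) ω ^ 2 ∂law p) * √(∫ ω, D p k (F j) ω ^ 4 ∂law p))) +
          5 / 12 * d ^ 2 * (1 / (p k * (1 - p k)) * (√√(∫ ω, D p k (F i) ω ^ 4 ∂law p) *
      (√√(∫ ω, D p k (F j) ω ^ 4 ∂law p) * √(∫ ω, D p k (F j) ω ^ 4 ∂law p))))) := by
        refine Finset.sum_le_sum fun k hk => ?_
        refine (abs_integral_D_comp_mul_sub_le h hf (ha k)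
          (fun ω e => mix_D_update s k (hFi i) ω e) i).trans ?_
        rw [Finset.sum_add_distrib]
        refine add_le_add ?_ ?_
        · have := (integral_sum_abs_pow_mul_le (p := p) (hDf k) (ha k) 1).trans
            (mul_le_mul_of_nonneg_left (Finset.sum_le_sum fun j _ => h2 k hk j) (by positivity))
          refine (mul_le_mul_of_nonneg_left this (by positivity)).trans (le_of_eq ?_)
          simp only [Finset.mul_sum]
          exact Finset.sum_congr rfl fun j _ => by ring
        · have := (integral_sum_abs_pow_mul_le (p := p) (hDf k) (ha k) 2).trans
            (mul_le_mul_of_nonneg_left (Finset.sum_le_sum fun j _ => h3 k hk j) (by positivity))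
          have h0 := hpq k
          refine (mul_le_mul_of_nonneg_left this (by positivity)).trans (le_of_eq ?_)
          simp only [Finset.mul_sum]
          exact Finset.sum_congr rfl fun j _ => by ring
    _ = _ := by
        rw [Finset.sum_comm]
        refine Finset.sum_congr rfl fun j _ => ?_
        rw [Finset.sum_add_distrib, ← Finset.mul_sum, ← Finset.mul_sum]
        rfl

/-- The covariance formula for `avg p s G` and F. -/
theorem integral_carre (s : Finset ℕ) {F G : Space → ℝ} (hF : Integrable F (law p))
    (hF0 : ∫ ω, F ω ∂law p = 0) :
    ∫ ω, carre p s F G ω ∂law p = ∫ ω, avg p s F ω * avg p s G ω ∂law p := by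
  unfold carre
  rw [integral_finsetSum _ fun k _ => (((cylinder_avg s G).D k).mul
    (cylinder_mix s (D p k F))).integrable, ← integral_mul_avg_sub s hF (cylinder_avg s G),
    hF0, mul_zero, sub_zero]
  simp_rw [mul_comm]

theorem cylinder_carre (s : Finset ℕ) (F G : Space → ℝ) : Cylinder (carre p s F G) :=
  Cylinder.sum _ fun k _ => ((cylinder_avg s G).D k).mul (cylinder_mix s _)

variable (p) in
/-- The bound for the approximate Stein equation satisfied by the conditional expectations of `F`
given the coordinates in `s`. -/
def steinBound (s : Finset ℕ) (F : Fin d → Space → ℝ) (S : Matrix (Fin d) (Fin d) ℝ) : ℝ :=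
  ∑ i, ∑ j, (|S i j - ∫ ω, avg p s (F i) ω * avg p s (F j) ω ∂law p| +
    (√(sumT p s (F i) (F j)) + 1 / 2 * √(sumT p s (F j) (F i)) +
      1 / 2 * √(sumU p s (F i) (F j))) +
    (1 / 2 * d * sumV p s (F i) (F j) + 5 / 12 * d ^ 2 * sumW p s (F i) (F j)))

/-- Since |g₂| ≤ 1, replacing `carre` by its mean costs its mean absolute deviation, and replacing
that mean by the entry of S costs their distance. -/
theorem abs_stein_le (h : D4.TestDerivs g₁ g₂ g₃)
    (hF2 : ∀ i, MemLp (F i) 2 (law p)) (hF0 : ∀ i, ∫ ω, F i ω ∂law p = 0)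
    (hF4 : ∀ i k, MemLp (D p k (F i)) 4 (law p)) (s : Finset ℕ) (S : Matrix (Fin d) (Fin d) ℝ) :
    |∑ i, ∫ ω, avg p s (F i) ω * g₁ i (vec (fun i => avg p s (F i)) ω) ∂law p -
      ∑ i, ∑ j, S i j * ∫ ω, g₂ i j (vec (fun i => avg p s (F i)) ω) ∂law p| ≤
      steinBound p s F S := by
  set f : Fin d → Space → ℝ := fun i => avg p s (F i)
  have hf : ∀ i, Cylinder (f i) := fun i => cylinder_avg s (F i)
  have hFi : ∀ i, Integrable (F i) (law p) := fun i => (hF2 i).integrable one_le_two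
  have key : ∀ i j, |∫ ω, g₂ i j (vec f ω) * carre p s (F i) (F j) ω ∂law p -
      S i j * ∫ ω, g₂ i j (vec f ω) ∂law p| ≤
      |S i j - ∫ ω, f i ω * f j ω ∂law p| + (√(sumT p s (F i) (F j)) +
        1 / 2 * √(sumT p s (F j) (F i)) + 1 / 2 * √(sumU p s (F i) (F j))) := by
    intro i j
    have hg := Cylinder.comp_vec hf (g₂ i j)
    have hc := cylinder_carre (p := p) s (F i) (F j)
    have hK := integral_abs_carre_sub_le s (hF2 i) (hF2 j) (hF4 i) (hF4 j)
    set c := ∫ ω, carre p s (F i) (F j) ω ∂law p with hcdef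
    have hcf : c = ∫ ω, f i ω * f j ω ∂law p := integral_carre s (hFi i) (hF0 i)
    rw [← hcf, ← integral_const_mul, ← integral_sub (hg.mul hc).integrable
      (hg.const_mul _).integrable]
    refine abs_integral_le_integral_abs.trans ?_
    calc _ ≤ ∫ ω, (|S i j - c| + |carre p s (F i) (F j) ω - c|) ∂law p := by
          refine integral_mono ((hg.mul hc).sub (hg.const_mul _)).abs.integrable
            ((Cylinder.const _).add (hc.sub (.const c)).abs).integrable fun ω => ?_
          simp only
          rw [mul_comm (S i j), ← mul_sub, abs_mul]
          refine (mul_le_of_le_one_left (abs_nonneg _) (h.bound₂ _ _ _)).trans ?_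
          have := abs_sub_le (carre p s (F i) (F j) ω) c (S i j)
          rw [abs_sub_comm c] at this
          linarith
      _ = |S i j - c| + ∫ ω, |carre p s (F i) (F j) ω - c| ∂law p := by
          rw [integral_add (integrable_const _) (hc.sub (.const c)).abs.integrable]
          simp
      _ ≤ _ := by gcongr
  have e : ∑ i, ∫ ω, f i ω * g₁ i (vec f ω) ∂law p -
      ∑ i, ∑ j, S i j * ∫ ω, g₂ i j (vec f ω) ∂law p =
      ∑ i, ((∫ ω, f i ω * g₁ i (vec f ω) ∂law p -
        ∑ j, ∫ ω, g₂ i j (vec f ω) * carre p s (F i) (F j) ω ∂law p) +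
      ∑ j, (∫ ω, g₂ i j (vec f ω) * carre p s (F i) (F j) ω ∂law p -
        S i j * ∫ ω, g₂ i j (vec f ω) ∂law p)) := by
    simp only [Finset.sum_add_distrib, Finset.sum_sub_distrib]
    ring
  rw [e]
  refine (Finset.abs_sum_le_sum_abs _ _).trans (Finset.sum_le_sum fun i _ => ?_)
  refine (abs_add_le _ _).trans ?_
  rw [Finset.sum_add_distrib, add_comm]
  exact add_le_add ((Finset.abs_sum_le_sum_abs _ _).trans (Finset.sum_le_sum fun j _ => key i j))
    (abs_integral_mul_sub_integral_carre_le h hF2 hF0 hF4 s i)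

end Stein

end Rademacher

end

/-! ### Regularity of test functions. -/

noncomputable section

namespace D4

variable {d : ℕ}

/-- Pass from y to x one coordinate at a time, so that only derivatives along coordinate lines are
used. All intermediate points satisfy the condition under which hK gives its bound. -/
theorem abs_sub_sub_sum_le {f : EuclideanSpace ℝ (Fin d) → ℝ}
    {f' : Fin d → EuclideanSpace ℝ (Fin d) → ℝ}
    (hf : ∀ i x, HasLineDerivAt ℝ f (f' i x) x (EuclideanSpace.single i 1))
    (x y : EuclideanSpace ℝ (Fin d)) (c : Fin d → ℝ) {K : ℝ}
    (hK : ∀ i z, (∀ m, |z m - y m| ≤ |x m - y m|) → |f' i z - c i| ≤ K) :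
    |f x - f y - ∑ i, c i * (x i - y i)| ≤ K * ∑ i, |x i - y i| := by
  set z : Finset (Fin d) → EuclideanSpace ℝ (Fin d) := fun A =>
    WithLp.toLp 2 (A.piecewise x y) with hz
  have key : ∀ A : Finset (Fin d),
      |f (z A) - f y - ∑ i ∈ A, c i * (x i - y i)| ≤ K * ∑ i ∈ A, |x i - y i| := by
    intro A
    induction A using Finset.induction_on with
    | empty => simp [hz]
    | insert a A ha ih =>
      have hline : ∀ s : ℝ, HasDerivAt
          (fun s : ℝ => f (z A + s • ((x a - y a) • EuclideanSpace.single a (1 : ℝ))))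
          ((x a - y a) * f' a (z A + s • ((x a - y a) • EuclideanSpace.single a (1 : ℝ)))) s := by
        intro s
        refine hasDerivAt_line (f' := fun w => (x a - y a) * f' a w) (fun w => ?_) (z A) s
        exact (hf a w).smul (x a - y a)
      have hmv := norm_le_of_hasDerivAt_of_le
        (f := fun s => f (z A + s • ((x a - y a) • EuclideanSpace.single a (1 : ℝ))) - f (z A) -
          s * (c a * (x a - y a)))
        (f' := fun s => (x a - y a) *
          f' a (z A + s • ((x a - y a) • EuclideanSpace.single a (1 : ℝ))) - c a * (x a - y a))
        (B := fun s => K * |x a - y a| * s) (B' := fun _ => K * |x a - y a|)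
        (fun s => by
          simpa using ((hline s).sub_const (f (z A))).fun_sub
            ((hasDerivAt_id s).mul_const (c a * (x a - y a))))
        (fun s => by simpa using (hasDerivAt_id s).const_mul (K * |x a - y a|)) (by simp)
        (fun s hs => by
          rw [mul_comm (x a - y a), ← sub_mul, abs_mul]
          refine mul_le_mul_of_nonneg_right (hK a _ fun m => ?_) (abs_nonneg _)
          by_cases hm : m = a
          · subst hm
            simp only [hz, PiLp.add_apply, PiLp.smul_apply, PiLp.single_apply,
              Finset.piecewise_eq_of_notMem _ _ _ ha, if_true, smul_eq_mul, mul_one,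
              add_sub_cancel_left, abs_mul, abs_of_nonneg hs.1]
            exact mul_le_of_le_one_left (abs_nonneg _) hs.2.le
          · by_cases hmA : m ∈ A <;> simp [hz, hm, hmA])
        1 (by simp)
      have hzi : z A + (1 : ℝ) • ((x a - y a) • EuclideanSpace.single a (1 : ℝ)) =
          z (insert a A) := by
        ext m
        by_cases hm : m = a
        · subst hm; simp [hz, ha]
        · simp [hz, hm, Finset.piecewise]
      rw [hzi] at hmv
      rw [Finset.sum_insert ha, Finset.sum_insert ha, mul_add]
      have e : f (z (insert a A)) - f y - (c a * (x a - y a) + ∑ i ∈ A, c i * (x i - y i)) =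
          (f (z (insert a A)) - f (z A) - 1 * (c a * (x a - y a))) +
            (f (z A) - f y - ∑ i ∈ A, c i * (x i - y i)) := by ring
      rw [e]
      refine (abs_add_le _ _).trans (add_le_add (hmv.trans (le_of_eq (by ring))) ih)
  simpa [hz] using key Finset.univ

theorem abs_sub_le_of_abs_deriv_le {f : EuclideanSpace ℝ (Fin d) → ℝ}
    {f' : Fin d → EuclideanSpace ℝ (Fin d) → ℝ}
    (hf : ∀ i x, HasLineDerivAt ℝ f (f' i x) x (EuclideanSpace.single i 1))
    (h : ∀ i x, |f' i x| ≤ 1) (x y : EuclideanSpace ℝ (Fin d)) :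
    |f x - f y| ≤ ∑ i, |x i - y i| := by
  simpa using abs_sub_sub_sum_le hf x y 0 (K := 1) fun i z _ => by simpa using h i z

/-- The linear form with given coefficients. -/
def grad (f' : Fin d → EuclideanSpace ℝ (Fin d) → ℝ) (x : EuclideanSpace ℝ (Fin d)) :
    EuclideanSpace ℝ (Fin d) →L[ℝ] ℝ :=
  ∑ i, f' i x • (EuclideanSpace.proj i : EuclideanSpace ℝ (Fin d) →L[ℝ] ℝ)

theorem grad_apply (f' : Fin d → EuclideanSpace ℝ (Fin d) → ℝ)
    (x v : EuclideanSpace ℝ (Fin d)) : grad f' x v = ∑ i, f' i x * v i := by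
  simp [grad]

theorem grad_single (f' : Fin d → EuclideanSpace ℝ (Fin d) → ℝ)
    (x : EuclideanSpace ℝ (Fin d)) (i : Fin d) :
    grad f' x (EuclideanSpace.single i 1) = f' i x := by
  simp [grad_apply]

theorem continuous_of_abs_sub_le {f : EuclideanSpace ℝ (Fin d) → ℝ}
    (h : ∀ x y, |f x - f y| ≤ ∑ i, |x i - y i|) : Continuous f := by
  refine continuous_iff_continuousAt.2 fun x => ?_
  rw [ContinuousAt, tendsto_iff_dist_tendsto_zero]
  have hc : Continuous fun y : EuclideanSpace ℝ (Fin d) => ∑ i, |y i - x i| := by fun_prop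
  have := hc.tendsto x
  simp only [sub_self, abs_zero, Finset.sum_const_zero] at this
  exact squeeze_zero (fun _ => dist_nonneg) (fun y => h y x) this

theorem sum_abs_le (x : EuclideanSpace ℝ (Fin d)) : ∑ i, |x i| ≤ d * ‖x‖ := by
  have : ∀ i ∈ Finset.univ, |x i| ≤ ‖x‖ := fun i _ => PiLp.norm_apply_le x i
  simpa using Finset.sum_le_card_nsmul _ _ _ this

/-- Lipschitz partial derivatives make the remainder quadratic. For test functions the Lipschitz
property comes from the bound one order higher, so mere partial differentiability yields total
differentiability up to order three. -/
theorem hasFDerivAt_grad {f : EuclideanSpace ℝ (Fin d) → ℝ}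
    {f' : Fin d → EuclideanSpace ℝ (Fin d) → ℝ}
    (hf : ∀ i x, HasLineDerivAt ℝ f (f' i x) x (EuclideanSpace.single i 1))
    (h : ∀ i x y, |f' i x - f' i y| ≤ ∑ m, |x m - y m|) (x : EuclideanSpace ℝ (Fin d)) :
    HasFDerivAt f (grad f' x) x := by
  rw [hasFDerivAt_iff_isLittleO]
  have hO : (fun y => f y - f x - grad f' x (y - x)) =O[nhds x] fun y => ‖y - x‖ ^ 2 := by
    refine Asymptotics.IsBigO.of_bound ((d : ℝ) ^ 2) (Filter.Eventually.of_forall fun y => ?_)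
    have h1 := abs_sub_sub_sum_le hf y x (fun i => f' i x) (K := ∑ m, |y m - x m|)
      fun i z hz => (h i z x).trans (Finset.sum_le_sum fun m _ => hz m)
    have h2 := sum_abs_le (y - x)
    simp only [PiLp.sub_apply] at h2
    have h0 : 0 ≤ ∑ m, |y m - x m| := Finset.sum_nonneg fun _ _ => abs_nonneg _
    rw [grad_apply, Real.norm_eq_abs]
    refine h1.trans ((mul_le_mul h2 h2 h0 (h0.trans h2)).trans (le_of_eq ?_))
    simp
    ring
  refine hO.trans_isLittleO ?_
  have := Asymptotics.isLittleO_norm_pow_id (E' := EuclideanSpace ℝ (Fin d)) one_lt_two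
  exact this.comp_tendsto (tendsto_sub_nhds_zero_iff.2 Filter.tendsto_id)

theorem hasLineDerivAt_pderiv {g : EuclideanSpace ℝ (Fin d) → ℝ} {i : Fin d}
    {x : EuclideanSpace ℝ (Fin d)}
    (h : LineDifferentiableAt ℝ g x (EuclideanSpace.single i 1)) :
    HasLineDerivAt ℝ g (pderiv i g x) x (EuclideanSpace.single i 1) :=
  h.hasLineDerivAt

theorem abs_iterPderiv_le {n : ℕ} {g : EuclideanSpace ℝ (Fin d) → ℝ} (h : M n g ≤ 1)
    (i : Fin n → Fin d) (x : EuclideanSpace ℝ (Fin d)) : |iterPderiv n i g x| ≤ 1 := by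
  have : ENNReal.ofReal |iterPderiv n i g x| ≤ 1 := (le_iSup₂ (f := fun (i : Fin n → Fin d)
    (x : EuclideanSpace ℝ (Fin d)) => ENNReal.ofReal |iterPderiv n i g x|) i x).trans h
  simpa using this

namespace IsTest

variable {g : EuclideanSpace ℝ (Fin d) → ℝ}

theorem line₀ (hg : IsTest g) (i : Fin d) (x : EuclideanSpace ℝ (Fin d)) :
    HasLineDerivAt ℝ g (pderiv i g x) x (EuclideanSpace.single i 1) :=
  hasLineDerivAt_pderiv (hg.1 0 (by norm_num) ![] i x)

theorem line₁ (hg : IsTest g) (i j : Fin d) (x : EuclideanSpace ℝ (Fin d)) :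
    HasLineDerivAt ℝ (pderiv i g) (pderiv j (pderiv i g) x) x (EuclideanSpace.single j 1) :=
  hasLineDerivAt_pderiv (hg.1 1 (by norm_num) ![i] j x)

theorem line₂ (hg : IsTest g) (i j l : Fin d) (x : EuclideanSpace ℝ (Fin d)) :
    HasLineDerivAt ℝ (pderiv j (pderiv i g)) (pderiv l (pderiv j (pderiv i g)) x) x
      (EuclideanSpace.single l 1) :=
  hasLineDerivAt_pderiv (hg.1 2 (by norm_num) ![j, i] l x)

theorem line₃ (hg : IsTest g) (i j l m : Fin d) (x : EuclideanSpace ℝ (Fin d)) :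
    HasLineDerivAt ℝ (pderiv l (pderiv j (pderiv i g)))
      (pderiv m (pderiv l (pderiv j (pderiv i g))) x) x (EuclideanSpace.single m 1) :=
  hasLineDerivAt_pderiv (hg.1 3 (by norm_num) ![l, j, i] m x)

theorem bound₁ (hg : IsTest g) (i : Fin d) (x : EuclideanSpace ℝ (Fin d)) : |pderiv i g x| ≤ 1 :=
  abs_iterPderiv_le hg.2.1 ![i] x

theorem bound₂ (hg : IsTest g) (i j : Fin d) (x : EuclideanSpace ℝ (Fin d)) :
    |pderiv j (pderiv i g) x| ≤ 1 :=
  abs_iterPderiv_le hg.2.2.1 ![j, i] x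

theorem bound₃ (hg : IsTest g) (i j l : Fin d) (x : EuclideanSpace ℝ (Fin d)) :
    |pderiv l (pderiv j (pderiv i g)) x| ≤ 1 :=
  abs_iterPderiv_le hg.2.2.2.1 ![l, j, i] x

theorem bound₄ (hg : IsTest g) (i j l m : Fin d) (x : EuclideanSpace ℝ (Fin d)) :
    |pderiv m (pderiv l (pderiv j (pderiv i g))) x| ≤ 1 :=
  abs_iterPderiv_le hg.2.2.2.2 ![m, l, j, i] x

theorem lip₀ (hg : IsTest g) (x y : EuclideanSpace ℝ (Fin d)) :
    |g x - g y| ≤ ∑ m, |x m - y m| :=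
  abs_sub_le_of_abs_deriv_le hg.line₀ hg.bound₁ x y

theorem lip₁ (hg : IsTest g) (i : Fin d) (x y : EuclideanSpace ℝ (Fin d)) :
    |pderiv i g x - pderiv i g y| ≤ ∑ m, |x m - y m| :=
  abs_sub_le_of_abs_deriv_le (hg.line₁ i) (hg.bound₂ i) x y

theorem lip₂ (hg : IsTest g) (i j : Fin d) (x y : EuclideanSpace ℝ (Fin d)) :
    |pderiv j (pderiv i g) x - pderiv j (pderiv i g) y| ≤ ∑ m, |x m - y m| :=
  abs_sub_le_of_abs_deriv_le (hg.line₂ i j) (hg.bound₃ i j) x y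

theorem lip₃ (hg : IsTest g) (i j l : Fin d) (x y : EuclideanSpace ℝ (Fin d)) :
    |pderiv l (pderiv j (pderiv i g)) x - pderiv l (pderiv j (pderiv i g)) y| ≤
      ∑ m, |x m - y m| :=
  abs_sub_le_of_abs_deriv_le (hg.line₃ i j l) (hg.bound₄ i j l) x y

theorem hasFDerivAt₀ (hg : IsTest g) (x : EuclideanSpace ℝ (Fin d)) :
    HasFDerivAt g (grad (fun i => pderiv i g) x) x :=
  hasFDerivAt_grad hg.line₀ hg.lip₁ x

theorem hasFDerivAt₁ (hg : IsTest g) (i : Fin d) (x : EuclideanSpace ℝ (Fin d)) :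
    HasFDerivAt (pderiv i g) (grad (fun j => pderiv j (pderiv i g)) x) x :=
  hasFDerivAt_grad (hg.line₁ i) (hg.lip₂ i) x

theorem hasFDerivAt₂ (hg : IsTest g) (i j : Fin d) (x : EuclideanSpace ℝ (Fin d)) :
    HasFDerivAt (pderiv j (pderiv i g)) (grad (fun l => pderiv l (pderiv j (pderiv i g))) x) x :=
  hasFDerivAt_grad (hg.line₂ i j) (hg.lip₃ i j) x

/-- The derivatives of `x ↦ r⁻² g (r x + c)`. -/
theorem testDerivs_rescale (hg : IsTest g) {r : ℝ} (hr0 : 0 < r) (hr1 : r ≤ 1)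
    (c : EuclideanSpace ℝ (Fin d)) :
    TestDerivs (fun i x => r⁻¹ * pderiv i g (r • x + c))
      (fun i j x => pderiv j (pderiv i g) (r • x + c))
      (fun i j l x => r * pderiv l (pderiv j (pderiv i g)) (r • x + c)) := by
  have hcurve : ∀ x v : EuclideanSpace ℝ (Fin d),
      HasDerivAt (fun s : ℝ => r • (x + s • v) + c) (r • v) 0 := fun x v => by
    have := (((hasDerivAt_id (0 : ℝ)).smul_const v).const_add x).const_smul r
    simpa using this.add_const c
  -- The factor r⁻² leaves the second derivatives unscaled; the third ones gain a factor r and their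
  -- Lipschitz constants r², both at most 1. The first derivatives, scaled by r⁻¹, need no bound.
  refine ⟨fun i x v => ?_, fun i j x v => ?_, fun i j x => hg.bound₂ i j _,
    fun i j l x => ?_, fun i j l x y => ?_⟩
  · have h := (hg.hasFDerivAt₁ i (r • (x + (0 : ℝ) • v) + c)).comp_hasDerivAt 0 (hcurve x v)
    refine (h.const_mul r⁻¹).congr_deriv ?_
    simp only [zero_smul, add_zero, map_smul, grad_apply, smul_eq_mul, Finset.mul_sum]
    refine Finset.sum_congr rfl fun j _ => ?_
    field_simp
  · have h := (hg.hasFDerivAt₂ i j (r • (x + (0 : ℝ) • v) + c)).comp_hasDerivAt 0 (hcurve x v)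
    refine h.congr_deriv ?_
    simp [grad_apply, Finset.mul_sum, mul_assoc]
  · rw [abs_mul, abs_of_pos hr0]
    exact mul_le_one₀ hr1 (abs_nonneg _) (hg.bound₃ i j l _)
  · rw [← mul_sub, abs_mul, abs_of_pos hr0]
    refine (mul_le_mul_of_nonneg_left (hg.lip₃ i j l _ _) hr0.le).trans ?_
    rw [Finset.mul_sum]
    refine Finset.sum_le_sum fun m _ => ?_
    have : (r • x + c) m - (r • y + c) m = r * (x m - y m) := by simp; ring
    rw [this, abs_mul, abs_of_pos hr0, ← mul_assoc]
    exact mul_le_of_le_one_left (abs_nonneg _) (mul_le_one₀ hr1 hr0.le hr1)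

end IsTest

end D4

end

/-! ### Gaussian integration by parts. -/

noncomputable section

open scoped MatrixOrder

namespace D4

/-- Stein's identity. -/
theorem integral_id_mul_gaussianReal {f f' : ℝ → ℝ} (hf : ∀ x, HasDerivAt f (f' x) x)
    (hfi : Integrable f (gaussianReal 0 1)) (hf' : Integrable f' (gaussianReal 0 1))
    (hxf : Integrable (fun x => x * f x) (gaussianReal 0 1)) :
    ∫ x, x * f x ∂gaussianReal 0 1 = ∫ x, f' x ∂gaussianReal 0 1 := by
  have hpdf : ∀ x, HasDerivAt (gaussianPDFReal 0 1) (-(x * gaussianPDFReal 0 1 x)) x := by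
    intro x
    have h1 : HasDerivAt (fun x : ℝ => -(x - 0) ^ 2 / (2 * ((1 : NNReal) : ℝ))) (-x) x := by
      have := ((((hasDerivAt_id x).sub_const 0).pow 2).neg).div_const (2 * ((1 : NNReal) : ℝ))
      refine this.congr_deriv ?_
      simp
      ring
    rw [gaussianPDFReal_def]
    refine (h1.exp.const_mul _).congr_deriv ?_
    ring
  have hI : ∀ u : ℝ → ℝ, Integrable u (gaussianReal 0 1) →
      Integrable fun x => gaussianPDFReal 0 1 x * u x := by
    intro u hu
    rw [gaussianReal_of_var_ne_zero 0 one_ne_zero, integrable_withDensity_iff_integrable_smul'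
      (measurable_gaussianPDF 0 1) (ae_of_all _ fun _ => gaussianPDF_lt_top)] at hu
    simpa [toReal_gaussianPDF] using hu
  have h := integral_mul_deriv_eq_deriv_mul_of_integrable (u := f) (u' := f')
    (v := gaussianPDFReal 0 1) (v' := fun x => -(x * gaussianPDFReal 0 1 x))
    (fun x _ => hf x) (fun x _ => hpdf x)
    ((hI _ hxf).neg.congr (ae_of_all _ fun x => by simp; ring))
    ((hI _ hf').congr (ae_of_all _ fun x => by simp; ring))
    ((hI _ hfi).congr (ae_of_all _ fun x => by simp; ring))
  rw [integral_gaussianReal_eq_integral_smul one_ne_zero,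
    integral_gaussianReal_eq_integral_smul one_ne_zero]
  simp only [smul_eq_mul]
  have e1 : ∫ x, gaussianPDFReal 0 1 x * (x * f x) =
      - ∫ x, f x * -(x * gaussianPDFReal 0 1 x) := by
    rw [← integral_neg]
    exact integral_congr_ae (ae_of_all _ fun x => by simp only; ring)
  rw [e1, h, neg_neg]
  exact integral_congr_ae (ae_of_all _ fun x => by simp only; ring)

/-- Fubini isolates coordinate k, and almost every slice satisfies the one-dimensional identity. -/
theorem integral_eval_mul_pi_gaussianReal {n : ℕ} (k : Fin n) {f f' : (Fin n → ℝ) → ℝ}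
    (hf : ∀ x t, HasDerivAt (fun t => f (Function.update x k t)) (f' (Function.update x k t)) t)
    (hfi : Integrable f (Measure.pi fun _ : Fin n => gaussianReal 0 1))
    (hf' : Integrable f' (Measure.pi fun _ : Fin n => gaussianReal 0 1))
    (hxf : Integrable (fun x => x k * f x) (Measure.pi fun _ : Fin n => gaussianReal 0 1)) :
    ∫ x, x k * f x ∂(Measure.pi fun _ : Fin n => gaussianReal 0 1) =
      ∫ x, f' x ∂(Measure.pi fun _ : Fin n => gaussianReal 0 1) := by
  cases n with
  | zero => exact k.elim0
  | succ n =>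
    set π' := Measure.pi fun _ : Fin n => gaussianReal 0 1
    have hmp := (measurePreserving_piFinSuccAbove
      (fun _ : Fin (n + 1) => gaussianReal 0 1) k).symm
    have hint : ∀ u : (Fin (n + 1) → ℝ) → ℝ,
        Integrable u (Measure.pi fun _ : Fin (n + 1) => gaussianReal 0 1) →
        Integrable (fun z : ℝ × (Fin n → ℝ) => u (k.insertNth z.1 z.2))
          ((gaussianReal 0 1).prod π') := fun u hu =>
      (hmp.integrable_comp_emb (MeasurableEquiv.measurableEmbedding _)).2 hu
    have hcomp : ∀ u : (Fin (n + 1) → ℝ) → ℝ,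
        Integrable u (Measure.pi fun _ : Fin (n + 1) => gaussianReal 0 1) →
        ∫ x, u x ∂(Measure.pi fun _ : Fin (n + 1) => gaussianReal 0 1) =
          ∫ y, ∫ t, u (k.insertNth t y) ∂gaussianReal 0 1 ∂π' := by
      intro u hu
      rw [← integral_prod_symm _ (hint u hu)]
      exact (hmp.integral_comp (MeasurableEquiv.measurableEmbedding _) u).symm
    rw [hcomp _ hxf, hcomp _ hf']
    have h1 := (hint _ hfi).prod_left_ae
    have h2 := (hint _ hf').prod_left_ae
    have h3 := (hint _ hxf).prod_left_ae
    refine integral_congr_ae ?_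
    filter_upwards [h1, h2, h3] with y h1 h2 h3
    simp only [Fin.insertNth_apply_same] at h3 ⊢
    refine integral_id_mul_gaussianReal (fun t => ?_) h1 h2 h3
    have := hf (k.insertNth 0 y) t
    simpa using this

variable {d : ℕ}

theorem abs_le_add_of_norm_deriv_le {E : Type*} [NormedAddCommGroup E] [NormedSpace ℝ E]
    {f : E → ℝ} {L : E → E →L[ℝ] ℝ} (hf : ∀ x, HasFDerivAt f (L x) x) {C : ℝ}
    (hC : ∀ x, ‖L x‖ ≤ C) (x : E) : |f x| ≤ |f 0| + C * ‖x‖ := by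
  have := convex_univ.norm_image_sub_le_of_norm_hasFDerivWithin_le
    (fun y _ => (hf y).hasFDerivWithinAt) (fun y _ => hC y) (Set.mem_univ 0) (Set.mem_univ x)
  rw [sub_zero, Real.norm_eq_abs] at this
  have h2 := abs_sub_abs_le_abs_sub (f x) (f 0)
  linarith

/-- A bounded derivative forces linear growth, which makes f square integrable against the Gaussian
law. -/
theorem integral_eval_mul_stdGaussian {f : EuclideanSpace ℝ (Fin d) → ℝ}
    {L : EuclideanSpace ℝ (Fin d) → EuclideanSpace ℝ (Fin d) →L[ℝ] ℝ}
    (hf : ∀ x, HasFDerivAt f (L x) x) (hL : Continuous L) {C : ℝ} (hC : ∀ x, ‖L x‖ ≤ C)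
    (k : Fin d) :
    Integrable (fun x : EuclideanSpace ℝ (Fin d) => x k * f x) (stdGaussian (EuclideanSpace ℝ (Fin d))) ∧
    ∫ x, x k * f x ∂stdGaussian (EuclideanSpace ℝ (Fin d)) =
      ∫ x, L x (EuclideanSpace.single k 1) ∂stdGaussian (EuclideanSpace ℝ (Fin d)) := by
  have hfc : Continuous f := continuous_iff_continuousAt.2 fun x => (hf x).continuousAt
  have hgrow := abs_le_add_of_norm_deriv_le hf hC
  have hC0 : 0 ≤ C := (norm_nonneg _).trans (hC 0)
  have hid : MemLp (fun x : EuclideanSpace ℝ (Fin d) => x) 2 (stdGaussian (EuclideanSpace ℝ (Fin d))) :=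
    IsGaussian.memLp_two_id
  have hn : MemLp (fun x : EuclideanSpace ℝ (Fin d) => ‖x‖) 2
      (stdGaussian (EuclideanSpace ℝ (Fin d))) := hid.norm
  have hb : MemLp (fun x : EuclideanSpace ℝ (Fin d) => |f 0| + C * ‖x‖) 2 (stdGaussian (EuclideanSpace ℝ (Fin d))) :=
    MemLp.add (f := fun _ => |f 0|) (g := fun x => C * ‖x‖) (memLp_const |f 0|) (hn.const_mul C)
  have hf2 : MemLp f 2 (stdGaussian (EuclideanSpace ℝ (Fin d))) := hb.mono hfc.aestronglyMeasurable
    (ae_of_all _ fun x => (hgrow x).trans (le_abs_self _))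
  have hk : MemLp (fun x : EuclideanSpace ℝ (Fin d) => x k) 2 (stdGaussian (EuclideanSpace ℝ (Fin d))) :=
    hid.mono (by fun_prop) (ae_of_all _ fun x => PiLp.norm_apply_le x k)
  have hxf : Integrable (fun x : EuclideanSpace ℝ (Fin d) => x k * f x) (stdGaussian (EuclideanSpace ℝ (Fin d))) :=
    hk.integrable_mul hf2
  have hLc : Continuous fun x => L x (EuclideanSpace.single k 1) := by fun_prop
  have hLi : Integrable (fun x => L x (EuclideanSpace.single k 1)) (stdGaussian (EuclideanSpace ℝ (Fin d))) :=
    Integrable.of_bound hLc.aestronglyMeasurable C (ae_of_all _ fun x =>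
      ((L x).le_opNorm _).trans (by simpa using hC x))
  refine ⟨hxf, ?_⟩
  have hmeas : AEMeasurable (WithLp.toLp 2) (Measure.pi fun _ : Fin d => gaussianReal 0 1) :=
    (by fun_prop : Measurable (WithLp.toLp 2 : (Fin d → ℝ) → _)).aemeasurable
  rw [← map_pi_eq_stdGaussian] at hxf hLi hf2 ⊢
  rw [integral_map hmeas hxf.aestronglyMeasurable, integral_map hmeas hLi.aestronglyMeasurable]
  refine integral_eval_mul_pi_gaussianReal k (f := fun x => f (WithLp.toLp 2 x))
    (f' := fun x => L (WithLp.toLp 2 x) (EuclideanSpace.single k 1)) (fun x t => ?_)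
    ((hf2.integrable one_le_two).comp_aemeasurable hmeas) (hLi.comp_aemeasurable hmeas)
    (hxf.comp_aemeasurable hmeas)
  have hcurve : HasDerivAt (fun t => WithLp.toLp 2 (Function.update x k t))
      (EuclideanSpace.single k (1 : ℝ)) t := by
    have h1 : (fun t => WithLp.toLp 2 (Function.update x k t)) = fun t =>
        WithLp.toLp 2 (Function.update x k 0) + t • EuclideanSpace.single k (1 : ℝ) := by
      ext t m
      by_cases hm : m = k
      · subst hm; simp
      · simp [hm]
    rw [h1]
    simpa using ((hasDerivAt_id t).smul_const (EuclideanSpace.single k (1 : ℝ))).const_add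
      (WithLp.toLp 2 (Function.update x k 0))
  exact (hf _).comp_hasDerivAt t hcurve

/-- The vector is the image of a standard Gaussian one under R = √S. One factor R comes from the
coordinate of the image and one from the chain rule; they recombine by R Rᵀ = S. -/
theorem integral_eval_mul_multivariateGaussian {S : Matrix (Fin d) (Fin d) ℝ}
    (hS : S.PosSemidef) {f : EuclideanSpace ℝ (Fin d) → ℝ}
    {L : EuclideanSpace ℝ (Fin d) → EuclideanSpace ℝ (Fin d) →L[ℝ] ℝ}
    (hf : ∀ x, HasFDerivAt f (L x) x) (hL : Continuous L) {C : ℝ} (hC : ∀ x, ‖L x‖ ≤ C)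
    (i : Fin d) :
    ∫ x, x i * f x ∂multivariateGaussian 0 S =
      ∑ j, S i j * ∫ x, L x (EuclideanSpace.single j 1) ∂multivariateGaussian 0 S := by
  have hfc : Continuous f := continuous_iff_continuousAt.2 fun x => (hf x).continuousAt
  set R := CFC.sqrt S
  set T : EuclideanSpace ℝ (Fin d) →L[ℝ] EuclideanSpace ℝ (Fin d) :=
    Matrix.toEuclideanCLM (𝕜 := ℝ) R
  have hRR : ∀ i j, ∑ k, R i k * R j k = S i j := by
    intro i j
    have h1 : R * R = S := CFC.sqrt_mul_sqrt_self _ hS.nonneg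
    have h2 : R.IsHermitian := (CFC.sqrt_nonneg S).isSelfAdjoint
    rw [← h1, Matrix.mul_apply]
    refine Finset.sum_congr rfl fun k _ => ?_
    rw [← h2.apply k j]
    simp
  have hTi : ∀ x i, T x i = ∑ k, R i k * x k := fun x i => by
    simp [T, Matrix.ofLp_toEuclideanCLM, Matrix.mulVec, dotProduct]
  have hT1 : ∀ k, T (EuclideanSpace.single k 1) = ∑ j, R j k • EuclideanSpace.single j (1 : ℝ) := by
    intro k
    ext m
    rw [hTi]
    simp [Finset.sum_apply, PiLp.single_apply, Pi.single_apply]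
  have hmap : multivariateGaussian 0 S = (stdGaussian (EuclideanSpace ℝ (Fin d))).map T := by
    simp [multivariateGaussian, T, R]
  have hTm : AEMeasurable T (stdGaussian (EuclideanSpace ℝ (Fin d))) :=
    T.continuous.measurable.aemeasurable
  have hLc : ∀ j, Continuous fun x => L x (EuclideanSpace.single j 1) := fun j => by fun_prop
  rw [hmap, integral_map hTm (by fun_prop)]
  simp_rw [integral_map hTm (hLc _).aestronglyMeasurable]
  have key : ∀ k, Integrable (fun x : EuclideanSpace ℝ (Fin d) => x k * f (T x))
        (stdGaussian (EuclideanSpace ℝ (Fin d))) ∧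
      ∫ x, x k * f (T x) ∂stdGaussian (EuclideanSpace ℝ (Fin d)) =
        ∫ x, (L (T x)).comp T (EuclideanSpace.single k 1)
          ∂stdGaussian (EuclideanSpace ℝ (Fin d)) := fun k =>
    integral_eval_mul_stdGaussian (f := f ∘ T) (L := fun x => (L (T x)).comp T)
    (fun x => (hf (T x)).comp x T.hasFDerivAt) (by fun_prop) (C := C * ‖T‖)
    (fun x => (ContinuousLinearMap.opNorm_comp_le _ _).trans
      (mul_le_mul_of_nonneg_right (hC _) (norm_nonneg _))) k
  have hLi : ∀ j, Integrable (fun x => L (T x) (EuclideanSpace.single j 1)) (stdGaussian (EuclideanSpace ℝ (Fin d))) :=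
    fun j => Integrable.of_bound ((hLc j).comp T.continuous).aestronglyMeasurable C
      (ae_of_all _ fun x => ((L (T x)).le_opNorm _).trans (by simpa using hC (T x)))
  simp_rw [hTi, Finset.sum_mul, mul_assoc]
  rw [integral_finsetSum _ fun k _ => (key k).1.const_mul (R i k)]
  simp_rw [integral_const_mul]
  have e : ∀ k, ∫ x, x k * f (T x) ∂stdGaussian (EuclideanSpace ℝ (Fin d)) =
      ∑ j, R j k * ∫ x, L (T x) (EuclideanSpace.single j 1) ∂stdGaussian (EuclideanSpace ℝ (Fin d)) := by
    intro k
    refine (key k).2.trans ?_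
    simp only [ContinuousLinearMap.comp_apply, hT1, map_sum, map_smul, smul_eq_mul]
    rw [integral_finsetSum _ fun j _ => (hLi j).const_mul (R j k)]
    simp_rw [integral_const_mul]
  simp_rw [e, Finset.mul_sum]
  rw [Finset.sum_comm]
  refine Finset.sum_congr rfl fun j _ => ?_
  rw [← hRR, Finset.sum_mul]
  exact Finset.sum_congr rfl fun k _ => by ring

end D4

end

/-! ### Interpolation between a random vector and a Gaussian one. -/

noncomputable section

namespace D4

variable {d : ℕ} {g : EuclideanSpace ℝ (Fin d) → ℝ}

namespace IsTest

theorem continuous (hg : IsTest g) : Continuous g := continuous_of_abs_sub_le hg.lip₀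

theorem continuous₁ (hg : IsTest g) (i : Fin d) : Continuous (pderiv i g) :=
  continuous_of_abs_sub_le (hg.lip₁ i)

theorem continuous₂ (hg : IsTest g) (i j : Fin d) : Continuous (pderiv j (pderiv i g)) :=
  continuous_of_abs_sub_le (hg.lip₂ i j)

theorem abs_le (hg : IsTest g) (x : EuclideanSpace ℝ (Fin d)) : |g x| ≤ |g 0| + ∑ i, |x i| := by
  have h1 := hg.lip₀ x 0
  have h2 := abs_sub_abs_le_abs_sub (g x) (g 0)
  simp only [PiLp.zero_apply, sub_zero] at h1
  linarith

/-- Gaussian integration by parts for first derivatives of test functions. -/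
theorem integral_eval_mul_pderiv (hg : IsTest g) {S : Matrix (Fin d) (Fin d) ℝ}
    (hS : S.PosSemidef) (i : Fin d) (x : EuclideanSpace ℝ (Fin d)) (c : ℝ) :
    ∫ y, y i * pderiv i g (x + c • y) ∂multivariateGaussian 0 S =
      c * ∑ j, S i j * ∫ y, pderiv j (pderiv i g) (x + c • y) ∂multivariateGaussian 0 S := by
  have hcont : Continuous fun y => grad (fun j => pderiv j (pderiv i g)) (x + c • y) := by
    unfold grad
    refine continuous_finsetSum _ fun j _ => ((hg.continuous₂ i j).comp (by fun_prop)).smul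
      continuous_const
  have hb : ∀ y, ‖grad (fun j => pderiv j (pderiv i g)) y‖ ≤
      ∑ j : Fin d, ‖(EuclideanSpace.proj j : EuclideanSpace ℝ (Fin d) →L[ℝ] ℝ)‖ := fun y => by
    refine (norm_sum_le _ _).trans (Finset.sum_le_sum fun j _ => ?_)
    rw [norm_smul]
    exact mul_le_of_le_one_left (norm_nonneg _) (hg.bound₂ i j y)
  have h := integral_eval_mul_multivariateGaussian hS
    (f := fun y => pderiv i g (x + c • y))
    (L := fun y => c • grad (fun j => pderiv j (pderiv i g)) (x + c • y)) (fun y => ?_)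
    (hcont.const_smul c) (C := |c| * ∑ j : Fin d,
      ‖(EuclideanSpace.proj j : EuclideanSpace ℝ (Fin d) →L[ℝ] ℝ)‖) (fun y => ?_) i
  · rw [h, Finset.mul_sum]
    refine Finset.sum_congr rfl fun j _ => ?_
    simp only [smul_apply, grad_single, smul_eq_mul, integral_const_mul]
    ring
  · have h1 : HasFDerivAt (fun y : EuclideanSpace ℝ (Fin d) => x + c • y)
        (c • ContinuousLinearMap.id ℝ (EuclideanSpace ℝ (Fin d))) y :=
      ((hasFDerivAt_id y).const_smul c).const_add x
    refine ((hg.hasFDerivAt₁ i (x + c • y)).comp y h1).congr_fderiv ?_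
    ext v
    simp
  · rw [norm_smul]
    exact mul_le_mul_of_nonneg_left (hb _) (abs_nonneg c)

variable {Ω : Type*} [MeasurableSpace Ω] {μ : Measure Ω} [IsProbabilityMeasure μ]
    {X : Ω → EuclideanSpace ℝ (Fin d)}

/-- A bound for the expectation of test functions from an approximate Stein equation, by
interpolation along `sin θ • X + cos θ • Y`, where `Y` is independent of `X` and satisfies the
integration by parts formula of a Gaussian vector. -/
theorem abs_integral_sub_integral_le (hg : IsTest g) {γ : Measure (EuclideanSpace ℝ (Fin d))}
    [IsProbabilityMeasure γ] {S : Fin d → Fin d → ℝ}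
    (hY : ∀ i, Integrable (fun y : EuclideanSpace ℝ (Fin d) => y i) γ)
    (hibp : ∀ i (x : EuclideanSpace ℝ (Fin d)) (c : ℝ), ∫ y, y i * pderiv i g (x + c • y) ∂γ =
      c * ∑ j, S i j * ∫ y, pderiv j (pderiv i g) (x + c • y) ∂γ)
    (hXm : Measurable X) (hX : ∀ i, Integrable (fun ω => X ω i) μ) {R : ℝ}
    (h : ∀ r c, 0 ≤ r → r ≤ 1 → |∑ i, ∫ ω, X ω i * pderiv i g (r • X ω + c) ∂μ -
      r * ∑ i, ∑ j, S i j * ∫ ω, pderiv j (pderiv i g) (r • X ω + c) ∂μ| ≤ r * R) :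
    |∫ ω, g (X ω) ∂μ - ∫ y, g y ∂γ| ≤ R / 2 := by
  set Z : ℝ → Ω × EuclideanSpace ℝ (Fin d) → EuclideanSpace ℝ (Fin d) := fun θ z =>
    Real.sin θ • X z.1 + Real.cos θ • z.2 with hZ
  have hZm : ∀ θ, Measurable (Z θ) := fun θ => by fun_prop
  -- A majorant free of θ, both for the ℓ¹ norm of the interpolation and for the θ-derivative of g
  -- along it.
  set b : Ω × EuclideanSpace ℝ (Fin d) → ℝ := fun z => ∑ i, (|X z.1 i| + |z.2 i|) with hb
  have hX' : ∀ i, Integrable (fun z : Ω × EuclideanSpace ℝ (Fin d) => X z.1 i) (μ.prod γ) :=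
    fun i => (hX i).comp_fst γ
  have hY' : ∀ i, Integrable (fun z : Ω × EuclideanSpace ℝ (Fin d) => z.2 i) (μ.prod γ) :=
    fun i => (hY i).comp_snd μ
  have hbi : Integrable b (μ.prod γ) :=
    integrable_finsetSum _ fun i _ => (hX' i).abs.add (hY' i).abs
  have hZb : ∀ θ z, ∑ i, |Z θ z i| ≤ b z := fun θ z => by
    refine Finset.sum_le_sum fun i _ => ?_
    change |Real.sin θ * X z.1 i + Real.cos θ * z.2 i| ≤ _
    refine (abs_add_le _ _).trans (add_le_add ?_ ?_)
    · rw [abs_mul]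
      exact mul_le_of_le_one_left (abs_nonneg _) (Real.abs_sin_le_one θ)
    · rw [abs_mul]
      exact mul_le_of_le_one_left (abs_nonneg _) (Real.abs_cos_le_one θ)
  have hGi : ∀ θ, Integrable (fun z => g (Z θ z)) (μ.prod γ) := fun θ =>
    ((integrable_const |g 0|).add hbi).mono
      (hg.continuous.measurable.comp (hZm θ)).aestronglyMeasurable (ae_of_all _ fun z =>
        ((hg.abs_le _).trans (add_le_add_right (hZb θ z) _)).trans (le_abs_self _))
  set G' : ℝ → Ω × EuclideanSpace ℝ (Fin d) → ℝ := fun θ z =>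
    ∑ i, pderiv i g (Z θ z) * (Real.cos θ * X z.1 i - Real.sin θ * z.2 i) with hG'
  have hum : ∀ i θ, Measurable fun z => pderiv i g (Z θ z) := fun i θ =>
    (hg.continuous₁ i).measurable.comp (hZm θ)
  have huX : ∀ i θ, Integrable (fun z => X z.1 i * pderiv i g (Z θ z)) (μ.prod γ) := fun i θ =>
    (hX' i).mul_bdd (c := 1) (hum i θ).aestronglyMeasurable (ae_of_all _ fun z => hg.bound₁ i _)
  have huY : ∀ i θ, Integrable (fun z => z.2 i * pderiv i g (Z θ z)) (μ.prod γ) := fun i θ =>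
    (hY' i).mul_bdd (c := 1) (hum i θ).aestronglyMeasurable (ae_of_all _ fun z => hg.bound₁ i _)
  have hv : ∀ i j θ, Integrable (fun z => pderiv j (pderiv i g) (Z θ z)) (μ.prod γ) :=
    fun i j θ => Integrable.of_bound
      ((hg.continuous₂ i j).measurable.comp (hZm θ)).aestronglyMeasurable 1
      (ae_of_all _ fun z => hg.bound₂ i j _)
  have hderiv : ∀ θ, HasDerivAt (fun θ => ∫ z, g (Z θ z) ∂μ.prod γ)
      (∫ z, G' θ z ∂μ.prod γ) θ := by
    intro θ
    refine (hasDerivAt_integral_of_dominated_loc_of_deriv_le (s := Set.univ) (bound := b)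
      Filter.univ_mem (Filter.Eventually.of_forall fun θ => (hGi θ).aestronglyMeasurable) (hGi θ)
      ?_ (ae_of_all _ fun z θ _ => ?_) hbi (ae_of_all _ fun z θ _ => ?_)).2
    · refine (Finset.measurable_sum _ fun i _ => (hum i θ).mul ?_).aestronglyMeasurable
      fun_prop
    · refine (Finset.abs_sum_le_sum_abs _ _).trans (Finset.sum_le_sum fun i _ => ?_)
      rw [abs_mul]
      refine (mul_le_of_le_one_left (abs_nonneg _) (hg.bound₁ i _)).trans
        ((abs_sub _ _).trans (add_le_add ?_ ?_))
      · rw [abs_mul]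
        exact mul_le_of_le_one_left (abs_nonneg _) (Real.abs_cos_le_one θ)
      · rw [abs_mul]
        exact mul_le_of_le_one_left (abs_nonneg _) (Real.abs_sin_le_one θ)
    · have hc : HasDerivAt (fun θ => Z θ z) (Real.cos θ • X z.1 + (-Real.sin θ) • z.2) θ :=
        ((Real.hasDerivAt_sin θ).smul_const _).add ((Real.hasDerivAt_cos θ).smul_const _)
      refine ((hg.hasFDerivAt₀ (Z θ z)).comp_hasDerivAt θ hc).congr_deriv ?_
      rw [grad_apply]
      refine Finset.sum_congr rfl fun i _ => ?_
      simp [sub_eq_add_neg]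
  -- Integration by parts in the second variable turns y_i into cos θ times second derivatives, so
  -- cos θ factors out. For each y there remains the Stein expression of h with r = sin θ and c =
  -- cos θ · y.
  have hform : ∀ θ, ∫ z, G' θ z ∂μ.prod γ = Real.cos θ * ∫ y,
      (∑ i, ∫ ω, X ω i * pderiv i g (Real.sin θ • X ω + Real.cos θ • y) ∂μ -
      Real.sin θ * ∑ i, ∑ j, S i j *
        ∫ ω, pderiv j (pderiv i g) (Real.sin θ • X ω + Real.cos θ • y) ∂μ) ∂γ := by
    intro θ
    have e1 : ∫ z, G' θ z ∂μ.prod γ = Real.cos θ * ∑ i, ∫ z, X z.1 i * pderiv i g (Z θ z) ∂μ.prod γ -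
        Real.sin θ * ∑ i, ∫ z, z.2 i * pderiv i g (Z θ z) ∂μ.prod γ := by
      rw [← integral_finsetSum _ fun i _ => huX i θ, ← integral_finsetSum _ fun i _ => huY i θ,
        ← integral_const_mul, ← integral_const_mul,
        ← integral_sub ((integrable_finsetSum _ fun i _ => huX i θ).const_mul _)
          ((integrable_finsetSum _ fun i _ => huY i θ).const_mul _)]
      refine integral_congr_ae (ae_of_all _ fun z => ?_)
      simp only [hG', Finset.mul_sum]
      rw [← Finset.sum_sub_distrib]
      exact Finset.sum_congr rfl fun i _ => by ring
    have e2 : ∀ i, ∫ z, z.2 i * pderiv i g (Z θ z) ∂μ.prod γ = Real.cos θ * ∑ j, S i j *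
        ∫ z, pderiv j (pderiv i g) (Z θ z) ∂μ.prod γ := by
      intro i
      rw [integral_prod _ (huY i θ)]
      simp only [hZ]
      simp_rw [hibp]
      rw [integral_const_mul, integral_finsetSum _ fun j _ =>
        ((hv i j θ).integral_prod_left).const_mul (S i j)]
      simp_rw [integral_const_mul]
      congr 1
      exact Finset.sum_congr rfl fun j _ => by rw [integral_prod _ (hv i j θ)]
    have e3 : ∀ i, ∫ z, X z.1 i * pderiv i g (Z θ z) ∂μ.prod γ =
        ∫ y, ∫ ω, X ω i * pderiv i g (Real.sin θ • X ω + Real.cos θ • y) ∂μ ∂γ := fun i =>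
      integral_prod_symm _ (huX i θ)
    have e4 : ∀ i j, ∫ z, pderiv j (pderiv i g) (Z θ z) ∂μ.prod γ =
        ∫ y, ∫ ω, pderiv j (pderiv i g) (Real.sin θ • X ω + Real.cos θ • y) ∂μ ∂γ := fun i j =>
      integral_prod_symm _ (hv i j θ)
    have i3 : ∀ i, Integrable
        (fun y => ∫ ω, X ω i * pderiv i g (Real.sin θ • X ω + Real.cos θ • y) ∂μ) γ := fun i =>
      (huX i θ).integral_prod_right
    have i4 : ∀ i j, Integrable
        (fun y => ∫ ω, pderiv j (pderiv i g) (Real.sin θ • X ω + Real.cos θ • y) ∂μ) γ :=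
      fun i j => (hv i j θ).integral_prod_right
    rw [e1, integral_sub (integrable_finsetSum _ fun i _ => i3 i)
      ((integrable_finsetSum _ fun i _ => integrable_finsetSum _ fun j _ =>
        (i4 i j).const_mul _).const_mul _), integral_finsetSum _ fun i _ => i3 i,
      integral_const_mul, integral_finsetSum _ fun i _ => integrable_finsetSum _ fun j _ =>
        (i4 i j).const_mul _]
    simp_rw [e2, e3]
    have e5 : ∀ i, ∫ y, ∑ j, S i j *
        ∫ ω, pderiv j (pderiv i g) (Real.sin θ • X ω + Real.cos θ • y) ∂μ ∂γ =
        ∑ j, S i j * ∫ z, pderiv j (pderiv i g) (Z θ z) ∂μ.prod γ := by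
      intro i
      rw [integral_finsetSum _ fun j _ => (i4 i j).const_mul _]
      simp_rw [integral_const_mul, e4]
    simp_rw [e5, ← Finset.mul_sum]
    ring
  have hbound : ∀ θ ∈ Set.Ico 0 (Real.pi / 2),
      |∫ z, G' θ z ∂μ.prod γ| ≤ R * (Real.sin θ * Real.cos θ) := by
    intro θ hθ
    have hs : 0 ≤ Real.sin θ := Real.sin_nonneg_of_nonneg_of_le_pi hθ.1
      (by linarith [hθ.2, Real.pi_pos])
    have hc : 0 ≤ Real.cos θ := Real.cos_nonneg_of_mem_Icc
      ⟨by linarith [hθ.1, Real.pi_pos], hθ.2.le⟩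
    rw [hform, abs_mul, abs_of_nonneg hc]
    have h1 := norm_integral_le_of_norm_le_const (μ := γ) (f := fun y =>
      ∑ i, ∫ ω, X ω i * pderiv i g (Real.sin θ • X ω + Real.cos θ • y) ∂μ -
      Real.sin θ * ∑ i, ∑ j, S i j *
        ∫ ω, pderiv j (pderiv i g) (Real.sin θ • X ω + Real.cos θ • y) ∂μ) (ae_of_all _ fun y =>
      h (Real.sin θ) (Real.cos θ • y) hs (Real.sin_le_one θ))
    rw [probReal_univ, mul_one] at h1
    refine (mul_le_mul_of_nonneg_left h1 hc).trans (le_of_eq (by ring))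
  -- The primitive R sin²θ / 2 of the derivative bound vanishes at 0 and equals R/2 at π/2.
  have hfin := image_norm_le_of_norm_deriv_right_le_deriv_boundary
    (f := fun θ => ∫ z, g (Z θ z) ∂μ.prod γ - ∫ z, g (Z 0 z) ∂μ.prod γ)
    (f' := fun θ => ∫ z, G' θ z ∂μ.prod γ) (a := 0) (b := Real.pi / 2)
    (B := fun θ => R * (Real.sin θ ^ 2 / 2)) (B' := fun θ => R * (Real.sin θ * Real.cos θ))
    (fun θ _ => ((hderiv θ).sub_const _).continuousAt.continuousWithinAt)
    (fun θ _ => ((hderiv θ).sub_const _).hasDerivWithinAt) (by simp)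
    (fun θ => by
      refine ((((Real.hasDerivAt_sin θ).pow 2).div_const 2).const_mul R).congr_deriv ?_
      push_cast
      ring) hbound (x := Real.pi / 2) ⟨by positivity, le_rfl⟩
  have hend : ∫ z, g (Z (Real.pi / 2) z) ∂μ.prod γ = ∫ ω, g (X ω) ∂μ := by
    simp only [hZ, Real.sin_pi_div_two, Real.cos_pi_div_two, one_smul, zero_smul, add_zero]
    rw [integral_fun_fst (f := fun ω => g (X ω))]
    simp
  have hstart : ∫ z, g (Z 0 z) ∂μ.prod γ = ∫ y, g y ∂γ := by
    simp only [hZ, Real.sin_zero, Real.cos_zero, one_smul, zero_smul, zero_add]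
    rw [integral_fun_snd (f := g)]
    simp
  rw [hend, hstart, Real.sin_pi_div_two, Real.norm_eq_abs] at hfin
  linarith

end IsTest

end D4

namespace Rademacher

variable {p : ℕ → ℝ} [hp : Fact (∀ k, p k ∈ Set.Ioo (0 : ℝ) 1)] {d : ℕ}
  {F : Fin d → Space → ℝ}

theorem measurable_vec {f : Fin d → Space → ℝ} (hf : ∀ i, Measurable (f i)) :
    Measurable (vec f) :=
  (by fun_prop : Measurable (WithLp.toLp 2 : (Fin d → ℝ) → _)).comp (measurable_pi_lambda _ hf)

theorem abs_integral_vec_avg_sub_le {g : EuclideanSpace ℝ (Fin d) → ℝ} (hg : D4.IsTest g)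
    (hF2 : ∀ i, MemLp (F i) 2 (law p)) (hF0 : ∀ i, ∫ ω, F i ω ∂law p = 0)
    (hF4 : ∀ i k, MemLp (D p k (F i)) 4 (law p)) (s : Finset ℕ) {S : Matrix (Fin d) (Fin d) ℝ}
    (hS : S.PosSemidef) :
    |∫ ω, g (vec (fun i => avg p s (F i)) ω) ∂law p - ∫ y, g y ∂multivariateGaussian 0 S| ≤
      steinBound p s F S / 2 := by
  have hc : ∀ i, Cylinder (avg p s (F i)) := fun i => cylinder_avg s (F i)
  have hY : ∀ i, Integrable (fun y : EuclideanSpace ℝ (Fin d) => y i) (multivariateGaussian 0 S) :=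
    fun i => (IsGaussian.integrable_id (μ := multivariateGaussian 0 S)).mono (by fun_prop)
      (ae_of_all _ fun y => PiLp.norm_apply_le y i)
  refine hg.abs_integral_sub_integral_le hY (hg.integral_eval_mul_pderiv hS) (measurable_vec fun i => (hc i).measurable)
    (fun i => (hc i).integrable) fun r c hr0 hr1 => ?_
  rcases hr0.eq_or_lt with rfl | hr0
  -- The rescaling by r⁻² is unavailable at r = 0, where the claim only says that the components are
  -- centred.
  · simp only [vec, zero_smul, zero_add, zero_mul, sub_zero, integral_mul_const]
    simp [integral_avg _ ((hF2 _).integrable one_le_two), hF0]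
  · have h := abs_stein_le (hg.testDerivs_rescale hr0 hr1 c) hF2 hF0 hF4 s S
    have e : ∀ i, ∫ ω, avg p s (F i) ω *
        (r⁻¹ * D4.pderiv i g (r • vec (fun i => avg p s (F i)) ω + c)) ∂law p =
        r⁻¹ * ∫ ω, avg p s (F i) ω *
          D4.pderiv i g (r • vec (fun i => avg p s (F i)) ω + c) ∂law p := fun i => by
      rw [← integral_const_mul]
      exact integral_congr_ae (ae_of_all _ fun ω => by simp only; ring)
    simp_rw [e, ← Finset.mul_sum] at h
    have h2 := mul_le_mul_of_nonneg_left h hr0.le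
    rw [← abs_of_pos hr0, ← abs_mul, abs_of_pos hr0, mul_sub, mul_inv_cancel_left₀ hr0.ne'] at h2
    exact h2

end Rademacher

end

/-! ### Approximation in L² by finitely many coordinates. -/

noncomputable section

namespace Rademacher

variable {p : ℕ → ℝ} [hp : Fact (∀ k, p k ∈ Set.Ioo (0 : ℝ) 1)]

open scoped symmDiff in
-- Measurable cylinders form an algebra generating the σ-algebra, so they approximate every
-- measurable set in measure; sums of indicators are dense in L².
theorem exists_cylinder_eLpNorm_sub_le {u : Space → ℝ} (hu : MemLp u 2 (law p)) {ε : ℝ≥0∞}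
    (hε : ε ≠ 0) : ∃ v, eLpNorm (u - v) 2 (law p) ≤ ε ∧ Cylinder v := by
  refine hu.induction_dense (by simp) Cylinder (fun c s hs _ ε hε => ?_)
    (fun _ _ hf hg => hf.add hg) (fun _ hf => hf.measurable.aestronglyMeasurable) hε
  obtain ⟨η, hη, h⟩ := exists_eLpNorm_indicator_le (p := 2) (μ := law p) (by simp) c hε
  have hd := Measure.MeasureDense.of_generateFrom_isSetAlgebra_finite (law p)
    (isSetAlgebra_measurableCylinders (α := fun _ : ℕ => ℤˣ))
    generateFrom_measurableCylinders.symm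
  obtain ⟨t, ht, hst⟩ := hd.approx s hs (measure_ne_top _ _) η (by exact_mod_cast hη)
  refine ⟨t.indicator fun _ => c, ?_, ?_⟩
  · rw [eLpNorm_indicator_sub_indicator]
    refine h _ ?_
    rw [symmDiff_comm]
    simpa using hst.le
  · obtain ⟨A, S, -, rfl⟩ := (mem_measurableCylinders t).1 ht
    refine ⟨A, fun x y hxy => ?_⟩
    have : x ∈ cylinder A S ↔ y ∈ cylinder A S := by
      have e : A.restrict x = A.restrict y := funext fun i => hxy i i.2
      change A.restrict x ∈ S ↔ A.restrict y ∈ S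
      rw [e]
    by_cases hx : x ∈ cylinder A S
    · simp [hx, this.1 hx]
    · have hy : y ∉ cylinder A S := fun h => hx (this.2 h)
      simp [hx, hy]

theorem integral_sq_eq_eLpNorm {Ω : Type*} [MeasurableSpace Ω] {μ : Measure Ω} {u : Ω → ℝ}
    (hu : MemLp u 2 μ) : ∫ ω, u ω ^ 2 ∂μ = (eLpNorm u 2 μ).toReal ^ 2 := by
  rw [hu.eLpNorm_eq_integral_rpow_norm (by simp) (by simp)]
  have h0 : 0 ≤ ∫ ω, u ω ^ 2 ∂μ := integral_nonneg fun _ => sq_nonneg _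
  simp only [ENNReal.toReal_ofNat, Real.rpow_ofNat, Real.norm_eq_abs, sq_abs]
  rw [ENNReal.toReal_ofReal (Real.rpow_nonneg h0 _), ← Real.rpow_natCast, ← Real.rpow_mul h0]
  simp

/-- Averaging fixes a cylinder function as soon as `range n` contains its coordinates, and it
contracts L²; density does the rest. -/
theorem tendsto_integral_sq_avg_sub {u : Space → ℝ} (hu : MemLp u 2 (law p)) :
    Filter.Tendsto (fun n => ∫ ω, (avg p (Finset.range n) u ω - u ω) ^ 2 ∂law p)
      Filter.atTop (nhds 0) := by
  rw [Metric.tendsto_atTop]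
  intro ε hε
  -- The square of a difference costs a factor 2 on each of two terms of size at most ε/8, for a
  -- total of ε/2.
  set δ := √(ε / 8) with hδ
  have hδ0 : 0 < δ := Real.sqrt_pos.2 (by positivity)
  obtain ⟨v, hv, hvc⟩ := exists_cylinder_eLpNorm_sub_le hu (ε := ENNReal.ofReal δ)
    (by simpa using hδ0)
  have hw : MemLp (fun ω => u ω - v ω) 2 (law p) := hu.sub (hvc.memLp 2)
  have hw2 : ∫ ω, (u ω - v ω) ^ 2 ∂law p ≤ ε / 8 := by
    rw [integral_sq_eq_eLpNorm hw]
    have : (eLpNorm (fun ω => u ω - v ω) 2 (law p)).toReal ≤ δ :=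
      ENNReal.toReal_le_of_le_ofReal hδ0.le hv
    refine (pow_le_pow_left₀ ENNReal.toReal_nonneg this 2).trans (le_of_eq ?_)
    rw [hδ, Real.sq_sqrt (by positivity)]
  obtain ⟨A, hA⟩ := hvc
  refine ⟨A.sup id + 1, fun n hn => ?_⟩
  have hsub : (A : Set ℕ) ⊆ (Finset.range n : Finset ℕ) := fun i hi => by
    have : i ≤ A.sup id := Finset.le_sup (f := id) (Finset.mem_coe.1 hi)
    simp only [Finset.coe_range, Set.mem_Iio]
    omega
  have hav := avg_of_dependsOn (p := p) (hA.mono hsub)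
  have hvc : Cylinder v := ⟨A, hA⟩
  have e : ∀ ω, avg p (Finset.range n) u ω - u ω =
      avg p (Finset.range n) (fun ω => u ω - v ω) ω - (u ω - v ω) := fun ω => by
    rw [avg_sub _ (hu.integrable one_le_two) hvc.integrable, hav]
    ring
  have hac := cylinder_avg (p := p) (Finset.range n) fun ω => u ω - v ω
  have hm := integral_sq_avg_le (Finset.range n) hw
  rw [Real.dist_0_eq_abs, abs_of_nonneg (integral_nonneg fun _ => sq_nonneg _)]
  simp_rw [e]
  calc _ ≤ ∫ ω, (2 * avg p (Finset.range n) (fun ω => u ω - v ω) ω ^ 2 +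
          2 * (u ω - v ω) ^ 2) ∂law p := by
        refine integral_mono ((hac.memLp 2).sub hw).integrable_sq
          (((hac.pow 2).integrable.const_mul 2).add (hw.integrable_sq.const_mul 2)) fun ω => ?_
        simp only
        nlinarith [sq_nonneg (avg p (Finset.range n) (fun ω => u ω - v ω) ω + (u ω - v ω))]
    _ = 2 * ∫ ω, avg p (Finset.range n) (fun ω => u ω - v ω) ω ^ 2 ∂law p +
          2 * ∫ ω, (u ω - v ω) ^ 2 ∂law p := by
        rw [integral_add ((hac.pow 2).integrable.const_mul 2) (hw.integrable_sq.const_mul 2),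
          integral_const_mul, integral_const_mul]
    _ < ε := by linarith

theorem tendsto_sqrt_integral_sq_avg_sub {u : Space → ℝ} (hu : MemLp u 2 (law p)) :
    Filter.Tendsto (fun n => √(∫ ω, (avg p (Finset.range n) u ω - u ω) ^ 2 ∂law p))
      Filter.atTop (nhds 0) := by
  simpa using (tendsto_integral_sq_avg_sub hu).sqrt

theorem abs_integral_mul_le_sqrt {Ω : Type*} [MeasurableSpace Ω] {μ : Measure Ω} {u v : Ω → ℝ}
    (hu : MemLp u 2 μ) (hv : MemLp v 2 μ) :
    |∫ ω, u ω * v ω ∂μ| ≤ √(∫ ω, u ω ^ 2 ∂μ) * √(∫ ω, v ω ^ 2 ∂μ) := by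
  refine abs_integral_le_integral_abs.trans ?_
  have := integral_mul_le_sqrt hu.norm hv.norm
  simpa [abs_mul] using this

theorem tendsto_integral_avg_mul_avg {u v : Space → ℝ} (hu : MemLp u 2 (law p))
    (hv : MemLp v 2 (law p)) :
    Filter.Tendsto (fun n => ∫ ω, avg p (Finset.range n) u ω * avg p (Finset.range n) v ω ∂law p)
      Filter.atTop (nhds (∫ ω, u ω * v ω ∂law p)) := by
  rw [tendsto_iff_dist_tendsto_zero]
  have hlim := ((tendsto_sqrt_integral_sq_avg_sub hu).mul_const (√(∫ ω, v ω ^ 2 ∂law p))).add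
    ((tendsto_sqrt_integral_sq_avg_sub hv).const_mul (√(∫ ω, u ω ^ 2 ∂law p)))
  rw [zero_mul, mul_zero, add_zero] at hlim
  refine squeeze_zero (fun _ => dist_nonneg) (fun n => ?_) hlim
  have ha := (cylinder_avg (p := p) (Finset.range n) u).memLp (p := p) 2
  have hb := (cylinder_avg (p := p) (Finset.range n) v).memLp (p := p) 2
  have hau : MemLp (fun ω => avg p (Finset.range n) u ω - u ω) 2 (law p) := ha.sub hu
  have hbv : MemLp (fun ω => avg p (Finset.range n) v ω - v ω) 2 (law p) := hb.sub hv
  have e : ∫ ω, avg p (Finset.range n) u ω * avg p (Finset.range n) v ω ∂law p -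
      ∫ ω, u ω * v ω ∂law p =
      ∫ ω, (avg p (Finset.range n) u ω - u ω) * avg p (Finset.range n) v ω ∂law p +
      ∫ ω, u ω * (avg p (Finset.range n) v ω - v ω) ∂law p := by
    have i₁ : Integrable (fun ω => avg p (Finset.range n) u ω * avg p (Finset.range n) v ω)
        (law p) := ha.integrable_mul hb
    have i₂ : Integrable (fun ω => u ω * v ω) (law p) := hu.integrable_mul hv
    have i₃ : Integrable (fun ω => (avg p (Finset.range n) u ω - u ω) *
        avg p (Finset.range n) v ω) (law p) := hau.integrable_mul hb
    have i₄ : Integrable (fun ω => u ω * (avg p (Finset.range n) v ω - v ω)) (law p) :=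
      hu.integrable_mul hbv
    rw [← integral_sub i₁ i₂, ← integral_add i₃ i₄]
    exact integral_congr_ae (ae_of_all _ fun ω => by ring)
  rw [Real.dist_eq, e]
  refine (abs_add_le _ _).trans (add_le_add ((abs_integral_mul_le_sqrt hau hb).trans ?_)
    (abs_integral_mul_le_sqrt hu hbv))
  exact mul_le_mul_of_nonneg_left (Real.sqrt_le_sqrt (integral_sq_avg_le _ hv)) (Real.sqrt_nonneg _)

variable {d : ℕ} {F : Fin d → Space → ℝ}

theorem tendsto_integral_comp_vec_avg {g : EuclideanSpace ℝ (Fin d) → ℝ} (hg : D4.IsTest g)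
    (hF : ∀ i, MemLp (F i) 2 (law p)) :
    Filter.Tendsto (fun n => ∫ ω, g (vec (fun i => avg p (Finset.range n) (F i)) ω) ∂law p)
      Filter.atTop (nhds (∫ ω, g (vec F ω) ∂law p)) := by
  rw [tendsto_iff_dist_tendsto_zero]
  have hlim := tendsto_finsetSum Finset.univ fun i _ => tendsto_sqrt_integral_sq_avg_sub (hF i)
  rw [Finset.sum_const_zero] at hlim
  refine squeeze_zero (fun _ => dist_nonneg) (fun n => ?_) hlim
  have hc : ∀ i, Cylinder (avg p (Finset.range n) (F i)) := fun i => cylinder_avg _ _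
  have hd : ∀ i, MemLp (fun ω => avg p (Finset.range n) (F i) ω - F i ω) 2 (law p) := fun i =>
    ((hc i).memLp 2).sub (hF i)
  have hgc := Cylinder.comp_vec hc g
  have hvm : AEStronglyMeasurable (vec F) (law p) := by
    have h1 : AEMeasurable (fun ω i => F i ω) (law p) :=
      aemeasurable_pi_lambda _ fun i => (hF i).aestronglyMeasurable.aemeasurable
    exact ((by fun_prop : Measurable (WithLp.toLp 2 : (Fin d → ℝ) → _)).comp_aemeasurable
      h1).aestronglyMeasurable
  have hgm : AEStronglyMeasurable (fun ω => g (vec F ω)) (law p) :=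
    hg.continuous.comp_aestronglyMeasurable hvm
  have hgi : Integrable (fun ω => g (vec F ω)) (law p) := by
    refine ((integrable_const |g 0|).add (integrable_finsetSum Finset.univ fun i _ =>
      ((hF i).integrable one_le_two).abs)).mono hgm (ae_of_all _ fun ω => ?_)
    exact (hg.abs_le _).trans (le_abs_self _)
  rw [Real.dist_eq, ← integral_sub hgc.integrable hgi]
  refine abs_integral_le_integral_abs.trans ?_
  calc _ ≤ ∫ ω, ∑ i, |avg p (Finset.range n) (F i) ω - F i ω| ∂law p := by
        refine integral_mono (hgc.integrable.sub hgi).abs (integrable_finsetSum _ fun i _ =>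
          ((hd i).integrable one_le_two).abs) fun ω => hg.lip₀ _ _
    _ = ∑ i, ∫ ω, |avg p (Finset.range n) (F i) ω - F i ω| ∂law p :=
        integral_finsetSum _ fun i _ => ((hd i).integrable one_le_two).abs
    _ ≤ _ := by
        refine Finset.sum_le_sum fun i _ => Real.le_sqrt_of_sq_le ?_
        have := sq_integral_le (hd i).norm
        simpa using this

/-- A single term of the ℓ⁴ sum, whose weight is a nonzero constant. -/
theorem memLp_four_D {G : Space → ℝ} (hG : MemLp G 2 (law p)) (h : FiniteFourth p G) (k : ℕ) :
    MemLp (D p k G) 4 (law p) := by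
  have hpq : 0 < p k * (1 - p k) := mul_pos (hp.out k).1 (sub_pos.2 (hp.out k).2)
  set c := (p k * (1 - p k)) ^ (-(1 / 4) : ℝ) with hc
  have hc0 : c ≠ 0 := (Real.rpow_pos_of_pos hpq _).ne'
  have hm : AEStronglyMeasurable (fun ω => c * D p k G ω) (law p) :=
    (hG.rademacherD k).aestronglyMeasurable.const_mul c
  have hlt : ∫⁻ ω, ENNReal.ofReal ((c * D p k G ω) ^ 4) ∂law p < ∞ :=
    (lintegral_mono fun ω => ENNReal.le_tsum (f := fun k : ℕ =>
      ENNReal.ofReal (((p k * (1 - p k)) ^ (-(1 / 4) : ℝ) * D p k G ω) ^ 4)) k).trans_lt h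
  have hi : Integrable (fun ω => (c * D p k G ω) ^ 4) (law p) :=
    (lintegral_ofReal_ne_top_iff_integrable (hm.pow 4)
      (ae_of_all _ fun ω => (by decide : Even 4).pow_nonneg _)).1 hlt.ne
  have h4 : MemLp (fun ω => c * D p k G ω) 4 (law p) := by
    rw [← integrable_norm_rpow_iff hm (by simp) (by simp)]
    refine hi.congr (ae_of_all _ fun ω => ?_)
    simp only [ENNReal.toReal_ofNat, Real.rpow_ofNat, Real.norm_eq_abs]
    rw [(by decide : Even 4).pow_abs]
  exact (h4.const_mul c⁻¹).congr_norm (hG.rademacherD k).aestronglyMeasurable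
    (ae_of_all _ fun ω => by simp [hc0])

/-! ### Real partial sums against the series in [0, ∞]. -/

theorem expect_eq {Z : Space → ℝ} (hZ : Integrable Z (law p)) (h0 : ∀ ω, 0 ≤ Z ω) :
    expect p Z = ENNReal.ofReal (∫ ω, Z ω ∂law p) :=
  (ofReal_integral_eq_lintegral_ofReal hZ (ae_of_all _ h0)).symm

theorem ofReal_sqrt {x : ℝ} (hx : 0 ≤ x) :
    ENNReal.ofReal (√x) = ENNReal.ofReal x ^ (1 / 2 : ℝ) := by
  rw [Real.sqrt_eq_rpow, ENNReal.ofReal_rpow_of_nonneg hx (by norm_num)]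

theorem ofReal_normMul {u v : Space → ℝ} (hu : MemLp u 4 (law p)) (hv : MemLp v 4 (law p)) :
    ENNReal.ofReal (normMul p u v) = expect p (fun ω => u ω ^ 2 * v ω ^ 2) ^ (1 / 2 : ℝ) := by
  have h := (hu.mul_of_four hv).integrable_sq
  simp only [mul_pow] at h
  rw [normMul, ofReal_sqrt (integral_nonneg fun _ => sq_nonneg _), expect_eq h
    fun ω => by positivity]
  simp only [mul_pow]

theorem sum_le_tsum_three (s : Finset ℕ) (f : ℕ → ℕ → ℕ → ℝ≥0∞) :
    ∑ m ∈ s, ∑ k ∈ s, ∑ l ∈ s, f k l m ≤ ∑' (k : ℕ) (l : ℕ) (m : ℕ), f k l m := by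
  rw [Finset.sum_comm]
  refine le_trans (Finset.sum_le_sum fun k _ => ?_) (ENNReal.sum_le_tsum s)
  rw [Finset.sum_comm]
  refine le_trans (Finset.sum_le_sum fun l _ => ?_) (ENNReal.sum_le_tsum s)
  exact ENNReal.sum_le_tsum s

theorem normMul_nonneg (u v : Space → ℝ) : 0 ≤ normMul p u v := Real.sqrt_nonneg _

variable {G H : Space → ℝ}

theorem sumT_nonneg (s : Finset ℕ) (G H : Space → ℝ) : 0 ≤ sumT p s G H :=
  Finset.sum_nonneg fun _ _ => Finset.sum_nonneg fun _ _ => Finset.sum_nonneg fun _ _ =>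
    mul_nonneg (normMul_nonneg _ _) (normMul_nonneg _ _)

theorem one_div_pq_pos (k : ℕ) : 0 < 1 / (p k * (1 - p k)) :=
  one_div_pos.2 (mul_pos (hp.out k).1 (sub_pos.2 (hp.out k).2))

theorem sumU_nonneg (s : Finset ℕ) (G H : Space → ℝ) : 0 ≤ sumU p s G H :=
  Finset.sum_nonneg fun m _ => mul_nonneg (one_div_pq_pos m).le (Finset.sum_nonneg fun _ _ =>
    Finset.sum_nonneg fun _ _ => mul_nonneg (normMul_nonneg _ _) (normMul_nonneg _ _))

/-- The factor 3/2 = 1 + 1/2 is that of `ofReal_steinBound_le`; its square 9/4 is below the 15/4 of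
`B₁`. -/
theorem ofReal_sumT_le (s : Finset ℕ) (hG : ∀ k, MemLp (D p k G) 4 (law p))
    (hH : ∀ k, MemLp (D p k H) 4 (law p)) :
    ENNReal.ofReal (3 / 2 * √(sumT p s G H)) ≤ B₁ p G H := by
  have h0 := sumT_nonneg (p := p) s G H
  have h1 : (3 / 2 * √(sumT p s G H)) = √(9 / 4 * sumT p s G H) := by
    rw [Real.sqrt_mul (by norm_num), show (9 / 4 : ℝ) = (3 / 2) ^ 2 by norm_num,
      Real.sqrt_sq (by norm_num)]
  rw [h1, ofReal_sqrt (by positivity), B₁, ENNReal.ofReal_mul (by norm_num)]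
  refine ENNReal.rpow_le_rpow (mul_le_mul' ?_ ?_) (by norm_num)
  · rw [show (15 / 4 : ℝ≥0∞) = ENNReal.ofReal (15 / 4) by
      rw [ENNReal.ofReal_div_of_pos (by norm_num)]; simp]
    exact ENNReal.ofReal_le_ofReal (by norm_num)
  · refine le_trans (le_of_eq ?_) (sum_le_tsum_three s _)
    have hn : ∀ k l m, 0 ≤ normMul p (D p k G) (D p l G) *
        normMul p (D p m (D p k H)) (D p m (D p l H)) := fun k l m =>
      mul_nonneg (normMul_nonneg _ _) (normMul_nonneg _ _)
    rw [sumT, ENNReal.ofReal_sum_of_nonneg fun m _ => Finset.sum_nonneg fun k _ =>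
      Finset.sum_nonneg fun l _ => hn k l m]
    refine Finset.sum_congr rfl fun m _ => ?_
    rw [ENNReal.ofReal_sum_of_nonneg fun k _ => Finset.sum_nonneg fun l _ => hn k l m]
    refine Finset.sum_congr rfl fun k _ => ?_
    rw [ENNReal.ofReal_sum_of_nonneg fun l _ => hn k l m]
    refine Finset.sum_congr rfl fun l _ => ?_
    rw [ENNReal.ofReal_mul (normMul_nonneg _ _), ofReal_normMul (hG k) (hG l),
      ofReal_normMul ((hH k).rademacherD m) ((hH l).rademacherD m)]

/-- Here (1/2)² = 1/4 is below the 3/4 of `B₂`. -/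
theorem ofReal_sumU_le (s : Finset ℕ) (hG : ∀ k, MemLp (D p k G) 4 (law p))
    (hH : ∀ k, MemLp (D p k H) 4 (law p)) :
    ENNReal.ofReal (1 / 2 * √(sumU p s G H)) ≤ B₂ p G H := by
  have h0 := sumU_nonneg (p := p) s G H
  have h1 : (1 / 2 * √(sumU p s G H)) = √(1 / 4 * sumU p s G H) := by
    rw [Real.sqrt_mul (by norm_num), show (1 / 4 : ℝ) = (1 / 2) ^ 2 by norm_num,
      Real.sqrt_sq (by norm_num)]
  rw [h1, ofReal_sqrt (by positivity), B₂, ENNReal.ofReal_mul (by norm_num)]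
  refine ENNReal.rpow_le_rpow (mul_le_mul' ?_ ?_) (by norm_num)
  · rw [show (3 / 4 : ℝ≥0∞) = ENNReal.ofReal (3 / 4) by
      rw [ENNReal.ofReal_div_of_pos (by norm_num)]; simp]
    exact ENNReal.ofReal_le_ofReal (by norm_num)
  · refine le_trans (le_of_eq ?_) (sum_le_tsum_three s _)
    have hn : ∀ k l m, 0 ≤ normMul p (D p m (D p k G)) (D p m (D p l G)) *
        normMul p (D p m (D p k H)) (D p m (D p l H)) := fun k l m =>
      mul_nonneg (normMul_nonneg _ _) (normMul_nonneg _ _)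
    rw [sumU, ENNReal.ofReal_sum_of_nonneg fun m _ => mul_nonneg (one_div_pq_pos m).le
      (Finset.sum_nonneg fun k _ => Finset.sum_nonneg fun l _ => hn k l m)]
    refine Finset.sum_congr rfl fun m _ => ?_
    rw [ENNReal.ofReal_mul (one_div_pq_pos m).le, ENNReal.ofReal_sum_of_nonneg fun k _ =>
      Finset.sum_nonneg fun l _ => hn k l m, Finset.mul_sum]
    refine Finset.sum_congr rfl fun k _ => ?_
    rw [ENNReal.ofReal_sum_of_nonneg fun l _ => hn k l m, Finset.mul_sum]
    refine Finset.sum_congr rfl fun l _ => ?_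
    rw [ENNReal.ofReal_mul (normMul_nonneg _ _),
      ofReal_normMul ((hG k).rademacherD m) ((hG l).rademacherD m),
      ofReal_normMul ((hH k).rademacherD m) ((hH l).rademacherD m), mul_assoc]

theorem _root_.MeasureTheory.MemLp.integrable_pow_four {Ω : Type*} [MeasurableSpace Ω]
    {μ : Measure Ω} {u : Ω → ℝ} (hu : MemLp u 4 μ) : Integrable (fun ω => u ω ^ 4) μ := by
  have := hu.sq_of_four.integrable_sq
  simp only [← pow_mul] at this
  exact this

theorem ofReal_sumV_le (s : Finset ℕ) (hG : ∀ k, MemLp (D p k G) 4 (law p))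
    (hH : ∀ k, MemLp (D p k H) 4 (law p)) :
    ENNReal.ofReal (1 / 2 * d * sumV p s G H) ≤ B₃ p d G H := by
  rw [B₃, ENNReal.ofReal_mul (by positivity), ENNReal.ofReal_mul (by norm_num),
    ENNReal.ofReal_natCast]
  refine mul_le_mul' (mul_le_mul' ?_ ?_) ?_
  · rw [ENNReal.ofReal_div_of_pos (by norm_num)]; simp
  -- The first power of d is raised to the power 3/2. Powers increase with the exponent only for a
  -- base of at least 1, so d = 0 is separate.
  · rcases Nat.eq_zero_or_pos d with rfl | hd
    · simp
    · conv_lhs => rw [← ENNReal.rpow_one (d : ℝ≥0∞)]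
      exact ENNReal.rpow_le_rpow_of_exponent_le (by exact_mod_cast hd) (by norm_num)
  · refine le_trans (le_of_eq ?_) (ENNReal.sum_le_tsum s)
    rw [sumV, ENNReal.ofReal_sum_of_nonneg fun k _ => by positivity]
    refine Finset.sum_congr rfl fun k _ => ?_
    rw [ENNReal.ofReal_mul (by positivity), ENNReal.ofReal_mul (by positivity),
      ofReal_sqrt (integral_nonneg fun _ => by positivity),
      ofReal_sqrt (integral_nonneg fun _ => by positivity),
      expect_eq (hG k).two_of_four.integrable_sq fun _ => by positivity,
      expect_eq (hH k).integrable_pow_four fun _ => by positivity, mul_assoc]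

theorem ofReal_sumW_le (s : Finset ℕ) (hG : ∀ k, MemLp (D p k G) 4 (law p))
    (hH : ∀ k, MemLp (D p k H) 4 (law p)) :
    ENNReal.ofReal (5 / 12 * d ^ 2 * sumW p s G H) ≤ B₄ p d G H := by
  have hn : ∀ k (u : Space → ℝ), 0 ≤ ∫ ω, D p k u ω ^ 4 ∂law p := fun k u =>
    integral_nonneg fun _ => by positivity
  rw [B₄, ENNReal.ofReal_mul (by positivity), ENNReal.ofReal_mul (by norm_num),
    ENNReal.ofReal_pow (by positivity), ENNReal.ofReal_natCast]
  refine mul_le_mul' (mul_le_mul' ?_ le_rfl) ?_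
  · rw [ENNReal.ofReal_div_of_pos (by norm_num)]; simp
  · refine le_trans (le_of_eq ?_) (ENNReal.sum_le_tsum s)
    rw [sumW, ENNReal.ofReal_sum_of_nonneg fun k _ => mul_nonneg (one_div_pq_pos k).le
      (by positivity)]
    refine Finset.sum_congr rfl fun k _ => ?_
    -- Nested square roots give the exponent 1/4, and 1/4 + 1/2 = 3/4.
    rw [ENNReal.ofReal_mul (one_div_pq_pos k).le, ENNReal.ofReal_mul (by positivity),
      ENNReal.ofReal_mul (by positivity), ofReal_sqrt (Real.sqrt_nonneg _), ofReal_sqrt (hn k G),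
      ofReal_sqrt (Real.sqrt_nonneg _), ofReal_sqrt (hn k H),
      expect_eq (hG k).integrable_pow_four fun _ => by positivity,
      expect_eq (hH k).integrable_pow_four fun _ => by positivity, mul_assoc,
      ← ENNReal.rpow_mul, ← ENNReal.rpow_mul, ← ENNReal.rpow_add_of_nonneg _ _ (by norm_num)
        (by norm_num)]
    norm_num

theorem ofReal_steinBound_le (s : Finset ℕ) (hF4 : ∀ i k, MemLp (D p k (F i)) 4 (law p))
    (S : Matrix (Fin d) (Fin d) ℝ) :
    ENNReal.ofReal (steinBound p s F S) ≤ ∑ i, ∑ j,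
      (ENNReal.ofReal |S i j - ∫ ω, avg p s (F i) ω * avg p s (F j) ω ∂law p| +
        B₁ p (F i) (F j) + B₂ p (F i) (F j) + B₃ p d (F i) (F j) + B₄ p d (F i) (F j)) := by
  have e : steinBound p s F S = ∑ i, ∑ j,
      (|S i j - ∫ ω, avg p s (F i) ω * avg p s (F j) ω ∂law p| +
        3 / 2 * √(sumT p s (F i) (F j)) + 1 / 2 * √(sumU p s (F i) (F j)) +
        1 / 2 * d * sumV p s (F i) (F j) + 5 / 12 * d ^ 2 * sumW p s (F i) (F j)) := by
    -- Summed over all ordered pairs, the two mixed terms with coefficients 1 and 1/2 merge into one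
    -- with coefficient 3/2.
    have hswap : ∑ i, ∑ j, √(sumT p s (F j) (F i)) = ∑ i, ∑ j, √(sumT p s (F i) (F j)) :=
      Finset.sum_comm
    simp only [steinBound, Finset.sum_add_distrib, ← Finset.mul_sum, hswap]
    ring
  have hV : ∀ i j, 0 ≤ 1 / 2 * d * sumV p s (F i) (F j) := fun i j =>
    mul_nonneg (by positivity) (Finset.sum_nonneg fun k _ => by positivity)
  have hW : ∀ i j, 0 ≤ 5 / 12 * (d : ℝ) ^ 2 * sumW p s (F i) (F j) := fun i j =>
    mul_nonneg (by positivity) (Finset.sum_nonneg fun k _ =>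
      mul_nonneg (one_div_pq_pos k).le (by positivity))
  have hT : ∀ i j, 0 ≤ |S i j - ∫ ω, avg p s (F i) ω * avg p s (F j) ω ∂law p| +
        3 / 2 * √(sumT p s (F i) (F j)) + 1 / 2 * √(sumU p s (F i) (F j)) := fun i j => by
    positivity
  have hn := fun i j => add_nonneg (add_nonneg (hT i j) (hV i j)) (hW i j)
  rw [e, ENNReal.ofReal_sum_of_nonneg fun i _ => Finset.sum_nonneg fun j _ => hn i j]
  refine Finset.sum_le_sum fun i _ => ?_
  rw [ENNReal.ofReal_sum_of_nonneg fun j _ => hn i j]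
  refine Finset.sum_le_sum fun j _ => ?_
  rw [ENNReal.ofReal_add (add_nonneg (hT i j) (hV i j)) (hW i j),
    ENNReal.ofReal_add (hT i j) (hV i j), ENNReal.ofReal_add (by positivity) (by positivity),
    ENNReal.ofReal_add (by positivity) (by positivity)]
  exact add_le_add (add_le_add (add_le_add (add_le_add le_rfl (ofReal_sumT_le s (hF4 i) (hF4 j)))
    (ofReal_sumU_le s (hF4 i) (hF4 j))) (ofReal_sumV_le s (hF4 i) (hF4 j)))
    (ofReal_sumW_le s (hF4 i) (hF4 j))

/-- Along s = `range n` the upper bound depends on n only through the covariances, which converge,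
as does the left side. The limit is taken in [0, ∞], so the series need not be finite. -/
theorem ofReal_abs_integral_sub_le {g : EuclideanSpace ℝ (Fin d) → ℝ} (hg : D4.IsTest g)
    (hF2 : ∀ i, MemLp (F i) 2 (law p)) (hF0 : ∀ i, ∫ ω, F i ω ∂law p = 0)
    (hF4 : ∀ i k, MemLp (D p k (F i)) 4 (law p)) {S : Matrix (Fin d) (Fin d) ℝ}
    (hS : S.PosSemidef) :
    ENNReal.ofReal |∫ ω, g (vec F ω) ∂law p - ∫ y, g y ∂multivariateGaussian 0 S| ≤
      (1 / 2) * ∑ i, ∑ j, (ENNReal.ofReal |S i j - cov[F i, F j; law p]| +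
        B₁ p (F i) (F j) + B₂ p (F i) (F j) + B₃ p d (F i) (F j) + B₄ p d (F i) (F j)) := by
  have hcov : ∀ i j, cov[F i, F j; law p] = ∫ ω, F i ω * F j ω ∂law p := fun i j => by
    rw [covariance_eq_sub (hF2 i) (hF2 j), hF0 i, zero_mul, sub_zero]
    rfl
  have h1 := ((ENNReal.continuous_ofReal.comp continuous_abs).tendsto _).comp
    ((tendsto_integral_comp_vec_avg hg hF2).sub_const (∫ y, g y ∂multivariateGaussian 0 S))
  have h2 : Filter.Tendsto (fun n => (1 / 2) * ∑ i, ∑ j, (ENNReal.ofReal |S i j -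
        ∫ ω, avg p (Finset.range n) (F i) ω * avg p (Finset.range n) (F j) ω ∂law p| +
        B₁ p (F i) (F j) + B₂ p (F i) (F j) + B₃ p d (F i) (F j) + B₄ p d (F i) (F j)))
      Filter.atTop (nhds ((1 / 2) * ∑ i, ∑ j, (ENNReal.ofReal |S i j - cov[F i, F j; law p]| +
        B₁ p (F i) (F j) + B₂ p (F i) (F j) + B₃ p d (F i) (F j) + B₄ p d (F i) (F j)))) := by
    refine ENNReal.Tendsto.const_mul (tendsto_finsetSum _ fun i _ => tendsto_finsetSum _
      fun j _ => ?_) (Or.inr (by simp))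
    refine Filter.Tendsto.add (Filter.Tendsto.add (Filter.Tendsto.add (Filter.Tendsto.add ?_
      tendsto_const_nhds) tendsto_const_nhds) tendsto_const_nhds) tendsto_const_nhds
    rw [hcov]
    exact ((ENNReal.continuous_ofReal.comp continuous_abs).tendsto _).comp
      ((tendsto_integral_avg_mul_avg (hF2 i) (hF2 j)).const_sub (S i j))
  refine le_of_tendsto_of_tendsto' h1 h2 fun n => ?_
  refine le_trans (ENNReal.ofReal_le_ofReal
    (abs_integral_vec_avg_sub_le hg hF2 hF0 hF4 (Finset.range n) hS)) ?_
  rw [div_eq_inv_mul, ENNReal.ofReal_mul (by norm_num)]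
  refine mul_le_mul' ?_ (ofReal_steinBound_le _ hF4 S)
  rw [ENNReal.ofReal_inv_of_pos (by norm_num)]
  simp

end Rademacher

end

theorem mainTheorem2 (p : ℕ → ℝ) (hp : ∀ k, p k ∈ Set.Ioo (0 : ℝ) 1)
    (d : ℕ) (F : Fin d → Rademacher.Space → ℝ)
    (hF1 : ∀ i, Rademacher.MemDom p 1 (F i))
    (hF0 : ∀ i, ∫ ω, F i ω ∂(Rademacher.law p) = 0)
    (hF4 : ∀ i, Rademacher.FiniteFourth p (F i))
    (hF2 : ∀ i, Rademacher.MemDom p 2 (F i))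
    (S : Matrix (Fin d) (Fin d) ℝ) (hS : S.PosSemidef)
    {Ω' : Type*} [MeasurableSpace Ω'] (P' : Measure Ω') [IsProbabilityMeasure P']
    (N : Ω' → EuclideanSpace ℝ (Fin d)) (hN : HasLaw N (multivariateGaussian 0 S) P') :
    D4.dist (fun ω => WithLp.toLp 2 fun i => F i ω) (Rademacher.law p) N P' ≤
      (1 / 2) * ∑ i, ∑ j,
        (ENNReal.ofReal |S i j - cov[F i, F j; Rademacher.law p]| +
          Rademacher.B₁ p (F i) (F j) + Rademacher.B₂ p (F i) (F j) +
          Rademacher.B₃ p d (F i) (F j) + Rademacher.B₄ p d (F i) (F j)) := by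
  have : Fact (∀ k, p k ∈ Set.Ioo (0 : ℝ) 1) := ⟨hp⟩
  refine iSup₂_le fun g hg => ?_
  have e : ∫ ω, g (N ω) ∂P' = ∫ y, g y ∂multivariateGaussian 0 S :=
    hN.integral_comp (f := g) hg.continuous.aestronglyMeasurable
  rw [e]
  exact Rademacher.ofReal_abs_integral_sub_le hg (fun i => (hF1 i).1) hF0
    (fun i => Rademacher.memLp_four_D (hF1 i).1 (hF4 i)) hS
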